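/- Let $M$ be a smooth finite-dimensional manifold (Hausdorff, $\sigma$-compact), $A\to M$ a smooth real vector bundle of finite rank, and $(A,[\cdot,\cdot],\rho)$ a Lie algebroid. Let $\pi\in\Gamma(\wedge^2A)$ be a bivector and $N:\Gamma(A)\to\Gamma(A)$ a $(1,1)$-tensor field ($C^\infty(M)$-linear map). Write $\pi^{\#}:\Gamma(A^*)\to\Gamma(A)$, $\langle\beta,\pi^\#\alpha\rangle=\pi(\alpha,\beta)$, and $N^*\alpha=\alpha\circ N$, and assume $N\pi^{\#}=\pi^{\#}N^*$. Notation. $[\cdot,\cdot]_{SN}$ is the Schouten–Nijenhuis bracket on $\Gamma(\wedge A)$. On the graded vector space $E=\Gamma(\wedge A)[2]$ (so $\Gamma(\wedge^pA)$ has degree $p-2$), put $l_2^{[\cdot,\cdot]}(P,Q)=(-1)^{p-1}[P,Q]_{SN}$ for $P\in\Gamma(\wedge^pA)$, and $l_1^{[\cdot,\cdot],\pi}(P)=[\pi,P]_{SN}$; the same notation is used for any skew-symmetric bracket with anchor satisfying the Leibniz rule. $\underline N:E\to E$ is the extension of $N$ to $\Gamma(\wedge A)$ as a derivation of $\wedge$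 vanishing on functions. A symmetric vector valued form on $E$ is a family $K=\sum_{n\ge0}K_n$ of graded symmetric $n$-linear maps $E^n\to E$ (elements of $E$ being $0$-forms). The insertion operator is $$\iota_KL(X_1,\dots,X_n)=\sum_{k+l-1=n}\ \sum_{\sigma\in Sh(k,l-1)}\epsilon(\sigma)\,L_l\big(K_k(X_{\sigma(1)},\dots,X_{\sigma(k)}),X_{\sigma(k+1)},\dots,X_{\sigma(n)}\big)$$ with $\epsilon(\sigma)$ the Koszul sign, and $[K,L]_{RN}=\iota_KL-(-1)^{\bar K\bar L}\iota_LK$, where $\bar K,\bar L$ are the degrees of $K$ and $L$. For a form $\mu$ of degree $1$, a form $\mathcal N$ of degree $0$ is co-boundary Nijenhuis with respect to $\mu$ with square $\mathcal K$ (a form of degree $0$) if $[\mathcal N,[\mathcal N,\mu]_{RN}]_{RN}=[\mathcal K,\mu]_{RN}$; its curvature is its $0$-form component. A DGLA structure on $E$ (in the symmetric convention) is a form $\mu=l_1+l_2$ of degree $1$ with $\iota_\mu\mu=0$. The deformed structure $A_N=(A,[\cdot,\cdot]_N,\rho\circ N)$ has $[X,Y]_N=[NX,Y]+[X,NY]-N[X,Y]$.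 The pair $(N,\pi)$ is a Poisson–Nijenhuis structure if 1. $[NX,NY]=N[X,Y]_N$ for all $X,Y\in\Gamma(A)$; 2. $[\pi,\pi]_{SN}=0$; 3. $N\pi^\#=\pi^\#N^*$; 4. $\{N^*\alpha,\beta\}_\pi+\{\alpha,N^*\beta\}_\pi-N^*\{\alpha,\beta\}_\pi=\{\alpha,\beta\}_\pi^{N}$ for all $\alpha,\beta\in\Gamma(A^*)$, where $\{\alpha,\beta\}_\pi=\mathcal L_{\pi^\#\alpha}\beta-\mathcal L_{\pi^\#\beta}\alpha-\mathrm d(\pi(\alpha,\beta))$ is formed with $([\cdot,\cdot],\rho)$ and $\{\cdot,\cdot\}_\pi^{N}$ is given by the same formula formed with $([\cdot,\cdot]_N,\rho\circ N)$. Then: (a) $\underline N+\pi$ is a co-boundary Nijenhuis form, with curvature $\pi$, with respect to $l_2^{[\cdot,\cdot]}$, with square $\underline{N^2}$, if and only if $(N,\pi)$ is a Poisson–Nijenhuis structure on $(A,[\cdot,\cdot],\rho)$. (b) In this case $A_N$ is a Lie algebroid, $\pi$ is a Poisson bivector on $A_N$, and $l_1^{[\cdot,\cdot]_N,\pi}+l_2^{[\cdot,\cdot]_N}$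 is a DGLA structure on $E$. Moreover $[\underline N,l_2^{[\cdot,\cdot]}]_{RN}=l_2^{[\cdot,\cdot]_N}$, and the deformed structure is $$[\underline N+\pi,\,l_2^{[\cdot,\cdot]}]_{RN}=l_2^{[\cdot,\cdot]_N}-l_1^{[\cdot,\cdot],\pi},$$ which is also a DGLA structure on $E$. -/

import Mathlib

set_option linter.unusedSectionVars false

noncomputable section

namespace Algebroid

/-! ### Symmetric vector valued forms on graded vector spaces -/

section Forms

variable {E : Type*} [AddCommGroup E] [Module ℝ E]

/-- Formal sums `∑ₙ Kₙ` of maps `Kₙ : E ^ n → E`. -/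
abbrev FormalSum (E : Type*) := ∀ n : ℕ, (Fin n → E) → E

/-- An element of `E` as a vector valued zero-form. -/
def zeroForm (C : E) : FormalSum E
  | 0, _ => C
  | _ + 1, _ => 0

/-- A vector valued one-form. -/
def oneForm (f : E → E) : FormalSum E
  | 1, x => f (x 0)
  | _, _ => 0

/-- A vector valued two-form. -/
def twoForm (B : E → E → E) : FormalSum E
  | 2, x => B (x 0) (x 1)
  | _, _ => 0

/-- The zero-form component of a formal sum. -/
def curvature (K : FormalSum E) : E := K 0 Fin.elim0

/-- `(-1) ^ (s t)` for parities `s`, `t`. -/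
def paritySign (s t : ZMod 2) : ℤ := if s = 1 ∧ t = 1 then -1 else 1

/-- The Koszul sign `ε(σ)` of `X₁ ⋯ Xₙ ↦ X_σ(1) ⋯ X_σ(n)`, where `Xᵢ` has parity `s i`. -/
def koszulSign {n : ℕ} (s : Fin n → ZMod 2) (σ : Equiv.Perm (Fin n)) : ℤ :=
  ∏ p : Fin n × Fin n with p.1 < p.2 ∧ σ p.2 < σ p.1, paritySign (s (σ p.1)) (s (σ p.2))

/-- `(k, n - k)`-shuffles. -/
def IsShuffle (k : ℕ) {n : ℕ} (σ : Equiv.Perm (Fin n)) : Prop :=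
  ∀ i j : Fin n, i < j → ((j : ℕ) < k ∨ k ≤ (i : ℕ)) → σ i < σ j

instance (k n : ℕ) : DecidablePred (IsShuffle k (n := n)) := fun _ => by
  unfold IsShuffle; infer_instance

variable (𝒜 : ℤ → Submodule ℝ E)

/-- Graded symmetric multilinear maps `Kₙ` of degree `d`, for all `n`. -/
def IsSymmetricForm (d : ℤ) (K : FormalSum E) : Prop :=
  ∀ n, (∃ T : MultilinearMap ℝ (fun _ : Fin n => E) E, ∀ x, K n x = T x) ∧
    ∀ (deg : Fin n → ℤ) (x : Fin n → E), (∀ i, x i ∈ 𝒜 (deg i)) →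
      K n x ∈ 𝒜 (∑ i, deg i + d) ∧
      ∀ σ : Equiv.Perm (Fin n), K n x = koszulSign (fun i => (deg i : ZMod 2)) σ • K n (x ∘ σ)

variable [DirectSum.Decomposition 𝒜]

/-- The sum of the homogeneous components of `x` whose degree has parity `s`. -/
def parityPart (s : ZMod 2) (x : E) : E :=
  DirectSum.toModule ℝ ℤ E (fun i => if (i : ZMod 2) = s then (𝒜 i).subtype else 0)
    (DirectSum.decompose 𝒜 x)

/-- The insertion operator
`(ι_K L)(X₁, …, Xₙ) = ∑ₖ ∑_σ ε(σ) L(K(X_σ(1), …, X_σ(k)), X_σ(k+1), …, X_σ(n))`, the inner sum over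
the `(k, n - k)`-shuffles. The arguments are split into their parts of even and of odd degree, for
which the Koszul sign makes sense. -/
def insertion (K L : FormalSum E) : FormalSum E := fun n X =>
  ∑ k : Fin (n + 1), ∑ σ : Equiv.Perm (Fin n) with IsShuffle k σ, ∑ s : Fin n → ZMod 2,
    koszulSign s σ • L (n - k + 1) (Fin.cons
      (K k fun i => parityPart 𝒜 (s (σ (i.castLE (by omega)))) (X (σ (i.castLE (by omega)))))
      fun j : Fin (n - k) => parityPart 𝒜 (s (σ ⟨k + j, by omega⟩)) (X (σ ⟨k + j, by omega⟩)))

/-- The Richardson–Nijenhuis bracket `[K, L] = ι_K L - (-1) ^ (a b) ι_L K` of forms `K`, `L` of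
degrees `a`, `b`. -/
def rn (a b : ℤ) (K L : FormalSum E) : FormalSum E :=
  insertion 𝒜 K L - ((a * b).negOnePow : ℤ) • insertion 𝒜 L K

/-- `𝒩` is co-boundary Nijenhuis with respect to the form `μ` of degree one, with square `𝒦`. -/
structure IsCoboundaryNijenhuis (μ 𝒩 𝒦 : FormalSum E) : Prop where
  form : IsSymmetricForm 𝒜 1 μ
  form_nijenhuis : IsSymmetricForm 𝒜 0 𝒩
  form_square : IsSymmetricForm 𝒜 0 𝒦
  coboundary : rn 𝒜 0 1 𝒩 (rn 𝒜 0 1 𝒩 μ) = rn 𝒜 0 1 𝒦 μ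

/-- `L_∞`-structures (without curvature). -/
structure IsLInfinity (μ : FormalSum E) : Prop where
  form : IsSymmetricForm 𝒜 1 μ
  curvature_eq_zero : curvature μ = 0
  jacobi : insertion 𝒜 μ μ = 0

/-- Differential graded Lie algebra structures, in the symmetric convention: `L_∞`-structures with
a unary and a binary bracket only. -/
structure IsDGLA (μ : FormalSum E) : Prop extends IsLInfinity 𝒜 μ where
  higher : ∀ n, 3 ≤ n → μ n = 0

end Forms

section Algebra

variable {R L : Type*} [CommRing R] [AddCommGroup L] [Module R L]

open ExteriorAlgebra in
theorem ι_mul_comm (X : L) (P : ExteriorAlgebra R L) :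
    CliffordAlgebra.involute P * ι R X = ι R X * P := by
  induction P using CliffordAlgebra.left_induction with
  | algebraMap r => simp [Algebra.commutes]
  | add x y hx hy => simp [add_mul, mul_add, hx, hy]
  | ι_mul x m hx =>
    have h := ι_add_mul_swap (R := R) X m
    change ι R X * ι R m + ι R m * ι R X = 0 at h
    change CliffordAlgebra.involute (ι R m * x) * ι R X = ι R X * (ι R m * x)
    rw [map_mul, mul_assoc, hx, ← mul_assoc, ← mul_assoc]
    rw [show (CliffordAlgebra.involute (ι R m) : ExteriorAlgebra R L) = - ι R m from
      CliffordAlgebra.involute_ι m, eq_neg_of_add_eq_zero_left h, neg_mul, neg_mul]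

variable (R L) in
/-- Data for an additive map `D` of `⋀ L` with
`D 1 = 0`, `D (r a) = r D a + twist r a`, `D (X ∧ a) = X ∧ D a + step X a`. -/
structure ExtData where
  twist : R →+ Module.End R (ExteriorAlgebra R L)
  step : L →+ Module.End R (ExteriorAlgebra R L)
  twist_mul : ∀ r r', twist (r * r') = r • twist r' + r' • twist r
  step_smul : ∀ r X a, step (r • X) a = r • step X a + twist r (ExteriorAlgebra.ι R X * a)
  twist_comm : ∀ r X a,
    ExteriorAlgebra.ι R X * twist r a = twist r (ExteriorAlgebra.ι R X * a)
  step_sq : ∀ X a, step X (ExteriorAlgebra.ι R X * a) + ExteriorAlgebra.ι R X * step X a = 0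

namespace ExtData

variable (d : ExtData R L)

theorem twist_one : d.twist 1 = 0 := by
  have h := d.twist_mul 1 1
  simpa using h

/-- Pairs `(a, D a)`, with the scalar action `r (a, b) = (r a, r b + twist r a)`. -/
@[ext]
structure Pairs (_d : ExtData R L) where
  fst : ExteriorAlgebra R L
  snd : ExteriorAlgebra R L

/-- Pairs as elements of a product. -/
def Pairs.equiv : d.Pairs ≃ ExteriorAlgebra R L × ExteriorAlgebra R L where
  toFun p := (p.fst, p.snd)
  invFun p := ⟨p.1, p.2⟩
  left_inv _ := rfl
  right_inv _ := rfl

instance : AddCommGroup d.Pairs := (Pairs.equiv d).addCommGroup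

@[simp] theorem Pairs.fst_zero : (0 : d.Pairs).fst = 0 := rfl
@[simp] theorem Pairs.snd_zero : (0 : d.Pairs).snd = 0 := rfl
@[simp] theorem Pairs.fst_add (p q : d.Pairs) : (p + q).fst = p.fst + q.fst := rfl
@[simp] theorem Pairs.snd_add (p q : d.Pairs) : (p + q).snd = p.snd + q.snd := rfl

instance : SMul R d.Pairs := ⟨fun r p => ⟨r • p.fst, r • p.snd + d.twist r p.fst⟩⟩

@[simp] theorem Pairs.fst_smul (r : R) (p : d.Pairs) : (r • p).fst = r • p.fst := rfl
@[simp] theorem Pairs.snd_smul (r : R) (p : d.Pairs) :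
    (r • p).snd = r • p.snd + d.twist r p.fst := rfl

instance : Module R d.Pairs where
  one_smul p := by ext <;> simp [d.twist_one]
  mul_smul r r' p := by ext <;> simp [d.twist_mul, mul_smul, add_assoc]
  smul_zero r := by ext <;> simp
  smul_add r p q := by
    ext
    · simp
    · simp only [Pairs.snd_smul, Pairs.snd_add, Pairs.fst_add, smul_add, map_add]; abel
  add_smul r s p := by
    ext
    · simp [add_smul]
    · simp only [Pairs.snd_smul, Pairs.snd_add, add_smul, map_add, LinearMap.add_apply]; abel
  zero_smul p := by ext <;> simp

/-- `(a, b) ↦ (X ∧ a, X ∧ b + step X a)`. -/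
def stepPairs : L →ₗ[R] d.Pairs →ₗ[R] d.Pairs :=
  LinearMap.mk₂ R
    (fun X p => ⟨ExteriorAlgebra.ι R X * p.fst, ExteriorAlgebra.ι R X * p.snd + d.step X p.fst⟩)
    (fun X Y p => by
      ext
      · simp [add_mul]
      · simp only [map_add, add_mul, LinearMap.add_apply, Pairs.snd_add]; abel)
    (fun r X p => by
      ext
      · simp
      · simp only [map_smul, smul_mul_assoc, d.step_smul, smul_add, add_assoc, Pairs.snd_smul])
    (fun X p q => by
      ext
      · simp [mul_add]
      · simp only [map_add, mul_add, Pairs.snd_add, Pairs.fst_add]; abel)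
    (fun r X p => by
      ext
      · simp
      · simp only [map_smul, mul_smul_comm, mul_add, smul_add, d.twist_comm, Pairs.snd_smul,
          Pairs.fst_smul]
        abel)

/-- The map `a ↦ (a, D a)`. -/
def extendPairs : ExteriorAlgebra R L →ₗ[R] d.Pairs :=
  CliffordAlgebra.foldr (0 : QuadraticForm R L) d.stepPairs
    (fun X p => by
      ext
      · simp [stepPairs, ← mul_assoc]
      · have h := d.step_sq X p.fst
        simp only [stepPairs, LinearMap.mk₂_apply, mul_add, ← mul_assoc,
          ExteriorAlgebra.ι_sq_zero, zero_mul, zero_add]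
        rw [add_comm, h]; simp)
    ⟨1, 0⟩

/-- The map `D` determined by the data. -/
def extend (a : ExteriorAlgebra R L) : ExteriorAlgebra R L := (d.extendPairs a).snd

theorem extendPairs_ι_mul (X : L) (a : ExteriorAlgebra R L) :
    d.extendPairs (ExteriorAlgebra.ι R X * a) = d.stepPairs X (d.extendPairs a) := by
  unfold extendPairs
  erw [CliffordAlgebra.foldr_mul, CliffordAlgebra.foldr_ι]

theorem extendPairs_algebraMap (r : R) :
    d.extendPairs (algebraMap R _ r) = ⟨algebraMap R _ r, d.twist r 1⟩ := by
  unfold extendPairs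
  erw [CliffordAlgebra.foldr_algebraMap]
  ext <;> simp [Algebra.algebraMap_eq_smul_one]

theorem extendPairs_fst (a : ExteriorAlgebra R L) : (d.extendPairs a).fst = a := by
  induction a using CliffordAlgebra.left_induction with
  | algebraMap r => exact congrArg Pairs.fst (d.extendPairs_algebraMap r)
  | add x y hx hy => rw [map_add, Pairs.fst_add, hx, hy]
  | ι_mul x m hx =>
    refine (congrArg Pairs.fst (d.extendPairs_ι_mul m x)).trans ?_
    change ExteriorAlgebra.ι R m * (d.extendPairs x).fst = _
    rw [hx]

theorem extend_add (a b : ExteriorAlgebra R L) : d.extend (a + b) = d.extend a + d.extend b := by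
  unfold extend; rw [map_add]; rfl

theorem extend_smul (r : R) (a : ExteriorAlgebra R L) :
    d.extend (r • a) = r • d.extend a + d.twist r a := by
  unfold extend; rw [map_smul, Pairs.snd_smul, extendPairs_fst]

theorem extend_algebraMap (r : R) : d.extend (algebraMap R _ r) = d.twist r 1 :=
  congrArg Pairs.snd (d.extendPairs_algebraMap r)

theorem extend_ι_mul (X : L) (a : ExteriorAlgebra R L) :
    d.extend (ExteriorAlgebra.ι R X * a) = ExteriorAlgebra.ι R X * d.extend a + d.step X a := by
  refine (congrArg Pairs.snd (d.extendPairs_ι_mul X a)).trans ?_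
  change _ * (d.extendPairs a).snd + d.step X (d.extendPairs a).fst = _
  rw [extendPairs_fst]; rfl

end ExtData

/-- The extension by derivation of an endomorphism. -/
def derivExtData (N : L →ₗ[R] L) : ExtData R L where
  twist := 0
  step := AddMonoidHom.mk' (fun Y => LinearMap.mulLeft R (ExteriorAlgebra.ι R (N Y)))
    (fun Y Z => by ext a; simp [add_mul])
  twist_mul r r' := by simp
  step_smul r X a := by simp
  twist_comm r X a := by simp
  step_sq X a := by
    have h := ExteriorAlgebra.ι_add_mul_swap (R := R) (N X) X
    simp only [AddMonoidHom.mk'_apply, LinearMap.mulLeft_apply, ← mul_assoc, ← add_mul, h, zero_mul]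

variable [Algebra ℝ R] [Module ℝ L] [IsScalarTower ℝ R L]

variable (R L) in
/-- A skew-symmetric bracket on the `R`-module `L`, with an anchor into the derivations of `R`
such that the Leibniz rule holds. -/
structure PreBracket where
  bracket : L →ₗ[ℝ] L →ₗ[ℝ] L
  anchor : L →ₗ[R] Derivation ℝ R R
  bracket_self : ∀ X, bracket X X = 0
  leibniz : ∀ X Y (f : R), bracket X (f • Y) = f • bracket X Y + anchor X f • Y

namespace PreBracket

variable (𝔞 : PreBracket R L)

theorem bracket_swap (X Y : L) : 𝔞.bracket X Y = - 𝔞.bracket Y X := by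
  have h := 𝔞.bracket_self (X + Y)
  simp only [map_add, LinearMap.add_apply, 𝔞.bracket_self, zero_add, add_zero] at h
  exact eq_neg_of_add_eq_zero_right h

theorem leibniz_left (f : R) (X Y : L) :
    𝔞.bracket (f • X) Y = f • 𝔞.bracket X Y - 𝔞.anchor Y f • X := by
  rw [𝔞.bracket_swap, 𝔞.leibniz, 𝔞.bracket_swap X Y]; simp [sub_eq_add_neg, add_comm]

/-- The differential `d f = (X ↦ ρ(X) f)` of a function. -/
def dFun (f : R) : Module.Dual R L where
  toFun X := 𝔞.anchor X f
  map_add' X Y := by simp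
  map_smul' r X := by simp

@[simp] theorem dFun_apply (f : R) (X : L) : 𝔞.dFun f X = 𝔞.anchor X f := rfl

theorem dFun_add (f g : R) : 𝔞.dFun (f + g) = 𝔞.dFun f + 𝔞.dFun g := by ext; simp
theorem dFun_mul (f g : R) : 𝔞.dFun (f * g) = f • 𝔞.dFun g + g • 𝔞.dFun f := by ext; simp
theorem dFun_const (c : ℝ) : 𝔞.dFun (algebraMap ℝ R c) = 0 := by ext; simp

/-- The Lie derivative along `X` on `⋀ L`: the derivation with `f ↦ ρ(X) f`, `Y ↦ [X, Y]`. -/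
def lieExtData (X : L) : ExtData R L where
  twist := AddMonoidHom.mk' (fun r => 𝔞.anchor X r • LinearMap.id)
    (fun r r' => by simp [add_smul])
  step := AddMonoidHom.mk' (fun Y => LinearMap.mulLeft R (ExteriorAlgebra.ι R (𝔞.bracket X Y)))
    (fun Y Z => by ext a; simp [add_mul])
  twist_mul r r' := by
    ext a; simp [add_smul, mul_smul]
  step_smul r Y a := by simp [𝔞.leibniz, add_mul]
  twist_comm r Y a := by simp
  step_sq Y a := by
    have h := ExteriorAlgebra.ι_add_mul_swap (R := R) (𝔞.bracket X Y) Y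
    simp only [AddMonoidHom.mk'_apply, LinearMap.mulLeft_apply, ← mul_assoc, ← add_mul, h, zero_mul]

/-- The Lie derivative `𝓛_X` on `⋀ L`. -/
def lie (X : L) (a : ExteriorAlgebra R L) : ExteriorAlgebra R L := (𝔞.lieExtData X).extend a

theorem lie_add_right (X : L) (a b : ExteriorAlgebra R L) :
    𝔞.lie X (a + b) = 𝔞.lie X a + 𝔞.lie X b := ExtData.extend_add _ _ _

theorem lie_smul_right (X : L) (r : R) (a : ExteriorAlgebra R L) :
    𝔞.lie X (r • a) = r • 𝔞.lie X a + 𝔞.anchor X r • a := ExtData.extend_smul _ _ _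

theorem lie_algebraMap (X : L) (r : R) :
    𝔞.lie X (algebraMap R _ r) = 𝔞.anchor X r • 1 := ExtData.extend_algebraMap _ _

theorem lie_ι_mul (X Y : L) (a : ExteriorAlgebra R L) :
    𝔞.lie X (ExteriorAlgebra.ι R Y * a) =
      ExteriorAlgebra.ι R Y * 𝔞.lie X a + ExteriorAlgebra.ι R (𝔞.bracket X Y) * a :=
  ExtData.extend_ι_mul _ _ _

theorem lie_add_left (X Y : L) (a : ExteriorAlgebra R L) :
    𝔞.lie (X + Y) a = 𝔞.lie X a + 𝔞.lie Y a := by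
  induction a using CliffordAlgebra.left_induction with
  | algebraMap r =>
    erw [lie_algebraMap, lie_algebraMap, lie_algebraMap]; simp [add_smul]
  | add x y hx hy => simp only [lie_add_right, hx, hy]; abel
  | ι_mul a Z hx =>
    erw [lie_ι_mul, lie_ι_mul, lie_ι_mul, hx]
    simp only [map_add, LinearMap.add_apply, mul_add, add_mul]; abel

/-- Contraction of a form of degree one with an element of `⋀ L`. -/
def contract (α : Module.Dual R L) : ExteriorAlgebra R L →ₗ[R] ExteriorAlgebra R L :=
  CliffordAlgebra.contractLeft (Q := (0 : QuadraticForm R L)) α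

theorem contract_ι_mul (α : Module.Dual R L) (X : L) (a : ExteriorAlgebra R L) :
    contract α (ExteriorAlgebra.ι R X * a) = α X • a - ExteriorAlgebra.ι R X * contract α a :=
  CliffordAlgebra.contractLeft_ι_mul (Q := (0 : QuadraticForm R L)) α X a

theorem contract_algebraMap (α : Module.Dual R L) (r : R) :
    contract α (algebraMap R (ExteriorAlgebra R L) r) = 0 :=
  CliffordAlgebra.contractLeft_algebraMap (Q := (0 : QuadraticForm R L)) α r

theorem contract_add (α β : Module.Dual R L) : contract (α + β) = contract α + contract β :=
  map_add _ _ _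

theorem contract_smul (r : R) (α : Module.Dual R L) : contract (r • α) = r • contract α :=
  map_smul _ _ _

theorem lie_smul_left (r : R) (X : L) (a : ExteriorAlgebra R L) :
    𝔞.lie (r • X) a = r • 𝔞.lie X a - ExteriorAlgebra.ι R X * contract (𝔞.dFun r) a := by
  induction a using CliffordAlgebra.left_induction with
  | algebraMap s =>
    erw [lie_algebraMap, lie_algebraMap, contract_algebraMap]; simp [mul_smul]
  | add x y hx hy => simp only [lie_add_right, hx, hy, map_add, mul_add, smul_add]; abel
  | ι_mul a Y hx =>
    erw [lie_ι_mul, lie_ι_mul, contract_ι_mul, hx]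
    have h := ExteriorAlgebra.ι_add_mul_swap (R := R) X Y
    have h' : ExteriorAlgebra.ι R Y * (ExteriorAlgebra.ι R X * contract (𝔞.dFun r) a) =
        - (ExteriorAlgebra.ι R X * (ExteriorAlgebra.ι R Y * contract (𝔞.dFun r) a)) := by
      rw [← mul_assoc, ← mul_assoc, eq_neg_of_add_eq_zero_right h, neg_mul]
    simp only [leibniz_left, map_sub, map_smul, sub_mul, mul_sub, smul_mul_assoc, mul_smul_comm,
      smul_add, h', dFun_apply]
    abel

/-- Data for `P ↦ [P, Q]`. -/
def schoutenExtData (Q : ExteriorAlgebra R L) : ExtData R L where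
  twist := AddMonoidHom.mk' (fun r => - LinearMap.mulRight R (contract (𝔞.dFun r) Q))
    (fun r r' => by ext a; simp [dFun_add, contract_add, mul_add, add_comm])
  step := AddMonoidHom.mk'
    (fun X => LinearMap.mulRight R (𝔞.lie X Q) ∘ₗ CliffordAlgebra.involute.toLinearMap)
    (fun X Y => by ext a; simp [lie_add_left, mul_add])
  twist_mul r r' := by
    ext a
    simp [dFun_mul, contract_add, contract_smul, mul_add, add_comm]
  step_smul r X a := by
    have h := ι_mul_comm X a
    simp only [AddMonoidHom.mk'_apply, LinearMap.comp_apply, LinearMap.mulRight_apply,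
      AlgHom.toLinearMap_apply, LinearMap.neg_apply, lie_smul_left]
    rw [← h]
    erw [mul_sub]
    simp [sub_eq_add_neg, mul_assoc]
  twist_comm r X a := by simp [mul_assoc]
  step_sq X a := by
    have h : CliffordAlgebra.involute (ExteriorAlgebra.ι R X) = - ExteriorAlgebra.ι R X :=
      CliffordAlgebra.involute_ι X
    simp [h, mul_assoc]

/-- The Schouten–Nijenhuis bracket on `⋀ L`. -/
def schoutenAux (P Q : ExteriorAlgebra R L) : ExteriorAlgebra R L := (𝔞.schoutenExtData Q).extend P

theorem schoutenAux_add_left (P P' Q : ExteriorAlgebra R L) :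
    𝔞.schoutenAux (P + P') Q = 𝔞.schoutenAux P Q + 𝔞.schoutenAux P' Q := ExtData.extend_add _ _ _

theorem schoutenAux_smul_left (r : R) (P Q : ExteriorAlgebra R L) :
    𝔞.schoutenAux (r • P) Q = r • 𝔞.schoutenAux P Q - P * contract (𝔞.dFun r) Q := by
  rw [sub_eq_add_neg]; exact ExtData.extend_smul _ _ _

/-- `[f, Q] = - ι_{df} Q`. -/
theorem schoutenAux_algebraMap (r : R) (Q : ExteriorAlgebra R L) :
    𝔞.schoutenAux (algebraMap R _ r) Q = - contract (𝔞.dFun r) Q := by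
  refine (ExtData.extend_algebraMap _ _).trans ?_
  simp [schoutenExtData]

/-- `[X ∧ P, Q] = X ∧ [P, Q] + (-1) ^ p P ∧ [X, Q]` for `P` of degree `p`. -/
theorem schoutenAux_ι_mul (X : L) (P Q : ExteriorAlgebra R L) :
    𝔞.schoutenAux (ExteriorAlgebra.ι R X * P) Q =
      ExteriorAlgebra.ι R X * 𝔞.schoutenAux P Q + CliffordAlgebra.involute P * 𝔞.lie X Q :=
  ExtData.extend_ι_mul _ _ _

theorem schoutenAux_add_right (P Q Q' : ExteriorAlgebra R L) :
    𝔞.schoutenAux P (Q + Q') = 𝔞.schoutenAux P Q + 𝔞.schoutenAux P Q' := by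
  induction P using CliffordAlgebra.left_induction with
  | algebraMap r =>
    erw [schoutenAux_algebraMap, schoutenAux_algebraMap, schoutenAux_algebraMap, map_add, neg_add]
  | add x y hx hy => simp only [schoutenAux_add_left, hx, hy]; abel
  | ι_mul P X hx =>
    erw [schoutenAux_ι_mul, schoutenAux_ι_mul, schoutenAux_ι_mul, hx, lie_add_right]
    simp only [mul_add]; abel

theorem schoutenAux_smul_right (r : R) (P Q : ExteriorAlgebra R L) (hr : 𝔞.dFun r = 0) :
    𝔞.schoutenAux P (r • Q) = r • 𝔞.schoutenAux P Q := by
  induction P using CliffordAlgebra.left_induction with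
  | algebraMap s =>
    erw [schoutenAux_algebraMap, schoutenAux_algebraMap, map_smul, smul_neg]
  | add x y hx hy => simp only [schoutenAux_add_left, hx, hy, smul_add]
  | ι_mul P X hx =>
    have h : 𝔞.anchor X r = 0 := by rw [← dFun_apply, hr]; rfl
    erw [schoutenAux_ι_mul, schoutenAux_ι_mul, hx, lie_smul_right]
    simp [h]

/-- If `r • Q = 0`, then `(r * r) • [P, Q] = 0`. -/
theorem schoutenAux_local_right (r : R) (P Q : ExteriorAlgebra R L) (h : r • Q = 0) :
    (r * r) • 𝔞.schoutenAux P Q = 0 := by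
  have h2 : (r * r) • Q = 0 := by rw [mul_smul, h, smul_zero]
  induction P using CliffordAlgebra.left_induction with
  | algebraMap s =>
    erw [schoutenAux_algebraMap, smul_neg, ← map_smul, h2, map_zero, neg_zero]
  | add x y hx hy => rw [schoutenAux_add_left, smul_add, hx, hy, add_zero]
  | ι_mul P X hx =>
    have h3 : (r * r) • 𝔞.lie X Q = 0 := by
      have e := 𝔞.lie_smul_right X r Q
      have e0 : 𝔞.lie X (0 : ExteriorAlgebra R L) = 0 := by
        have := 𝔞.lie_add_right X 0 0
        simpa using this
      rw [h, e0] at e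
      have e' := congrArg (r • ·) e
      simp only [smul_zero, smul_add, smul_comm r (𝔞.anchor X r), h, add_zero] at e'
      rw [mul_smul, ← e']
    erw [schoutenAux_ι_mul, smul_add, ← mul_smul_comm, hx, mul_zero, ← mul_smul_comm, h3, mul_zero,
      add_zero]

/-- If `r • P = 0`, then `(r * r) • [P, Q] = 0`. -/
theorem schoutenAux_local_left (r : R) (P Q : ExteriorAlgebra R L) (h : r • P = 0) :
    (r * r) • 𝔞.schoutenAux P Q = 0 := by
  have e := 𝔞.schoutenAux_smul_left r P Q
  have e0 : 𝔞.schoutenAux (0 : ExteriorAlgebra R L) Q = 0 := by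
    have := 𝔞.schoutenAux_add_left 0 0 Q
    simpa using this
  rw [h, e0] at e
  have e' := congrArg (r • ·) e
  simp only [smul_zero, smul_sub, ← smul_mul_assoc, h, zero_mul, sub_zero] at e'
  rw [mul_smul, ← e']

/-- The Schouten–Nijenhuis bracket on `⋀ L` as a bilinear map over `ℝ`. -/
def schoutenExt : ExteriorAlgebra R L →ₗ[ℝ] ExteriorAlgebra R L →ₗ[ℝ] ExteriorAlgebra R L :=
  LinearMap.mk₂ ℝ 𝔞.schoutenAux 𝔞.schoutenAux_add_left
    (fun c P Q => by
      rw [← algebraMap_smul R c P, schoutenAux_smul_left, dFun_const, algebraMap_smul]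
      simp [contract])
    𝔞.schoutenAux_add_right
    (fun c P Q => by
      rw [← algebraMap_smul R c Q, 𝔞.schoutenAux_smul_right _ _ _ (𝔞.dFun_const c),
        algebraMap_smul])

/-- The Lie derivative `(𝓛_X β)(Y) = ρ(X)(β(Y)) - β([X, Y])` of a form of degree one. -/
def lieForm (X : L) (β : Module.Dual R L) : Module.Dual R L where
  toFun Y := 𝔞.anchor X (β Y) - β (𝔞.bracket X Y)
  map_add' Y Z := by simp only [map_add]; abel
  map_smul' r Y := by
    simp only [map_smul, 𝔞.leibniz, map_add, smul_eq_mul, Derivation.leibniz, RingHom.id_apply]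
    ring

/-- The bracket `{α, β} = 𝓛_{πα} β - 𝓛_{πβ} α - d (β(πα))` on forms of degree one. -/
def dualBracket (s : Module.Dual R L →ₗ[R] L) (α β : Module.Dual R L) : Module.Dual R L :=
  𝔞.lieForm (s α) β - 𝔞.lieForm (s β) α - 𝔞.dFun (β (s α))

/-- The map `α ↦ ι_α P` into `L`, for `P` of degree two. -/
def sharpExt : ExteriorAlgebra R L →ₗ[ℝ] Module.Dual R L →ₗ[R] L where
  toFun P :=
    { toFun := fun α => ExteriorAlgebra.ιInv (contract α P)
      map_add' := fun α β => by rw [contract_add, LinearMap.add_apply, map_add]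
      map_smul' := fun r α => by rw [contract_smul, LinearMap.smul_apply, map_smul]; rfl }
  map_add' P Q := by ext1 α; simp
  map_smul' c P := by
    ext1 α
    change ((ExteriorAlgebra.ιInv (R := R) (M := L)).restrictScalars ℝ ∘ₗ
      (contract α).restrictScalars ℝ) (c • P) = _
    rw [map_smul]; rfl

theorem sharpExt_smul (r : R) (P : ExteriorAlgebra R L) (α : Module.Dual R L) :
    sharpExt (r • P) α = r • sharpExt P α := by
  change ExteriorAlgebra.ιInv (contract α (r • P)) = r • ExteriorAlgebra.ιInv (contract α P)
  rw [map_smul, map_smul]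

end PreBracket

/-! ### Multisections -/

section Multisections

open scoped DirectSum

variable {M : Type*} (ev : M → R →+* ℝ)

variable (L) in
/-- The elements of `⋀ L` that vanish near every point. -/
def locallyZero : Submodule ℝ (ExteriorAlgebra R L) where
  carrier := {Z | ∀ x, ∃ f : R, ev x f ≠ 0 ∧ f • Z = 0}
  zero_mem' x := ⟨1, by simp, by simp⟩
  add_mem' {Z W} hZ hW x := by
    obtain ⟨f, hf, hfZ⟩ := hZ x
    obtain ⟨g, hg, hgW⟩ := hW x
    refine ⟨f * g, by simp [hf, hg], ?_⟩
    rw [smul_add, mul_comm, mul_smul, hfZ, mul_comm, mul_smul, hgW]; simp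
  smul_mem' c Z hZ x := by
    obtain ⟨f, hf, hfZ⟩ := hZ x
    exact ⟨f, hf, by rw [smul_comm, hfZ, smul_zero]⟩

variable (L) in
abbrev MultiSection := ExteriorAlgebra R L ⧸ locallyZero L ev

variable {ev}

/-- The class of an element of `⋀ L`. -/
def MultiSection.mk : ExteriorAlgebra R L →ₗ[ℝ] MultiSection L ev := (locallyZero L ev).mkQ

theorem locallyZero_map (D : ExteriorAlgebra R L →ₗ[ℝ] ExteriorAlgebra R L)
    (h : ∀ (r : R) Z, r • Z = 0 → (r * r) • D Z = 0) :
    locallyZero L ev ≤ (locallyZero L ev).comap D := fun Z hZ x => by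
  obtain ⟨f, hf, hfZ⟩ := hZ x
  exact ⟨f * f, by simp [hf], h f Z hfZ⟩

/-- The multiplication by `(-1) ^ p` on sections of degree `p`. -/
def signInvolution : MultiSection L ev →ₗ[ℝ] MultiSection L ev :=
  (locallyZero L ev).mapQ (locallyZero L ev)
    ((CliffordAlgebra.involute (Q := (0 : QuadraticForm R L))).toLinearMap.restrictScalars ℝ)
    (locallyZero_map _ fun r Z h => by
      change (r * r) • CliffordAlgebra.involute Z = 0
      rw [← map_smul, mul_smul, h, smul_zero, map_zero])

/-- The extension of `N` by derivation. -/
def underline (N : L →ₗ[R] L) : MultiSection L ev →ₗ[ℝ] MultiSection L ev :=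
  (locallyZero L ev).mapQ (locallyZero L ev)
    { toFun := (derivExtData N).extend
      map_add' := (derivExtData N).extend_add
      map_smul' := fun c a => by
        rw [← algebraMap_smul R c a, ExtData.extend_smul]
        simp [derivExtData] }
    (locallyZero_map _ fun r Z h => by
      have e := (derivExtData N).extend_smul r Z
      have e0 : (derivExtData N).extend 0 = 0 := by
        have := (derivExtData N).extend_add 0 0
        simpa using this
      rw [h, e0] at e
      have e' : r • (derivExtData N).extend Z = 0 := by simpa [derivExtData] using e.symm
      change (r * r) • (derivExtData N).extend Z = 0
      rw [mul_smul, e', smul_zero])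

/-- The Schouten–Nijenhuis bracket. -/
def PreBracket.schouten (𝔞 : PreBracket R L) :
    MultiSection L ev →ₗ[ℝ] MultiSection L ev →ₗ[ℝ] MultiSection L ev :=
  (locallyZero L ev).liftQ
    { toFun := fun P => (locallyZero L ev).mapQ (locallyZero L ev) (𝔞.schoutenExt P)
        (locallyZero_map _ fun r Z h => 𝔞.schoutenAux_local_right r P Z h)
      map_add' := fun P P' => by
        ext Q
        simp [-Submodule.Quotient.mk_add, ← Submodule.Quotient.mk_add]
      map_smul' := fun c P => by
        ext Q
        simp }
    (fun P hP => by
      rw [LinearMap.mem_ker]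
      ext Q
      simp only [LinearMap.coe_mk, AddHom.coe_mk, LinearMap.comp_apply, Submodule.mkQ_apply,
        Submodule.mapQ_apply, LinearMap.zero_apply, Submodule.Quotient.mk_eq_zero]
      exact locallyZero_map (𝔞.schoutenExt.flip Q)
        (fun r Z h => 𝔞.schoutenAux_local_left r Z Q h) hP)

/-- Sections of degree `p`, i.e. of `⋀ ^ p`. -/
def degreePart (p : ℕ) : Submodule ℝ (MultiSection L ev) :=
  ((⋀[R]^p L).restrictScalars ℝ).map (MultiSection.mk (ev := ev))

/-- The grading of `Γ(⋀ A)[2]`: the component of degree `i` consists of the sections of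
`⋀ ^ (i + 2)`. -/
def shiftedGrading (i : ℤ) : Submodule ℝ (MultiSection L ev) :=
  if 0 ≤ i + 2 then degreePart (i + 2).toNat else ⊥

theorem mk_mem_shiftedGrading (p : ℕ) (Z : ExteriorAlgebra R L) (hZ : Z ∈ ⋀[R]^p L) :
    MultiSection.mk Z ∈ shiftedGrading (L := L) (ev := ev) ((p : ℤ) - 2) := by
  have : ((p : ℤ) - 2 + 2).toNat = p := by simp
  rw [shiftedGrading, if_pos (by simp), this]
  exact ⟨Z, hZ, rfl⟩

/-- The homogeneous component, as a map into the shifted grading. -/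
def componentHom (p : ℕ) :
    ⋀[R]^p L →+ ⨁ i, shiftedGrading (L := L) (ev := ev) i :=
  (DirectSum.of (fun i => shiftedGrading (L := L) (ev := ev) i) ((p : ℤ) - 2)).comp
    { toFun := fun Z => ⟨MultiSection.mk Z.1, mk_mem_shiftedGrading p Z.1 Z.2⟩
      map_zero' := by ext; simp
      map_add' := fun Z W => by ext; simp }

/-- The decomposition of an element of `⋀ L` into the classes of its components. -/
def decomposeAux : ExteriorAlgebra R L →+ ⨁ i, shiftedGrading (L := L) (ev := ev) i :=
  (DirectSum.toAddMonoid componentHom).comp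
    (DirectSum.decomposeAddEquiv (fun p : ℕ => ⋀[R]^p L)).toAddMonoidHom

theorem decomposeAux_of_mem (p : ℕ) (Z : ExteriorAlgebra R L) (hZ : Z ∈ ⋀[R]^p L) :
    decomposeAux (ev := ev) Z =
      DirectSum.of (fun i => shiftedGrading (L := L) (ev := ev) i) ((p : ℤ) - 2)
        ⟨MultiSection.mk Z, mk_mem_shiftedGrading p Z hZ⟩ := by
  change DirectSum.toAddMonoid componentHom (DirectSum.decompose (fun p : ℕ => ⋀[R]^p L) Z) = _
  rw [DirectSum.decompose_of_mem (fun p : ℕ => ⋀[R]^p L) hZ, DirectSum.toAddMonoid_of]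
  rfl

theorem decomposeAux_eq_zero (Z : ExteriorAlgebra R L) (hZ : Z ∈ locallyZero L ev) :
    decomposeAux (ev := ev) Z = 0 := by
  classical
  change DirectSum.toAddMonoid componentHom (DirectSum.decompose (fun p : ℕ => ⋀[R]^p L) Z) = _
  have key : ∀ p, componentHom (ev := ev) p (DirectSum.decompose (fun p : ℕ => ⋀[R]^p L) Z p) = 0 := by
    intro p
    have h0 : MultiSection.mk (ev := ev)
        (DirectSum.decompose (fun p : ℕ => ⋀[R]^p L) Z p : ExteriorAlgebra R L) = 0 := by
      refine (Submodule.Quotient.mk_eq_zero _).2 fun x => ?_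
      obtain ⟨f, hf, hfZ⟩ := hZ x
      refine ⟨f, hf, ?_⟩
      have := congrArg (fun W => (DirectSum.decompose (fun p : ℕ => ⋀[R]^p L) W p :
        ExteriorAlgebra R L)) hfZ
      rw [DirectSum.decompose_smul, DirectSum.decompose_zero] at this
      exact this
    have h1 : (⟨_, mk_mem_shiftedGrading (ev := ev) p _
        (DirectSum.decompose (fun p : ℕ => ⋀[R]^p L) Z p).2⟩ :
        shiftedGrading (L := L) (ev := ev) ((p : ℤ) - 2)) = 0 := Subtype.ext h0
    change DirectSum.of (fun i => shiftedGrading (L := L) (ev := ev) i) _ ⟨_, _⟩ = 0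
    rw [h1, map_zero]
  rw [← DirectSum.sum_support_of (DirectSum.decompose (fun p : ℕ => ⋀[R]^p L) Z), map_sum]
  refine Finset.sum_eq_zero fun p _ => ?_
  rw [DirectSum.toAddMonoid_of, key]

/-- The decomposition of a multisection into its homogeneous components. -/
def decomposeHom : MultiSection L ev →+ ⨁ i, shiftedGrading (L := L) (ev := ev) i :=
  QuotientAddGroup.lift (locallyZero L ev).toAddSubgroup decomposeAux
    (fun Z hZ => decomposeAux_eq_zero Z hZ)

instance : DirectSum.Decomposition (shiftedGrading (L := L) (ev := ev)) :=
  DirectSum.Decomposition.ofAddHom _ decomposeHom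
    (by
      ext x
      obtain ⟨Z, rfl⟩ := (locallyZero L ev).mkQ_surjective x
      induction Z using DirectSum.Decomposition.inductionOn (fun p : ℕ => ⋀[R]^p L) with
      | zero => simp
      | homogeneous Z =>
        change DirectSum.coeAddMonoidHom _ (decomposeAux (Z : ExteriorAlgebra R L)) = _
        rw [decomposeAux_of_mem _ _ Z.2, DirectSum.coeAddMonoidHom_of]; rfl
      | add Z W hZ hW => simpa only [map_add] using congrArg₂ (· + ·) hZ hW)
    (by
      ext i x : 2
      obtain ⟨x, hx⟩ := x
      change decomposeHom (DirectSum.coeAddMonoidHom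
        (fun i => shiftedGrading (L := L) (ev := ev) i)
        (DirectSum.of (fun i => shiftedGrading (L := L) (ev := ev) i) i ⟨x, hx⟩)) =
        DirectSum.of (fun i => shiftedGrading (L := L) (ev := ev) i) i ⟨x, hx⟩
      rw [DirectSum.coeAddMonoidHom_of]
      have hx' := hx
      unfold shiftedGrading at hx'
      split_ifs at hx' with h
      · obtain ⟨Z, hZ, rfl⟩ := hx'
        change decomposeAux Z = _
        rw [decomposeAux_of_mem _ Z hZ]
        have e : (((i + 2).toNat : ℕ) : ℤ) - 2 = i := by omega
        exact DirectSum.of_eq_of_gradedMonoid_eq (Sigma.subtype_ext e rfl)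
      · obtain rfl : x = 0 := by simpa using hx'
        rw [map_zero]; symm; exact map_zero _)

end Multisections
end Algebra
/-! ### Lie algebroids -/

section Geometry

open scoped Manifold ContDiff

variable {EM : Type*} [NormedAddCommGroup EM] [NormedSpace ℝ EM] 
  {M : Type*} [TopologicalSpace M] [ChartedSpace EM M] [IsManifold 𝓘(ℝ, EM) ∞ M]
  {F : Type*} [NormedAddCommGroup F] [NormedSpace ℝ F] 
  {A : M → Type*} [TopologicalSpace (Bundle.TotalSpace F A)] [∀ x, AddCommGroup (A x)]
  [∀ x, Module ℝ (A x)] [∀ x, TopologicalSpace (A x)] [FiberBundle F A] [VectorBundle ℝ F A]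

variable (EM M) in
/-- Smooth functions on `M`. -/
abbrev Fn := C^∞⟮𝓘(ℝ, EM), M; ℝ⟯

variable (EM F A) in
/-- Smooth sections of the vector bundle `A`. -/
abbrev Sec := Cₛ^∞⟮𝓘(ℝ, EM); F, A⟯

variable (EM M) in
/-- Smooth vector fields. -/
abbrev VF := Cₛ^∞⟮𝓘(ℝ, EM); EM, (TangentSpace 𝓘(ℝ, EM) : M → Type _)⟯

/-- Multiplication of sections by functions. -/
instance : SMul (Fn EM M) (Sec EM F A) :=
  ⟨fun f s => ⟨(f : M → ℝ) • (s : ∀ x, A x), f.contMDiff.smul_section s.contMDiff⟩⟩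

theorem smul_apply (f : Fn EM M) (s : Sec EM F A) (x : M) : (f • s) x = f x • s x := rfl

instance : Module (Fn EM M) (Sec EM F A) where
  one_smul s := by ext x; exact one_smul ℝ _
  mul_smul f g s := by ext x; exact mul_smul (f x) (g x) (s x)
  smul_zero f := by ext x; exact smul_zero (f x)
  smul_add f s t := by ext x; exact smul_add (f x) (s x) (t x)
  add_smul f g s := by ext x; exact add_smul (f x) (g x) (s x)
  zero_smul s := by ext x; exact zero_smul ℝ (s x)

instance : IsScalarTower ℝ (Fn EM M) (Sec EM F A) where
  smul_assoc c f s := by ext x; exact mul_smul c (f x) (s x)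

/-- Evaluation of functions at a point. -/
def evalAt (x : M) : Fn EM M →+* ℝ := ContMDiffMap.evalRingHom x

theorem mfderiv_smooth (V : VF EM M) (f : Fn EM M) :
    ContMDiff 𝓘(ℝ, EM) 𝓘(ℝ) ∞ (fun x => mfderiv 𝓘(ℝ, EM) 𝓘(ℝ) f x (V x) : M → ℝ) := by
  have h1 := f.contMDiff.contMDiff_tangentMap (m := ∞) (by simp)
  have h2 := h1.comp V.contMDiff
  have h3 := (contMDiff_snd_tangentBundle_modelSpace ℝ 𝓘(ℝ, ℝ) (n := ∞)).comp h2
  exact h3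

/-- The derivative of functions along a vector field. -/
def along (V : VF EM M) : Derivation ℝ (Fn EM M) (Fn EM M) :=
  Derivation.mk'
    { toFun := fun f => ⟨fun x => mfderiv 𝓘(ℝ, EM) 𝓘(ℝ) f x (V x), mfderiv_smooth V f⟩
      map_add' := fun f g => by
        ext x
        have hf := f.contMDiff.mdifferentiableAt (x := x) (by simp)
        have hg := g.contMDiff.mdifferentiableAt (x := x) (by simp)
        exact congrArg (· (V x)) (mfderiv_add hf hg)
      map_smul' := fun c f => by
        ext x
        have hf := f.contMDiff.mdifferentiableAt (x := x) (by simp)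
        exact congrArg (· (V x)) (const_smul_mfderiv hf c) }
    (fun f g => by
        ext x
        have hf := f.contMDiff.mdifferentiableAt (x := x) (by simp)
        have hg := g.contMDiff.mdifferentiableAt (x := x) (by simp)
        exact congrArg (fun φ : EM →L[ℝ] ℝ => φ (V x))
          (hf.hasMFDerivAt.mul hg.hasMFDerivAt).mfderiv)

variable (EM F A) in
/-- A pre-Lie algebroid structure on `A`: a skew-symmetric bracket of sections and an anchor
`A → TM` (as a map of sections, linear over the functions) with the Leibniz rule. -/
structure PreLieAlgebroid where
  bracket : Sec EM F A →ₗ[ℝ] Sec EM F A →ₗ[ℝ] Sec EM F A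
  anchor : Sec EM F A →ₗ[Fn EM M] VF EM M
  bracket_self : ∀ X, bracket X X = 0
  leibniz : ∀ X Y (f : Fn EM M), bracket X (f • Y) = f • bracket X Y + along (anchor X) f • Y

theorem along_add (V W : VF EM M) (f : Fn EM M) : along (V + W) f = along V f + along W f := by
  ext x
  exact map_add (mfderiv 𝓘(ℝ, EM) 𝓘(ℝ) f x) (V x) (W x)

theorem along_smul (g : Fn EM M) (V : VF EM M) (f : Fn EM M) :
    along (g • V) f = g • along V f := by
  ext x
  exact map_smul (mfderiv 𝓘(ℝ, EM) 𝓘(ℝ) f x) (g x) (V x)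

namespace PreLieAlgebroid

variable (𝔞 : PreLieAlgebroid EM F A)

/-- The underlying bracket, with the anchor acting on functions by derivations. -/
def toPreBracket : PreBracket (Fn EM M) (Sec EM F A) where
  bracket := 𝔞.bracket
  anchor :=
    { toFun := fun X => along (𝔞.anchor X)
      map_add' := fun X Y => by ext1 f; rw [map_add, along_add]; rfl
      map_smul' := fun g X => by ext1 f; rw [map_smul, along_smul]; rfl }
  bracket_self := 𝔞.bracket_self
  leibniz := 𝔞.leibniz

/-- The Jacobi identity: `𝔞` is a Lie algebroid structure. -/
def IsLie : Prop := ∀ X Y Z,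
  𝔞.bracket X (𝔞.bracket Y Z) + 𝔞.bracket Y (𝔞.bracket Z X) + 𝔞.bracket Z (𝔞.bracket X Y) = 0

/-- The deformation by `N`: `[X, Y]_N = [N X, Y] + [X, N Y] - N [X, Y]`, with anchor `ρ ∘ N`. -/
def deform (N : Sec EM F A →ₗ[Fn EM M] Sec EM F A) : PreLieAlgebroid EM F A where
  bracket := 𝔞.bracket ∘ₗ N.restrictScalars ℝ + 𝔞.bracket.compl₂ (N.restrictScalars ℝ)
    - 𝔞.bracket.compr₂ (N.restrictScalars ℝ)
  anchor := 𝔞.anchor ∘ₗ N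
  bracket_self X := by
    have h := 𝔞.toPreBracket.bracket_swap (N X) X
    change 𝔞.bracket (N X) X = - 𝔞.bracket X (N X) at h
    simp [h, 𝔞.bracket_self]
  leibniz X Y f := by
    simp only [LinearMap.sub_apply, LinearMap.add_apply, LinearMap.comp_apply,
      LinearMap.compl₂_apply, LinearMap.compr₂_apply, LinearMap.restrictScalars_apply, map_smul,
      𝔞.leibniz, map_add, smul_sub, smul_add]
    abel

end PreLieAlgebroid

variable (EM F A) in
/-- A Lie algebroid structure on `A`. -/
structure LieAlgebroid extends PreLieAlgebroid EM F A where
  jacobi : toPreLieAlgebroid.IsLie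

/-! ### Multisections of `A` -/

variable (EM F A) in
/-- The sections of `⋀ A`: elements of the exterior algebra of `Γ(A)` over the functions, up to
elements that vanish near every point. On a Hausdorff, `σ`-compact manifold `Γ(A)` is finitely
generated projective, `Γ(⋀ A)` is its exterior algebra, and only zero vanishes near every point;
the quotient makes equality of multisections a local matter by construction. -/
abbrev MultiSec := MultiSection (R := Fn EM M) (Sec EM F A) evalAt

variable (EM F A) in
/-- The graded vector space `Γ(⋀ A)[2]`. -/
abbrev grading : ℤ → Submodule ℝ (MultiSec EM F A) :=
  shiftedGrading (R := Fn EM M) (L := Sec EM F A) (ev := evalAt)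

variable (EM F A) in
/-- The bivector fields: sections of `⋀² A`. -/
abbrev Bivector : Submodule ℝ (MultiSec EM F A) :=
  degreePart (R := Fn EM M) (L := Sec EM F A) (ev := evalAt) 2

variable (EM F A) in
/-- Sections of the dual bundle, as maps on `Γ(A)` that are linear over the functions. -/
abbrev DualSec := Module.Dual (Fn EM M) (Sec EM F A)

variable (EM F A) in
/-- Tensor fields of type `(1, 1)`: endomorphisms of `Γ(A)`, linear over the functions. -/
abbrev Tensor := Sec EM F A →ₗ[Fn EM M] Sec EM F A

/-- The map `π♯` with `β(π♯ α) = π(α, β)`, i.e. `π♯ α = ι_α π`, for a bivector field `π`. -/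
def sharp : MultiSec EM F A →ₗ[ℝ] DualSec EM F A →ₗ[Fn EM M] Sec EM F A :=
  (locallyZero (Sec EM F A) evalAt).liftQ PreBracket.sharpExt fun P hP => by
    rw [LinearMap.mem_ker]
    ext α x
    obtain ⟨f, hf, hfP⟩ := hP x
    have h : f • PreBracket.sharpExt P α = 0 := by
      rw [← PreBracket.sharpExt_smul, hfP, map_zero]; rfl
    have h' : f x • PreBracket.sharpExt P α x = 0 := by
      rw [← smul_apply, h]; rfl
    exact (smul_eq_zero.1 h').resolve_left hf

namespace PreLieAlgebroid

variable (𝔞 : PreLieAlgebroid EM F A)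

/-- The Schouten–Nijenhuis bracket on `Γ(⋀ A)`. -/
def schouten : MultiSec EM F A →ₗ[ℝ] MultiSec EM F A →ₗ[ℝ] MultiSec EM F A :=
  𝔞.toPreBracket.schouten

/-- The two-form `l2(P, Q) = (-1) ^ (p - 1) [P, Q]` for `P` of degree `p`. -/
def l2 : FormalSum (MultiSec EM F A) :=
  twoForm fun P Q => - 𝔞.schouten (signInvolution P) Q

/-- The one-form `l1(P) = [π, P]`. -/
def l1 (π : MultiSec EM F A) : FormalSum (MultiSec EM F A) := oneForm fun P => 𝔞.schouten π P

/-- `π` is Poisson. -/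
def IsPoisson (π : MultiSec EM F A) : Prop := 𝔞.schouten π π = 0

/-- `N` is a Nijenhuis tensor: its torsion vanishes. -/
def IsNijenhuis (N : Tensor EM F A) : Prop :=
  ∀ X Y, 𝔞.bracket (N X) (N Y) - N ((𝔞.deform N).bracket X Y) = 0

/-- The bracket `{α, β}_π = 𝓛_{π♯α} β - 𝓛_{π♯β} α - d (π(α, β))` on `Γ(A*)`. -/
def koszulBracket (π : MultiSec EM F A) (α β : DualSec EM F A) : DualSec EM F A :=
  𝔞.toPreBracket.dualBracket (sharp π) α β

/-- Poisson–Nijenhuis structures. The dual map `N*` is `α ↦ α ∘ N`. -/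
structure IsPoissonNijenhuis (π : MultiSec EM F A) (N : Tensor EM F A) : Prop where
  nijenhuis : 𝔞.IsNijenhuis N
  poisson : 𝔞.IsPoisson π
  commute : ∀ α, N (sharp π α) = sharp π (α ∘ₗ N)
  concomitant : ∀ α β,
    𝔞.koszulBracket π (α ∘ₗ N) β + 𝔞.koszulBracket π α (β ∘ₗ N) - 𝔞.koszulBracket π α β ∘ₗ N =
      (𝔞.deform N).koszulBracket π α β

end PreLieAlgebroid

end Geometry
end Algebroid

end

open scoped Manifold ContDiff
open Algebroid

/-! Bracketing with the degree zero form `N + π` is explicit on forms with a unary part `f` and a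
binary part `B` (`rn_lowForm`): the result has constant part `f π`, unary part `B(π, ·) + fN - Nf`
and binary part `B(N·, ·) + B(·, N·) - N B(·, ·)`, which is `B` deformed by `N`. The formula for the
deformed bracket of sections persists for the Schouten bracket (`IsDeformation.schoutenAux`), so one
application to `l2` gives `l2_N - [π, ·]`, the deformed structure in (b). A second application gives
the constant `-[π, π]`, the unary part `N[π, ·] - [π, N·] - [π, ·]_N`, and the symmetric bracket
deformed twice. The right-hand side, coming from `N²`, has a binary part only. The co-boundary
condition therefore splits into three (`coboundary_iff`).

The constant part says that `π` is Poisson. For the binary part, deforming twice by `N` and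
deforming once by `N²` differ by twice the torsion of `N` (`symBracket_eq_iff`). The unary part is
an odd derivation of the wedge product. It kills functions because `Nπ♯ = π♯N*`, and on a section
`X` it is a bivector whose double contraction with `α`, `β` is minus the Poisson–Nijenhuis
concomitant of `α`, `β` evaluated at `X` (`contract_contract_concomitantMap`). A bivector all of
whose double contractions vanish is locally zero, as a frame cut off by bump functions shows
(`exists_frame`, `concomitant_iff`). This is where the geometry enters; the rest is algebra in the
exterior algebra of `Γ(A)` over the functions.

For (b), the torsion condition reduces the Jacobi identity of `[·,·]_N` to instances of the original
one. Evaluating the vanishing unary part at `π` and comparing with the deformation formula gives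
`3[π, π]_N = 0`. The same condition says that `N[π, ·] - [π, N·]` is the inner operator `½[Nπ, ·]`,
which makes `[π, ·]` a derivation of the deformed bracket as well. Square-zero odd derivations of a
Schouten bracket satisfying graded Jacobi then give both DGLA structures (`isDGLA_symBracket`). -/

noncomputable section

namespace Algebroid

/-! ### Exterior calculus, with signs carried by the grading involution. -/

section ExteriorCalculus

variable {R L : Type*} [CommRing R] [AddCommGroup L] [Module R L]

/-- The grading involution of the exterior algebra. -/
def gradeInv : ExteriorAlgebra R L →ₐ[R] ExteriorAlgebra R L :=
  CliffordAlgebra.involute (Q := (0 : QuadraticForm R L))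

theorem gradeInv_ι (X : L) :
    gradeInv (ExteriorAlgebra.ι R X) = - ExteriorAlgebra.ι R X := CliffordAlgebra.involute_ι X

theorem gradeInv_gradeInv (a : ExteriorAlgebra R L) : gradeInv (gradeInv a) = a :=
  CliffordAlgebra.involute_involute a

theorem gradeInv_algebraMap (r : R) :
    gradeInv (algebraMap R (ExteriorAlgebra R L) r) = algebraMap R _ r := AlgHom.commutes _ _

theorem gradeInv_mul_ι (X : L) (a : ExteriorAlgebra R L) :
    gradeInv a * ExteriorAlgebra.ι R X = ExteriorAlgebra.ι R X * a := ι_mul_comm X a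

theorem ι_ι_mul_swap (X Y : L) (a : ExteriorAlgebra R L) :
    ExteriorAlgebra.ι R X * (ExteriorAlgebra.ι R Y * a) =
      - (ExteriorAlgebra.ι R Y * (ExteriorAlgebra.ι R X * a)) := by
  rw [← mul_assoc, ← mul_assoc, ← neg_mul,
    eq_neg_of_add_eq_zero_left (ExteriorAlgebra.ι_add_mul_swap (R := R) X Y)]

/-- Clifford induction at the zero quadratic form, phrased in terms of `ExteriorAlgebra.ι`. It
replaces expansions in decomposable elements: the identities below are checked on functions and
propagated through left multiplication by a section. -/
theorem exterior_induction {p : ExteriorAlgebra R L → Prop} (a : ExteriorAlgebra R L)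
    (algebraMap : ∀ r : R, p (algebraMap R _ r)) (add : ∀ a b, p a → p b → p (a + b))
    (ι_mul : ∀ X a, p a → p (ExteriorAlgebra.ι R X * a)) : p a :=
  CliffordAlgebra.left_induction (Q := (0 : QuadraticForm R L)) (P := p) algebraMap add
    (fun a X h => ι_mul X a h) a

/-- Elements fixed by the grading involution are central. -/
theorem even_mul_comm {a : ExteriorAlgebra R L} (ha : gradeInv a = a) (b : ExteriorAlgebra R L) :
    b * a = a * b := by
  induction b using exterior_induction with
  | algebraMap r => exact Algebra.commutes _ _
  | add b c hb hc => rw [add_mul, mul_add, hb, hc]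
  | ι_mul X b hb =>
    rw [mul_assoc, hb, ← mul_assoc, ← mul_assoc, ← gradeInv_mul_ι, ha]

theorem odd_mul_comm {a : ExteriorAlgebra R L} (ha : gradeInv a = - a)
    (b : ExteriorAlgebra R L) : b * a = a * gradeInv b := by
  induction b using exterior_induction with
  | algebraMap r => rw [gradeInv_algebraMap]; exact Algebra.commutes _ _
  | add b c hb hc => rw [map_add, add_mul, mul_add, hb, hc]
  | ι_mul X b hb =>
    rw [mul_assoc, hb, ← mul_assoc, ← gradeInv_mul_ι, ha, map_mul, gradeInv_ι]
    simp only [neg_mul, mul_neg, mul_assoc]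

/-! ### Extension by derivation -/

/-- The extension of an endomorphism by derivation. -/
def derivExt (N : L →ₗ[R] L) (a : ExteriorAlgebra R L) : ExteriorAlgebra R L :=
  (derivExtData N).extend a

variable (N : L →ₗ[R] L)

theorem derivExt_add (a b : ExteriorAlgebra R L) :
    derivExt N (a + b) = derivExt N a + derivExt N b := ExtData.extend_add _ _ _

theorem derivExt_smul (r : R) (a : ExteriorAlgebra R L) :
    derivExt N (r • a) = r • derivExt N a :=
  (ExtData.extend_smul _ _ _).trans (by simp [derivExtData, derivExt])

theorem derivExt_zero : derivExt N (0 : ExteriorAlgebra R L) = 0 := by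
  simpa using derivExt_smul N 0 0

theorem derivExt_neg (a : ExteriorAlgebra R L) : derivExt N (-a) = - derivExt N a := by
  simpa using derivExt_smul N (-1) a

theorem derivExt_sub (a b : ExteriorAlgebra R L) :
    derivExt N (a - b) = derivExt N a - derivExt N b := by
  rw [sub_eq_add_neg, derivExt_add, derivExt_neg, ← sub_eq_add_neg]

theorem derivExt_algebraMap (r : R) : derivExt N (algebraMap R (ExteriorAlgebra R L) r) = 0 :=
  (ExtData.extend_algebraMap _ _).trans (by simp [derivExtData])

theorem derivExt_ι_mul (X : L) (a : ExteriorAlgebra R L) :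
    derivExt N (ExteriorAlgebra.ι R X * a) =
      ExteriorAlgebra.ι R X * derivExt N a + ExteriorAlgebra.ι R (N X) * a :=
  ExtData.extend_ι_mul _ _ _

theorem derivExt_ι (X : L) :
    derivExt N (ExteriorAlgebra.ι R X) = ExteriorAlgebra.ι R (N X) := by
  have h := derivExt_ι_mul N X (algebraMap R _ 1)
  rw [derivExt_algebraMap, map_one] at h
  simpa using h

theorem derivExt_mul (a b : ExteriorAlgebra R L) :
    derivExt N (a * b) = derivExt N a * b + a * derivExt N b := by
  induction a using exterior_induction with
  | algebraMap r =>
    rw [derivExt_algebraMap, ← Algebra.smul_def, ← Algebra.smul_def, derivExt_smul, zero_mul,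
      zero_add]
  | add a c ha hc => simp only [add_mul, derivExt_add, ha, hc]; abel
  | ι_mul X a ha =>
    rw [mul_assoc, derivExt_ι_mul, ha, derivExt_ι_mul]
    simp only [mul_add, add_mul, mul_assoc]; abel

theorem gradeInv_derivExt (a : ExteriorAlgebra R L) :
    gradeInv (derivExt N a) = derivExt N (gradeInv a) := by
  induction a using exterior_induction with
  | algebraMap r => rw [gradeInv_algebraMap, derivExt_algebraMap, map_zero]
  | add a c ha hc => simp only [map_add, derivExt_add, ha, hc]
  | ι_mul X a ha =>
    rw [derivExt_ι_mul]
    simp only [map_add, map_mul, gradeInv_ι, ha, derivExt_neg, derivExt_ι_mul, neg_mul]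
    abel

/-! ### Contraction -/

open Algebroid.PreBracket (contract contract_ι_mul contract_algebraMap contract_add contract_smul)

variable [Algebra ℝ R] [Module ℝ L] [IsScalarTower ℝ R L] (α β : Module.Dual R L)

theorem contract_ι (X : L) : contract α (ExteriorAlgebra.ι R X) = algebraMap R _ (α X) :=
  CliffordAlgebra.contractLeft_ι (Q := (0 : QuadraticForm R L)) α X

theorem gradeInv_contract (a : ExteriorAlgebra R L) :
    gradeInv (contract α a) = - contract α (gradeInv a) := by
  induction a using exterior_induction with
  | algebraMap r => rw [gradeInv_algebraMap, contract_algebraMap, map_zero, neg_zero]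
  | add a c ha hc => simp only [map_add, ha, hc, neg_add]
  | ι_mul X a ha =>
    rw [contract_ι_mul]
    simp only [map_sub, map_mul, map_smul, gradeInv_ι, ha, neg_mul, map_neg, contract_ι_mul]
    simp only [mul_neg, neg_neg, neg_sub]

theorem contract_mul (a b : ExteriorAlgebra R L) :
    contract α (a * b) = contract α a * b + gradeInv a * contract α b := by
  induction a using exterior_induction with
  | algebraMap r =>
    rw [contract_algebraMap, ← Algebra.smul_def, gradeInv_algebraMap, ← Algebra.smul_def, map_smul,
      zero_mul, zero_add]
  | add a c ha hc => simp only [add_mul, map_add, ha, hc]; abel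
  | ι_mul X a ha =>
    rw [mul_assoc, contract_ι_mul, ha, contract_ι_mul]
    simp only [map_mul, gradeInv_ι, mul_add, sub_mul, mul_assoc, smul_mul_assoc, neg_mul]; abel

theorem contract_contract (a : ExteriorAlgebra R L) :
    contract α (contract β a) = - contract β (contract α a) :=
  CliffordAlgebra.contractLeft_comm (Q := (0 : QuadraticForm R L)) α β a

/-- The commutator of a derivation with a contraction is again an antiderivation linear over
functions, hence determined on sections. It is what makes `N` act on `[f, ·] = -ι_{df}` through `N*
df`. -/
theorem derivExt_contract (a : ExteriorAlgebra R L) :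
    derivExt N (contract α a) = contract α (derivExt N a) - contract (α ∘ₗ N) a := by
  induction a using exterior_induction with
  | algebraMap r => simp only [contract_algebraMap, derivExt_algebraMap, derivExt_zero, map_zero, sub_zero]
  | add a c ha hc => simp only [map_add, derivExt_add, ha, hc]; abel
  | ι_mul X a ha =>
    simp only [contract_ι_mul, derivExt_ι_mul, derivExt_sub, derivExt_smul, ha, map_add,
      LinearMap.comp_apply, mul_sub]
    abel

end ExteriorCalculus
end Algebroid
end

noncomputable section

namespace Algebroid

namespace PreBracket

/-! ### Lie derivative and Schouten bracket on the exterior algebra -/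

variable {R L : Type*} [CommRing R] [AddCommGroup L] [Module R L]
  [Algebra ℝ R] [Module ℝ L] [IsScalarTower ℝ R L] (𝔞 : PreBracket R L)

theorem lie_zero_right (X : L) : 𝔞.lie X 0 = 0 := by simpa using 𝔞.lie_add_right X 0 0

theorem lie_neg_right (X : L) (a : ExteriorAlgebra R L) : 𝔞.lie X (-a) = - 𝔞.lie X a := by
  rw [eq_neg_iff_add_eq_zero, ← lie_add_right, neg_add_cancel, lie_zero_right]

theorem lie_sub_right (X : L) (a b : ExteriorAlgebra R L) :
    𝔞.lie X (a - b) = 𝔞.lie X a - 𝔞.lie X b := by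
  rw [sub_eq_add_neg, lie_add_right, lie_neg_right, ← sub_eq_add_neg]

theorem lie_ι (X Y : L) :
    𝔞.lie X (ExteriorAlgebra.ι R Y) = ExteriorAlgebra.ι R (𝔞.bracket X Y) := by
  have h := 𝔞.lie_ι_mul X Y (algebraMap R _ 1)
  rw [lie_algebraMap, map_one] at h
  simpa using h

theorem lie_mul (X : L) (a b : ExteriorAlgebra R L) :
    𝔞.lie X (a * b) = 𝔞.lie X a * b + a * 𝔞.lie X b := by
  induction a using exterior_induction with
  | algebraMap r =>
    rw [lie_algebraMap, ← Algebra.smul_def, ← Algebra.smul_def, lie_smul_right, smul_mul_assoc,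
      one_mul, add_comm]
  | add a c ha hc => simp only [add_mul, lie_add_right, ha, hc]; abel
  | ι_mul Y a ha =>
    rw [mul_assoc, lie_ι_mul, ha, lie_ι_mul]
    simp only [mul_add, add_mul, mul_assoc]; abel

theorem gradeInv_lie (X : L) (a : ExteriorAlgebra R L) :
    gradeInv (𝔞.lie X a) = 𝔞.lie X (gradeInv a) := by
  induction a using exterior_induction with
  | algebraMap r => rw [gradeInv_algebraMap, lie_algebraMap, map_smul, map_one]
  | add a c ha hc => simp only [map_add, lie_add_right, ha, hc]
  | ι_mul Y a ha =>
    rw [lie_ι_mul]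
    simp only [map_add, map_mul, gradeInv_ι, ha, lie_neg_right, lie_ι_mul, neg_mul]
    abel

theorem schoutenAux_ι_mul' (X : L) (P Q : ExteriorAlgebra R L) :
    𝔞.schoutenAux (ExteriorAlgebra.ι R X * P) Q =
      ExteriorAlgebra.ι R X * 𝔞.schoutenAux P Q + gradeInv P * 𝔞.lie X Q :=
  𝔞.schoutenAux_ι_mul X P Q

theorem schoutenAux_zero_left (Q : ExteriorAlgebra R L) : 𝔞.schoutenAux 0 Q = 0 := by
  simpa using 𝔞.schoutenAux_add_left 0 0 Q

theorem schoutenAux_zero_right (P : ExteriorAlgebra R L) : 𝔞.schoutenAux P 0 = 0 := by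
  simpa using 𝔞.schoutenAux_add_right P 0 0

theorem schoutenAux_neg_left (P Q : ExteriorAlgebra R L) :
    𝔞.schoutenAux (-P) Q = - 𝔞.schoutenAux P Q := by
  rw [eq_neg_iff_add_eq_zero, ← schoutenAux_add_left, neg_add_cancel, schoutenAux_zero_left]

theorem schoutenAux_neg_right (P Q : ExteriorAlgebra R L) :
    𝔞.schoutenAux P (-Q) = - 𝔞.schoutenAux P Q := by
  rw [eq_neg_iff_add_eq_zero, ← schoutenAux_add_right, neg_add_cancel, schoutenAux_zero_right]

theorem schoutenAux_sub_left (P P' Q : ExteriorAlgebra R L) :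
    𝔞.schoutenAux (P - P') Q = 𝔞.schoutenAux P Q - 𝔞.schoutenAux P' Q := by
  rw [sub_eq_add_neg, schoutenAux_add_left, schoutenAux_neg_left, ← sub_eq_add_neg]

theorem schoutenAux_ι_left (X : L) (Q : ExteriorAlgebra R L) :
    𝔞.schoutenAux (ExteriorAlgebra.ι R X) Q = 𝔞.lie X Q := by
  have h := 𝔞.schoutenAux_ι_mul' X (algebraMap R _ 1) Q
  have h0 : 𝔞.dFun (1 : R) = 0 := by ext; simp
  rw [schoutenAux_algebraMap, h0, map_one, show contract (0 : Module.Dual R L) = 0 from map_zero _]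
    at h
  simpa using h

theorem gradeInv_schoutenAux (P Q : ExteriorAlgebra R L) :
    gradeInv (𝔞.schoutenAux P Q) = - 𝔞.schoutenAux (gradeInv P) (gradeInv Q) := by
  induction P using exterior_induction with
  | algebraMap r =>
    rw [gradeInv_algebraMap, schoutenAux_algebraMap, schoutenAux_algebraMap, map_neg,
      gradeInv_contract]
  | add a c ha hc => simp only [map_add, schoutenAux_add_left, ha, hc, neg_add]
  | ι_mul X P hP =>
    rw [schoutenAux_ι_mul']
    simp only [map_add, map_mul, gradeInv_ι, hP, neg_mul, schoutenAux_neg_left, schoutenAux_ι_mul',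
      gradeInv_lie, neg_neg]
    simp only [mul_neg, neg_neg]

/-- Antisymmetry against a section, where no sign depends on the degree of `Q`; the general swap
lemmas use it in their induction step. -/
theorem schoutenAux_ι_right (X : L) (Q : ExteriorAlgebra R L) :
    𝔞.schoutenAux Q (ExteriorAlgebra.ι R X) = - 𝔞.lie X Q := by
  induction Q using exterior_induction with
  | algebraMap r =>
    rw [schoutenAux_algebraMap, lie_algebraMap, contract_ι, dFun_apply,
      Algebra.algebraMap_eq_smul_one]
  | add a c ha hc => simp only [lie_add_right, schoutenAux_add_left, ha, hc, neg_add]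
  | ι_mul Y Q hQ =>
    rw [schoutenAux_ι_mul', hQ, lie_ι, lie_ι_mul, gradeInv_mul_ι, 𝔞.bracket_swap Y X, map_neg]
    simp only [neg_mul, mul_neg, neg_add]

theorem schoutenAux_algebraMap_right (r : R) (P : ExteriorAlgebra R L) :
    𝔞.schoutenAux P (algebraMap R _ r) = gradeInv (contract (𝔞.dFun r) P) := by
  induction P using exterior_induction with
  | algebraMap s =>
    rw [schoutenAux_algebraMap, contract_algebraMap, contract_algebraMap, map_zero, neg_zero]
  | add a c ha hc => simp only [map_add, schoutenAux_add_left, ha, hc]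
  | ι_mul X P hP =>
    rw [schoutenAux_ι_mul', hP, lie_algebraMap, contract_ι_mul, dFun_apply]
    simp only [map_sub, map_smul, map_mul, gradeInv_ι, mul_smul_comm, mul_one]
    simp only [neg_mul, sub_neg_eq_add]
    abel

theorem schoutenAux_smul_right' (r : R) (P Q : ExteriorAlgebra R L) :
    𝔞.schoutenAux P (r • Q) =
      r • 𝔞.schoutenAux P Q + gradeInv (contract (𝔞.dFun r) P) * Q := by
  induction P using exterior_induction with
  | algebraMap s =>
    rw [schoutenAux_algebraMap, schoutenAux_algebraMap, contract_algebraMap, map_smul, map_zero,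
      zero_mul, add_zero, smul_neg]
  | add a c ha hc => simp only [map_add, schoutenAux_add_left, ha, hc, smul_add, add_mul]; abel
  | ι_mul X P hP =>
    rw [schoutenAux_ι_mul', schoutenAux_ι_mul', hP, lie_smul_right, contract_ι_mul, dFun_apply]
    simp only [map_sub, map_smul, map_mul, gradeInv_ι, mul_smul_comm, mul_add, smul_add,
      sub_mul, smul_mul_assoc, mul_assoc]
    simp only [neg_mul, sub_neg_eq_add]
    abel

/-- The operator `[P, ·]` has degree `p - 1`, so passing `Y` costs `(-1)^(p-1)`, which is encoded as
`-gradeInv P`. -/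
theorem schoutenAux_ι_mul_right (Y : L) (P Q : ExteriorAlgebra R L) :
    𝔞.schoutenAux P (ExteriorAlgebra.ι R Y * Q) =
      𝔞.schoutenAux P (ExteriorAlgebra.ι R Y) * Q -
        ExteriorAlgebra.ι R Y * 𝔞.schoutenAux (gradeInv P) Q := by
  induction P using exterior_induction with
  | algebraMap s =>
    rw [gradeInv_algebraMap]
    simp only [schoutenAux_algebraMap, contract_ι_mul, contract_ι, mul_neg, neg_mul,
      Algebra.smul_def]
    abel
  | add a c ha hc => simp only [map_add, schoutenAux_add_left, ha, hc, mul_add, add_mul]; abel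
  | ι_mul X P hP =>
    rw [schoutenAux_ι_mul', hP, lie_ι_mul, map_mul, gradeInv_ι, neg_mul, schoutenAux_neg_left,
      schoutenAux_ι_mul', schoutenAux_ι_mul', lie_ι, gradeInv_gradeInv]
    simp only [mul_sub, mul_add, add_mul, mul_neg, mul_assoc]
    rw [ι_ι_mul_swap X Y, ← mul_assoc (gradeInv P), gradeInv_mul_ι]
    simp only [mul_assoc]
    abel

/-- The Leibniz sign `(-1)^((p-1)a)` depends on two degrees at once. Fixing the parity of one
argument leaves a sign that is constant or expressed by `gradeInv` of the other, so no homogeneous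
decomposition is needed; the pairs of odd and even lemmas below follow this pattern. -/
theorem schoutenAux_mul_right_of_odd {P : ExteriorAlgebra R L} (hP : gradeInv P = - P)
    (A B : ExteriorAlgebra R L) :
    𝔞.schoutenAux P (A * B) = 𝔞.schoutenAux P A * B + A * 𝔞.schoutenAux P B := by
  induction A using exterior_induction with
  | algebraMap r =>
    rw [← Algebra.smul_def, schoutenAux_smul_right', schoutenAux_algebraMap_right,
      ← Algebra.smul_def, add_comm]
  | add a c ha hc => simp only [schoutenAux_add_right, ha, hc, add_mul]; abel
  | ι_mul X A hA =>
    rw [mul_assoc, schoutenAux_ι_mul_right, schoutenAux_ι_mul_right, hP]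
    simp only [schoutenAux_neg_left, hA, mul_add, mul_neg, add_mul, mul_assoc, sub_neg_eq_add]
    abel

theorem schoutenAux_mul_right_of_even {P : ExteriorAlgebra R L} (hP : gradeInv P = P)
    (A B : ExteriorAlgebra R L) :
    𝔞.schoutenAux P (A * B) = 𝔞.schoutenAux P A * B + gradeInv A * 𝔞.schoutenAux P B := by
  induction A using exterior_induction with
  | algebraMap r =>
    rw [← Algebra.smul_def, schoutenAux_smul_right', schoutenAux_algebraMap_right,
      gradeInv_algebraMap, ← Algebra.smul_def, add_comm]
  | add a c ha hc => simp only [schoutenAux_add_right, ha, hc, add_mul, map_add]; abel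
  | ι_mul X A hA =>
    rw [mul_assoc, schoutenAux_ι_mul_right, schoutenAux_ι_mul_right, hP, map_mul, gradeInv_ι]
    simp only [hA, mul_add, sub_mul, mul_assoc, neg_mul]
    abel

/-- The sign `-(-1)^((p-1)(q-1))` is `-1` for odd `q`. The induction compares the Leibniz rule in
the first argument, built into the definition, with the one in the second. -/
theorem schoutenAux_swap_of_odd {Q : ExteriorAlgebra R L} (hQ : gradeInv Q = - Q)
    (P : ExteriorAlgebra R L) : 𝔞.schoutenAux P Q = - 𝔞.schoutenAux Q P := by
  induction P using exterior_induction with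
  | algebraMap r =>
    rw [schoutenAux_algebraMap, schoutenAux_algebraMap_right, gradeInv_contract, hQ, map_neg,
      neg_neg]
  | add a c ha hc => simp only [schoutenAux_add_right, schoutenAux_add_left, ha, hc, neg_add]
  | ι_mul X P hP =>
    have h : gradeInv (𝔞.lie X Q) = - 𝔞.lie X Q := by rw [gradeInv_lie, hQ, lie_neg_right]
    rw [schoutenAux_ι_mul', hP, schoutenAux_mul_right_of_odd _ hQ, schoutenAux_ι_right,
      odd_mul_comm h, gradeInv_gradeInv, mul_neg, neg_mul, neg_add]
    abel

theorem schoutenAux_swap_of_even {Q : ExteriorAlgebra R L} (hQ : gradeInv Q = Q)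
    (P : ExteriorAlgebra R L) : 𝔞.schoutenAux P Q = 𝔞.schoutenAux Q (gradeInv P) := by
  induction P using exterior_induction with
  | algebraMap r =>
    rw [schoutenAux_algebraMap, gradeInv_algebraMap, schoutenAux_algebraMap_right,
      gradeInv_contract, hQ]
  | add a c ha hc => simp only [schoutenAux_add_right, schoutenAux_add_left, ha, hc, map_add]
  | ι_mul X P hP =>
    have h : gradeInv (𝔞.lie X Q) = 𝔞.lie X Q := by rw [gradeInv_lie, hQ]
    rw [schoutenAux_ι_mul', hP, map_mul, gradeInv_ι, neg_mul, schoutenAux_neg_right,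
      schoutenAux_mul_right_of_even _ hQ, schoutenAux_ι_right, gradeInv_ι, even_mul_comm h]
    simp only [neg_mul, neg_add, neg_neg]
    abel

theorem schoutenAux_mul_left_of_odd {B : ExteriorAlgebra R L} (hB : gradeInv B = - B)
    (A Q : ExteriorAlgebra R L) :
    𝔞.schoutenAux (A * B) Q = A * 𝔞.schoutenAux B Q + B * 𝔞.schoutenAux (gradeInv A) Q := by
  induction A using exterior_induction with
  | algebraMap r =>
    rw [← Algebra.smul_def, schoutenAux_smul_left, gradeInv_algebraMap, schoutenAux_algebraMap,
      ← Algebra.smul_def, mul_neg, sub_eq_add_neg]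
  | add a c ha hc => simp only [schoutenAux_add_left, ha, hc, add_mul, map_add, mul_add]; abel
  | ι_mul X A hA =>
    have h := odd_mul_comm hB (ExteriorAlgebra.ι R X)
    rw [gradeInv_ι, mul_neg] at h
    rw [mul_assoc, schoutenAux_ι_mul', hA, map_mul, map_mul, gradeInv_ι, neg_mul,
      schoutenAux_neg_left, schoutenAux_ι_mul', gradeInv_gradeInv, hB, mul_neg, odd_mul_comm hB,
      gradeInv_gradeInv]
    simp only [mul_add, mul_neg, neg_mul, ← mul_assoc, h]
    abel

theorem schoutenAux_mul_left_of_even {B : ExteriorAlgebra R L} (hB : gradeInv B = B)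
    (A Q : ExteriorAlgebra R L) :
    𝔞.schoutenAux (A * B) Q = A * 𝔞.schoutenAux B Q + B * 𝔞.schoutenAux A Q := by
  induction A using exterior_induction with
  | algebraMap r =>
    rw [← Algebra.smul_def, schoutenAux_smul_left, schoutenAux_algebraMap,
      ← Algebra.smul_def, mul_neg, sub_eq_add_neg]
  | add a c ha hc => simp only [schoutenAux_add_left, ha, hc, add_mul, mul_add]; abel
  | ι_mul X A hA =>
    have h := even_mul_comm hB (ExteriorAlgebra.ι R X)
    rw [mul_assoc, schoutenAux_ι_mul', hA, map_mul, schoutenAux_ι_mul', hB,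
      even_mul_comm hB]
    simp only [mul_add, ← mul_assoc, h]
    abel

end PreBracket
end Algebroid
end

noncomputable section

namespace Algebroid

namespace PreBracket

/-! ### The graded Jacobi identity -/

variable {R L : Type*} [CommRing R] [AddCommGroup L] [Module R L]
  [Algebra ℝ R] [Module ℝ L] [IsScalarTower ℝ R L] (𝔞 : PreBracket R L)

/-- The Jacobi identity holds, and the anchor is compatible with brackets. -/
structure IsLieRinehart : Prop where
  jacobi : ∀ X Y Z, 𝔞.bracket X (𝔞.bracket Y Z) =
    𝔞.bracket (𝔞.bracket X Y) Z + 𝔞.bracket Y (𝔞.bracket X Z)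
  anchor_bracket : ∀ X Y f,
    𝔞.anchor (𝔞.bracket X Y) f = 𝔞.anchor X (𝔞.anchor Y f) - 𝔞.anchor Y (𝔞.anchor X f)

variable {𝔞}

namespace IsLieRinehart

variable (h : 𝔞.IsLieRinehart)

include h

/-- Both sides are derivations of the wedge product in `a`: on functions they agree by compatibility
of the anchor, on sections by the Jacobi identity. -/
theorem lie_bracket (X Y : L) (a : ExteriorAlgebra R L) :
    𝔞.lie (𝔞.bracket X Y) a = 𝔞.lie X (𝔞.lie Y a) - 𝔞.lie Y (𝔞.lie X a) := by
  induction a using exterior_induction with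
  | algebraMap r =>
    simp only [lie_algebraMap, ← Algebra.algebraMap_eq_smul_one, h.anchor_bracket, map_sub]
  | add a c ha hc => simp only [lie_add_right, ha, hc]; abel
  | ι_mul Z a ha =>
    simp only [lie_ι_mul, lie_add_right, ha, h.jacobi X Y Z, map_add, mul_sub, add_mul]
    abel

/-- This is the Jacobi identity for `X`, `f` and `a`, read through `[f, ·] = -ι_{df}`. -/
theorem lie_contract (X : L) (f : R) (a : ExteriorAlgebra R L) :
    𝔞.lie X (contract (𝔞.dFun f) a) =
      contract (𝔞.dFun f) (𝔞.lie X a) + contract (𝔞.dFun (𝔞.anchor X f)) a := by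
  induction a using exterior_induction with
  | algebraMap r =>
    simp only [lie_algebraMap, ← Algebra.algebraMap_eq_smul_one, contract_algebraMap,
      lie_zero_right, add_zero]
  | add a c ha hc => simp only [lie_add_right, map_add, ha, hc]; abel
  | ι_mul Z a ha =>
    simp only [lie_ι_mul, contract_ι_mul, lie_sub_right, lie_smul_right, map_add, ha, dFun_apply,
      h.anchor_bracket, mul_add, sub_smul]
    abel

theorem lie_schoutenAux (X : L) (Q S : ExteriorAlgebra R L) :
    𝔞.lie X (𝔞.schoutenAux Q S) =
      𝔞.schoutenAux (𝔞.lie X Q) S + 𝔞.schoutenAux Q (𝔞.lie X S) := by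
  induction Q using exterior_induction with
  | algebraMap r =>
    simp only [schoutenAux_algebraMap, lie_algebraMap, ← Algebra.algebraMap_eq_smul_one,
      lie_neg_right, h.lie_contract]
    abel
  | add a c ha hc => simp only [lie_add_right, schoutenAux_add_left, ha, hc]; abel
  | ι_mul Y Q hQ =>
    simp only [schoutenAux_ι_mul', lie_add_right, schoutenAux_add_left, lie_mul, hQ,
      h.lie_bracket, gradeInv_lie, lie_ι, mul_add, mul_sub]
    abel

/-- The graded Jacobi identity with a function in the first slot, again because `[f, ·] = -ι_{df}`.
It is the base of the induction on `P` for the full identity, while `lie_schoutenAux` supplies the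
section that is split off in each step. -/
theorem contract_schoutenAux (f : R) (Q S : ExteriorAlgebra R L) :
    contract (𝔞.dFun f) (𝔞.schoutenAux Q S) =
      𝔞.schoutenAux (contract (𝔞.dFun f) Q) S -
        𝔞.schoutenAux (gradeInv Q) (contract (𝔞.dFun f) S) := by
  induction Q using exterior_induction with
  | algebraMap r =>
    rw [gradeInv_algebraMap]
    simp only [schoutenAux_algebraMap, contract_algebraMap, schoutenAux_zero_left, map_neg,
      contract_contract (𝔞.dFun f)]
    abel
  | add a c ha hc => simp only [map_add, schoutenAux_add_left, ha, hc]; abel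
  | ι_mul Y Q hQ =>
    have e := h.lie_contract Y f S
    rw [map_mul gradeInv, gradeInv_ι, neg_mul]
    simp only [schoutenAux_neg_left, schoutenAux_ι_mul', map_add, contract_ι_mul, hQ,
      schoutenAux_sub_left, schoutenAux_smul_left, dFun_apply, mul_sub]
    rw [contract_mul, gradeInv_gradeInv, e, mul_add, ← neg_eq_iff_eq_neg.2 (gradeInv_contract _ Q)]
    simp only [neg_mul]
    abel

theorem schoutenAux_jacobi_of_odd {Q : ExteriorAlgebra R L} (hQ : gradeInv Q = - Q)
    (P S : ExteriorAlgebra R L) :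
    𝔞.schoutenAux P (𝔞.schoutenAux Q S) =
      𝔞.schoutenAux (𝔞.schoutenAux P Q) S + 𝔞.schoutenAux Q (𝔞.schoutenAux P S) := by
  induction P using exterior_induction with
  | algebraMap r =>
    simp only [schoutenAux_algebraMap, h.contract_schoutenAux, hQ, schoutenAux_neg_left,
      schoutenAux_neg_right]
    abel
  | add a c ha hc => simp only [schoutenAux_add_right, schoutenAux_add_left, ha, hc]; abel
  | ι_mul X P hP =>
    have hX : gradeInv (𝔞.lie X Q) = - 𝔞.lie X Q := by rw [gradeInv_lie, hQ, lie_neg_right]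
    have e := 𝔞.schoutenAux_swap_of_odd hQ (gradeInv P)
    have e' := 𝔞.gradeInv_schoutenAux P Q
    rw [hQ, schoutenAux_neg_right, neg_neg] at e'
    simp only [schoutenAux_ι_mul', schoutenAux_add_left, schoutenAux_add_right, hP,
      schoutenAux_mul_right_of_odd _ hQ, schoutenAux_mul_left_of_odd _ hX, e', e,
      schoutenAux_ι_right, gradeInv_gradeInv, h.lie_schoutenAux, mul_add, neg_mul]
    abel

theorem schoutenAux_jacobi_of_even {Q : ExteriorAlgebra R L} (hQ : gradeInv Q = Q)
    (P S : ExteriorAlgebra R L) :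
    𝔞.schoutenAux P (𝔞.schoutenAux Q S) =
      𝔞.schoutenAux (𝔞.schoutenAux P Q) S - 𝔞.schoutenAux Q (𝔞.schoutenAux (gradeInv P) S) := by
  induction P using exterior_induction with
  | algebraMap r =>
    rw [gradeInv_algebraMap]
    simp only [schoutenAux_algebraMap, h.contract_schoutenAux, hQ, schoutenAux_neg_left,
      schoutenAux_neg_right]
    abel
  | add a c ha hc => simp only [map_add, schoutenAux_add_right, schoutenAux_add_left, ha, hc]; abel
  | ι_mul X P hP =>
    have hX : gradeInv (𝔞.lie X Q) = 𝔞.lie X Q := by rw [gradeInv_lie, hQ]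
    have e := 𝔞.schoutenAux_swap_of_even hQ (gradeInv P)
    have e' := 𝔞.gradeInv_schoutenAux P Q
    rw [gradeInv_gradeInv] at e
    rw [hQ] at e'
    rw [map_mul, gradeInv_ι, neg_mul]
    simp only [schoutenAux_neg_left, schoutenAux_neg_right, schoutenAux_ι_mul',
      schoutenAux_add_left, schoutenAux_add_right, hP,
      schoutenAux_mul_right_of_even _ hQ, schoutenAux_mul_left_of_even _ hX, e', e,
      schoutenAux_ι_right, gradeInv_gradeInv, gradeInv_ι, h.lie_schoutenAux, mul_add, mul_sub,
      neg_mul]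
    abel

end IsLieRinehart

/-! ### Deformation by an endomorphism -/

/-- `𝔟` is the deformation of `𝔞` by `N`. -/
structure IsDeformation (𝔞 𝔟 : PreBracket R L) (N : L →ₗ[R] L) : Prop where
  bracket : ∀ X Y,
    𝔟.bracket X Y = 𝔞.bracket (N X) Y + 𝔞.bracket X (N Y) - N (𝔞.bracket X Y)
  anchor : ∀ X, 𝔟.anchor X = 𝔞.anchor (N X)

namespace IsDeformation

variable {𝔟 : PreBracket R L} {N : L →ₗ[R] L} (h : IsDeformation 𝔞 𝔟 N)

include h

theorem dFun (f : R) : 𝔟.dFun f = 𝔞.dFun f ∘ₗ N := by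
  ext X
  simp [h.anchor]

/-- The right side is `𝓛_{NX}` minus the commutator of `N` with `𝓛_X`, hence a derivation; it
suffices to compare on functions and sections, where it is the definition of the deformation. -/
theorem lie (X : L) (a : ExteriorAlgebra R L) :
    𝔟.lie X a = 𝔞.lie (N X) a + 𝔞.lie X (derivExt N a) - derivExt N (𝔞.lie X a) := by
  induction a using exterior_induction with
  | algebraMap r =>
    simp only [lie_algebraMap, ← Algebra.algebraMap_eq_smul_one, derivExt_algebraMap,
      lie_zero_right, h.anchor, add_zero, sub_zero]
  | add a c ha hc => simp only [lie_add_right, derivExt_add, ha, hc]; abel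
  | ι_mul Y a ha =>
    simp only [lie_ι_mul, derivExt_ι_mul, lie_add_right, derivExt_add, ha, h.bracket, map_add,
      map_sub, mul_add, mul_sub, add_mul, sub_mul]
    abel

/-- The identity behind `[N, l2] = l2_N`. On functions it rests on `d_N f = N* df` and the
commutator of `N` with contractions. -/
theorem schoutenAux (P Q : ExteriorAlgebra R L) :
    𝔟.schoutenAux P Q = 𝔞.schoutenAux (derivExt N P) Q + 𝔞.schoutenAux P (derivExt N Q) -
      derivExt N (𝔞.schoutenAux P Q) := by
  induction P using exterior_induction with
  | algebraMap r =>
    simp only [schoutenAux_algebraMap, derivExt_algebraMap, schoutenAux_zero_left, h.dFun,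
      derivExt_neg, derivExt_contract]
    abel
  | add a c ha hc => simp only [schoutenAux_add_left, derivExt_add, ha, hc]; abel
  | ι_mul X P hP =>
    simp only [schoutenAux_ι_mul', schoutenAux_add_left, derivExt_add, derivExt_mul,
      derivExt_ι, hP, h.lie, gradeInv_derivExt, mul_add, mul_sub]
    abel

/-- The deformation of a Lie algebra by a Nijenhuis operator satisfies the Jacobi identity. -/
theorem jacobi (hJ : ∀ X Y Z, 𝔞.bracket X (𝔞.bracket Y Z) + 𝔞.bracket Y (𝔞.bracket Z X) +
      𝔞.bracket Z (𝔞.bracket X Y) = 0)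
    (hN : ∀ X Y, N (𝔟.bracket X Y) = 𝔞.bracket (N X) (N Y)) (X Y Z : L) :
    𝔟.bracket X (𝔟.bracket Y Z) + 𝔟.bracket Y (𝔟.bracket Z X) +
      𝔟.bracket Z (𝔟.bracket X Y) = 0 := by
  -- The torsion condition is used twice: on `N [Y, Z]_N`, and on `[NX, N[Y, Z]]`, whose expansion
  -- cancels `N[X, N[Y, Z]]`. Only nested brackets of `𝔞` with `N` on the arguments or outermost
  -- remain, and their cyclic sum regroups into seven Jacobi identities.
  have key : ∀ X Y Z, 𝔟.bracket X (𝔟.bracket Y Z) =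
      𝔞.bracket X (𝔞.bracket (N Y) (N Z)) + 𝔞.bracket (N X) (𝔞.bracket (N Y) Z) +
      𝔞.bracket (N X) (𝔞.bracket Y (N Z)) - N (𝔞.bracket X (𝔞.bracket (N Y) Z) +
      𝔞.bracket X (𝔞.bracket Y (N Z)) + 𝔞.bracket (N X) (𝔞.bracket Y Z)) +
      N (N (𝔞.bracket X (𝔞.bracket Y Z))) := by
    intro X Y Z
    have e := hN X (𝔞.bracket Y Z)
    rw [h.bracket X (𝔟.bracket Y Z), hN, h.bracket Y Z]
    rw [h.bracket] at e
    simp only [map_add, map_sub] at e ⊢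
    rw [← e]
    abel
  rw [key, key, key]
  have e1 := hJ X (N Y) (N Z)
  have e2 := hJ Y (N Z) (N X)
  have e3 := hJ Z (N X) (N Y)
  have e4 := congrArg N (hJ X Y (N Z))
  have e5 := congrArg N (hJ Y Z (N X))
  have e6 := congrArg N (hJ Z X (N Y))
  have e7 := congrArg (fun W => N (N W)) (hJ X Y Z)
  simp only [map_add, map_zero] at e4 e5 e6 e7 ⊢
  linear_combination (norm := module) e1 + e2 + e3 - e4 - e5 - e6 + e7

end IsDeformation

end PreBracket
end Algebroid
end

noncomputable section

namespace Algebroid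

/-! ### Degrees -/

section Degrees

variable {R L : Type*} [CommRing R] [AddCommGroup L] [Module R L]

@[elab_as_elim]
theorem exteriorPower_induction {C : ∀ (n : ℕ) (a : ExteriorAlgebra R L), a ∈ ⋀[R]^n L → Prop}
    (algebraMap : ∀ r : R, C 0 (algebraMap R _ r) (Submodule.algebraMap_mem r))
    (add : ∀ n a b ha hb, C n a ha → C n b hb → C n (a + b) (add_mem ha hb))
    (ι_mul : ∀ n X a ha, C n a ha → C (n + 1) (ExteriorAlgebra.ι R X * a)
      (by rw [ExteriorAlgebra.exteriorPower, pow_succ']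
          exact Submodule.mul_mem_mul ⟨X, rfl⟩ ha))
    {n : ℕ} {a : ExteriorAlgebra R L} (ha : a ∈ ⋀[R]^n L) : C n a ha := by
  refine Submodule.pow_induction_on_left' (LinearMap.range (ExteriorAlgebra.ι R (M := L)))
    (C := C) algebraMap (fun a b n => add n a b) ?_ ha
  rintro _ ⟨X, rfl⟩ n a ha h
  exact ι_mul n X a ha h

theorem ι_mul_mem_exteriorPower {n : ℕ} (X : L) {a : ExteriorAlgebra R L} (ha : a ∈ ⋀[R]^n L) :
    ExteriorAlgebra.ι R X * a ∈ ⋀[R]^(n + 1) L := by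
  rw [ExteriorAlgebra.exteriorPower, pow_succ']
  exact Submodule.mul_mem_mul ⟨X, rfl⟩ ha

theorem algebraMap_mem_exteriorPower (r : R) :
    algebraMap R (ExteriorAlgebra R L) r ∈ ⋀[R]^0 L := by
  rw [ExteriorAlgebra.exteriorPower, pow_zero]
  exact Submodule.algebraMap_mem r

theorem ι_mem_exteriorPower (X : L) : ExteriorAlgebra.ι R X ∈ ⋀[R]^1 L := by
  rw [ExteriorAlgebra.exteriorPower, pow_one]
  exact ⟨X, rfl⟩

theorem mem_exteriorPower_one {a : ExteriorAlgebra R L} (ha : a ∈ ⋀[R]^1 L) :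
    ∃ X, ExteriorAlgebra.ι R X = a := by
  rw [ExteriorAlgebra.exteriorPower, pow_one] at ha
  exact ha

theorem gradeInv_of_mem {n : ℕ} {a : ExteriorAlgebra R L} (ha : a ∈ ⋀[R]^n L) :
    gradeInv a = (-1 : R) ^ n • a := by
  induction ha using exteriorPower_induction with
  | algebraMap r => rw [gradeInv_algebraMap, pow_zero, one_smul]
  | add n a b _ _ ha hb => rw [map_add, ha, hb, smul_add]
  | ι_mul n X a _ ha =>
    rw [map_mul, gradeInv_ι, ha, pow_succ, mul_neg_one, neg_smul, neg_mul, mul_smul_comm]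

theorem derivExt_mem (N : L →ₗ[R] L) {n : ℕ} {a : ExteriorAlgebra R L} (ha : a ∈ ⋀[R]^n L) :
    derivExt N a ∈ ⋀[R]^n L := by
  induction ha using exteriorPower_induction with
  | algebraMap r => rw [derivExt_algebraMap]; exact zero_mem _
  | add n a b _ _ ha hb => rw [derivExt_add]; exact add_mem ha hb
  | ι_mul n X a h ha =>
    rw [derivExt_ι_mul]
    exact add_mem (ι_mul_mem_exteriorPower X ha) (ι_mul_mem_exteriorPower _ h)

variable (R L) in
/-- The part of degree `i` of the exterior algebra, for an integer `i`. -/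
def intPart (i : ℤ) : Submodule R (ExteriorAlgebra R L) :=
  if 0 ≤ i then ⋀[R]^i.toNat L else ⊥

theorem intPart_natCast (n : ℕ) : intPart R L n = ⋀[R]^n L := by simp [intPart]

theorem mul_mem_intPart {i j : ℤ} {a b : ExteriorAlgebra R L} (ha : a ∈ intPart R L i)
    (hb : b ∈ intPart R L j) : a * b ∈ intPart R L (i + j) := by
  unfold intPart at ha hb
  split_ifs at ha hb with hi hj
  · obtain ⟨m, rfl⟩ := Int.eq_ofNat_of_zero_le hi
    obtain ⟨n, rfl⟩ := Int.eq_ofNat_of_zero_le hj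
    rw [← Nat.cast_add, intPart_natCast, ExteriorAlgebra.exteriorPower, pow_add]
    exact Submodule.mul_mem_mul ha hb
  · rw [(Submodule.mem_bot R).1 hb, mul_zero]; exact zero_mem _
  · rw [(Submodule.mem_bot R).1 ha, zero_mul]; exact zero_mem _
  · rw [(Submodule.mem_bot R).1 ha, zero_mul]; exact zero_mem _

theorem ι_mem_intPart (X : L) : ExteriorAlgebra.ι R X ∈ intPart R L 1 := by
  rw [← Nat.cast_one, intPart_natCast]; exact ι_mem_exteriorPower X

open Algebroid.PreBracket

variable [Algebra ℝ R] [Module ℝ L] [IsScalarTower ℝ R L] (𝔞 : PreBracket R L)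

/-- Degrees are integers here because contracting a function lands in degree `-1`, where the part is
zero. -/
theorem contract_mem_intPart (α : Module.Dual R L) {n : ℕ} {a : ExteriorAlgebra R L}
    (ha : a ∈ ⋀[R]^n L) : contract α a ∈ intPart R L (n - 1) := by
  induction ha using exteriorPower_induction with
  | algebraMap r => rw [contract_algebraMap]; exact zero_mem _
  | add n a b _ _ ha hb => rw [map_add]; exact add_mem ha hb
  | ι_mul n X a h ha =>
    rw [contract_ι_mul, Nat.cast_succ, add_sub_cancel_right]
    refine sub_mem (Submodule.smul_mem _ _ (by rwa [intPart_natCast])) ?_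
    simpa using mul_mem_intPart (ι_mem_intPart X) ha

theorem contract_mem_exteriorPower (α : Module.Dual R L) {n : ℕ} {a : ExteriorAlgebra R L}
    (ha : a ∈ ⋀[R]^(n + 1) L) : contract α a ∈ ⋀[R]^n L := by
  rw [← intPart_natCast]
  simpa using contract_mem_intPart α ha

theorem lie_mem (X : L) {n : ℕ} {a : ExteriorAlgebra R L} (ha : a ∈ ⋀[R]^n L) :
    𝔞.lie X a ∈ ⋀[R]^n L := by
  induction ha using exteriorPower_induction with
  | algebraMap r =>
    rw [lie_algebraMap, ← Algebra.algebraMap_eq_smul_one]; exact algebraMap_mem_exteriorPower _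
  | add n a b _ _ ha hb => rw [lie_add_right]; exact add_mem ha hb
  | ι_mul n X a h ha =>
    rw [lie_ι_mul]
    exact add_mem (ι_mul_mem_exteriorPower X ha) (ι_mul_mem_exteriorPower _ h)

theorem schoutenAux_mem {m n : ℕ} {P Q : ExteriorAlgebra R L} (hP : P ∈ ⋀[R]^m L)
    (hQ : Q ∈ ⋀[R]^n L) : 𝔞.schoutenAux P Q ∈ intPart R L (m + n - 1) := by
  induction hP using exteriorPower_induction with
  | algebraMap r =>
    rw [schoutenAux_algebraMap, Nat.cast_zero, zero_add]
    exact neg_mem (contract_mem_intPart _ hQ)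
  | add n a b _ _ ha hb => rw [schoutenAux_add_left]; exact add_mem ha hb
  | ι_mul m X a h ha =>
    rw [schoutenAux_ι_mul', Nat.cast_succ]
    refine add_mem ?_ ?_
    · have e := mul_mem_intPart (ι_mem_intPart X) ha
      rwa [show (1 + ((m : ℤ) + n - 1)) = m + 1 + n - 1 by ring] at e
    · rw [show (m : ℤ) + 1 + n - 1 = m + n by ring, gradeInv_of_mem h]
      refine mul_mem_intPart ?_ ?_
      · rw [intPart_natCast]; exact Submodule.smul_mem _ _ h
      · rw [intPart_natCast]; exact lie_mem 𝔞 X hQ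

/-- If the identity is locally a sum of tensors `ε i ⊗ e i`, then so is the multiplication by the
degree on the exterior algebra. -/
theorem sum_ι_mul_contract {κ : Type*} [Fintype κ] (e : κ → L) (ε : κ → Module.Dual R L) (f : R)
    (h : ∀ X, f • X = ∑ i, ε i X • e i) {n : ℕ} {a : ExteriorAlgebra R L} (ha : a ∈ ⋀[R]^n L) :
    ∑ i, ExteriorAlgebra.ι R (e i) * contract (ε i) a = (n : R) • f • a := by
  induction ha using exteriorPower_induction with
  | algebraMap r => simp [contract_algebraMap]
  | add n a b _ _ ha hb => simp only [map_add, mul_add, Finset.sum_add_distrib, ha, hb, smul_add]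
  | ι_mul n X a _ ha =>
    have h1 : ∀ i, ExteriorAlgebra.ι R (e i) * contract (ε i) (ExteriorAlgebra.ι R X * a) =
        ExteriorAlgebra.ι R (ε i X • e i) * a +
          ExteriorAlgebra.ι R X * (ExteriorAlgebra.ι R (e i) * contract (ε i) a) := by
      intro i
      rw [contract_ι_mul, mul_sub, ι_ι_mul_swap, map_smul, mul_smul_comm, smul_mul_assoc,
        sub_neg_eq_add]
    rw [Finset.sum_congr rfl fun i _ => h1 i, Finset.sum_add_distrib, ← Finset.mul_sum, ha,
      ← Finset.sum_mul, ← map_sum, ← h, Nat.cast_succ, add_smul, one_smul, map_smul,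
      smul_mul_assoc, mul_smul_comm, mul_smul_comm, add_comm]

/-- A bivector is recovered from its double contractions by applying `sum_ι_mul_contract` twice: in
degree one it kills `f • contract α a`, in degree two it gives `2 (f * f) • a = 0`. The factor `2`
is invertible in a real algebra. -/
theorem smul_eq_zero_of_contract_contract {κ : Type*} [Fintype κ] (e : κ → L)
    (ε : κ → Module.Dual R L) (f : R) (h : ∀ X, f • X = ∑ i, ε i X • e i)
    {a : ExteriorAlgebra R L} (ha : a ∈ ⋀[R]^2 L)
    (h0 : ∀ α β, contract β (contract α a) = 0) : (f * f) • a = 0 := by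
  have h1 : ∀ α, f • contract α a = 0 := by
    intro α
    have h2 := sum_ι_mul_contract e ε f h (contract_mem_exteriorPower α ha)
    rw [Nat.cast_one, one_smul] at h2
    rw [← h2]
    simp [h0]
  have h2 := sum_ι_mul_contract e ε f h ha
  have h3 : ((2 : ℕ) : R) • (f * f) • a = 0 := by
    rw [mul_smul, smul_comm _ f, ← h2, Finset.smul_sum]
    exact Finset.sum_eq_zero fun i _ => by rw [← mul_smul_comm, h1, mul_zero]
  have h4 : (algebraMap ℝ R (1 / 2)) * ((2 : ℕ) : R) = 1 := by
    rw [← map_natCast (algebraMap ℝ R), ← map_mul]; norm_num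
  rw [← one_smul R ((f * f) • a), ← h4, mul_smul, h3, smul_zero]

end Degrees

namespace PreBracket

/-! ### The concomitant of a bivector and an endomorphism -/

variable {R L : Type*} [CommRing R] [AddCommGroup L] [Module R L]
  [Algebra ℝ R] [Module ℝ L] [IsScalarTower ℝ R L] (𝔞 : PreBracket R L)

/-- Unlike `lie_contract`, this holds for every `α` without the Jacobi identity: the term `lieForm`
is by construction the commutator of `𝓛_X` with contraction. -/
theorem lie_contract_eq (X : L) (α : Module.Dual R L) (a : ExteriorAlgebra R L) :
    𝔞.lie X (contract α a) = contract α (𝔞.lie X a) + contract (𝔞.lieForm X α) a := by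
  induction a using exterior_induction with
  | algebraMap r =>
    simp only [lie_algebraMap, ← Algebra.algebraMap_eq_smul_one, contract_algebraMap,
      lie_zero_right, add_zero]
  | add a c ha hc => simp only [lie_add_right, map_add, ha, hc]; abel
  | ι_mul Z a ha =>
    have e : 𝔞.lieForm X α Z = 𝔞.anchor X (α Z) - α (𝔞.bracket X Z) := rfl
    simp only [lie_ι_mul, contract_ι_mul, lie_sub_right, lie_smul_right, map_add, ha, e, mul_add,
      sub_smul]
    abel

section

variable {W : ExteriorAlgebra R L} (hW : W ∈ ⋀[R]^2 L)

include hW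

/-- `sharpExt` uses only a left inverse of `ι`; for `W` of degree two the contraction already lies
in the image of `ι`, so nothing is lost. -/
theorem ι_sharpExt (α : Module.Dual R L) :
    ExteriorAlgebra.ι R (sharpExt W α) = contract α W := by
  obtain ⟨X, hX⟩ := mem_exteriorPower_one (contract_mem_exteriorPower α hW)
  change ExteriorAlgebra.ι R (ExteriorAlgebra.ιInv (contract α W)) = _
  rw [← hX, ExteriorAlgebra.ι_leftInverse]

theorem sharpExt_swap (α β : Module.Dual R L) : α (sharpExt W β) = - β (sharpExt W α) := by
  have h := contract_contract β α W
  rw [← ι_sharpExt hW, ← ι_sharpExt hW, contract_ι, contract_ι, ← map_neg] at h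
  have := ExteriorAlgebra.algebraMap_leftInverse (R := R) L |>.injective h
  rw [this, neg_neg]

theorem contract_contract_lie (X : L) (α β : Module.Dual R L) :
    contract β (contract α (𝔞.lie X W)) = algebraMap R _
      (β (𝔞.bracket X (sharpExt W α)) + 𝔞.anchor X (α (sharpExt W β)) -
        α (𝔞.bracket X (sharpExt W β))) := by
  have h := 𝔞.lie_contract_eq X α W
  rw [← ι_sharpExt hW, lie_ι, ← ι_sharpExt hW] at h
  rw [eq_sub_of_add_eq h.symm, map_sub, contract_ι, contract_ι, ← map_sub,
    sharpExt_swap hW β (𝔞.lieForm X α), sub_neg_eq_add]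
  change _ = algebraMap R _ (_ + _ - _)
  rw [add_sub_assoc]
  rfl

/-- The map `P ↦ N [W, P] - [W, N P] - [W, P]_N`. -/
def concomitantMap (𝔞 𝔟 : PreBracket R L) (N : L →ₗ[R] L) (W P : ExteriorAlgebra R L) :
    ExteriorAlgebra R L :=
  derivExt N (𝔞.schoutenAux W P) - 𝔞.schoutenAux W (derivExt N P) - 𝔟.schoutenAux W P

variable {𝔞} {𝔟 : PreBracket R L} {N : L →ₗ[R] L}

/-- Since `[W, X] = -𝓛_X W`, the map on sections consists of Lie derivatives of `W`. Moving `N`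
across the contractions and expanding each `𝓛_X W` on `α`, `β` produces the terms of the concomitant
of the dual brackets; the Jacobi identity plays no role. -/
theorem contract_contract_concomitantMap (h : IsDeformation 𝔞 𝔟 N)
    (hN : ∀ α : Module.Dual R L, N (sharpExt W α) = sharpExt W (α ∘ₗ N)) (X : L)
    (α β : Module.Dual R L) :
    contract β (contract α (concomitantMap 𝔞 𝔟 N W (ExteriorAlgebra.ι R X))) =
      - algebraMap R _ ((𝔞.dualBracket (sharpExt W) (α ∘ₗ N) β +
          𝔞.dualBracket (sharpExt W) α (β ∘ₗ N) - 𝔞.dualBracket (sharpExt W) α β ∘ₗ N -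
          𝔟.dualBracket (sharpExt W) α β) X) := by
  have e : ∀ Q : ExteriorAlgebra R L, contract β (contract α (derivExt N Q)) =
      derivExt N (contract β (contract α Q)) + contract (β ∘ₗ N) (contract α Q) +
        contract β (contract (α ∘ₗ N) Q) := by
    intro Q
    rw [derivExt_contract, derivExt_contract, map_sub]
    abel
  have swp : ∀ s : L, 𝔞.bracket s X = - 𝔞.bracket X s := fun s => 𝔞.bracket_swap s X
  have swp' : ∀ s : L, 𝔞.bracket s (N X) = - 𝔞.bracket (N X) s := fun s => 𝔞.bracket_swap s _
  have dA : ∀ (𝔠 : PreBracket R L) (γ δ : Module.Dual R L) (Y : L),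
      𝔠.dualBracket (sharpExt W) γ δ Y =
        (𝔠.anchor (sharpExt W γ) (δ Y) - δ (𝔠.bracket (sharpExt W γ) Y)) -
        (𝔠.anchor (sharpExt W δ) (γ Y) - γ (𝔠.bracket (sharpExt W δ) Y)) -
        𝔠.anchor Y (δ (sharpExt W γ)) := fun _ _ _ _ => rfl
  rw [concomitantMap, derivExt_ι, schoutenAux_ι_right, schoutenAux_ι_right, schoutenAux_ι_right,
    derivExt_neg]
  simp only [map_sub (contract α), map_sub (contract β), map_neg (contract α),
    map_neg (contract β), e, contract_contract_lie _ hW, derivExt_algebraMap, zero_add]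
  simp only [← map_add, ← map_sub, ← map_neg]
  congr 1
  simp only [LinearMap.sub_apply, LinearMap.add_apply, LinearMap.comp_apply, dA, h.bracket,
    h.anchor, ← hN, map_add, map_sub, swp, swp', map_neg, sharpExt_swap hW α β]
  -- The form `β(N π♯α)` is skew because `Nπ♯ = π♯N*`; this matches the remaining anchor terms.
  have e1 : α (N (sharpExt W β)) = - β (N (sharpExt W α)) := by
    rw [hN, sharpExt_swap hW α]; rfl
  simp only [e1, map_neg]
  ring

/-- For even `W` the operators `[W, ·]` and `[W, ·]_N` are odd derivations, and so is the commutator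
of the first with `N`. Thus `concomitantMap` is determined by functions and sections. -/
theorem concomitantMap_ι_mul (Y : L) (P : ExteriorAlgebra R L) :
    concomitantMap 𝔞 𝔟 N W (ExteriorAlgebra.ι R Y * P) =
      concomitantMap 𝔞 𝔟 N W (ExteriorAlgebra.ι R Y) * P -
        ExteriorAlgebra.ι R Y * concomitantMap 𝔞 𝔟 N W P := by
  have h : gradeInv W = W := by rw [gradeInv_of_mem hW]; simp
  simp only [concomitantMap, derivExt_ι_mul, schoutenAux_add_right]
  rw [schoutenAux_ι_mul_right, schoutenAux_ι_mul_right, schoutenAux_ι_mul_right,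
    schoutenAux_ι_mul_right, h, derivExt_sub, derivExt_mul, derivExt_mul]
  simp only [derivExt_ι, sub_mul, mul_sub]
  abel

/-- On a function `r` the map is `π♯N* dr - Nπ♯ dr`. -/
theorem concomitantMap_algebraMap (h : IsDeformation 𝔞 𝔟 N)
    (hN : ∀ α : Module.Dual R L, N (sharpExt W α) = sharpExt W (α ∘ₗ N)) (r : R) :
    concomitantMap 𝔞 𝔟 N W (algebraMap R _ r) = 0 := by
  rw [concomitantMap, derivExt_algebraMap, schoutenAux_zero_right, schoutenAux_algebraMap_right,
    schoutenAux_algebraMap_right, h.dFun, ← ι_sharpExt hW, ← ι_sharpExt hW, gradeInv_ι, gradeInv_ι,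
    derivExt_neg, derivExt_ι, hN]
  simp

end

end PreBracket
end Algebroid
end

noncomputable section

namespace Algebroid

/-! ### Insertion of forms with components of arity at most two. -/

section LowForms

variable {E : Type*} [AddCommGroup E] [Module ℝ E]

/-- Forms with components of arity at most two. -/
def lowForm (C : E) (f : E →ₗ[ℝ] E) (B : E →ₗ[ℝ] E →ₗ[ℝ] E) : FormalSum E
  | 0, _ => C
  | 1, x => f (x 0)
  | 2, x => B (x 0) (x 1)
  | _ + 3, _ => 0

variable (C C' : E) (f f' : E →ₗ[ℝ] E) (B B' : E →ₗ[ℝ] E →ₗ[ℝ] E)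

theorem lowForm_eq_zero {n : ℕ} (hn : 3 ≤ n) (x : Fin n → E) : lowForm C f B n x = 0 := by
  obtain ⟨m, rfl⟩ := Nat.exists_eq_add_of_le' hn
  rfl

theorem lowForm_cons_zero {n : ℕ} (x : Fin n → E) :
    lowForm C f B (n + 1) (Fin.cons 0 x) = 0 := by
  match n, x with
  | 0, x => exact map_zero f
  | 1, x => exact congrArg (· (x 0)) (map_zero B)
  | n + 2, x => rfl

theorem koszulSign_one {n : ℕ} (s : Fin n → ZMod 2) : koszulSign s 1 = 1 := by
  unfold koszulSign
  rw [Finset.filter_false_of_mem, Finset.prod_empty]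
  rintro p - ⟨h1, h2⟩
  exact lt_asymm h1 h2

theorem koszulSign_swap (s : Fin 2 → ZMod 2) :
    koszulSign s (Equiv.swap 0 1) = paritySign (s 1) (s 0) := by
  unfold koszulSign
  have : (Finset.univ.filter fun p : Fin 2 × Fin 2 => p.1 < p.2 ∧
      Equiv.swap (0 : Fin 2) 1 p.2 < Equiv.swap (0 : Fin 2) 1 p.1) = {(0, 1)} := by decide
  rw [this, Finset.prod_singleton]
  rfl

theorem koszulSign_swap_last (s : Fin 3 → ZMod 2) :
    koszulSign s (Equiv.swap 1 2) = paritySign (s 2) (s 1) := by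
  unfold koszulSign
  have : (Finset.univ.filter fun p : Fin 3 × Fin 3 => p.1 < p.2 ∧
      Equiv.swap (1 : Fin 3) 2 p.2 < Equiv.swap (1 : Fin 3) 2 p.1) = {(1, 2)} := by decide
  rw [this, Finset.prod_singleton]
  rfl

/-- The rotation is the `(2, 1)`-shuffle bringing the last two arguments in front of the first, so
the first one is passed by both others. -/
theorem koszulSign_finRotate (s : Fin 3 → ZMod 2) :
    koszulSign s (finRotate 3) = paritySign (s 1) (s 0) * paritySign (s 2) (s 0) := by
  unfold koszulSign
  have : (Finset.univ.filter fun p : Fin 3 × Fin 3 => p.1 < p.2 ∧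
      finRotate 3 p.2 < finRotate 3 p.1) = {(0, 2), (1, 2)} := by decide
  rw [this, Finset.prod_pair (by decide)]
  rfl

variable (𝒜 : ℤ → Submodule ℝ E)

theorem isSymmetricForm_lowForm {d : ℤ} (hC : C ∈ 𝒜 d) (hf : ∀ i, ∀ x ∈ 𝒜 i, f x ∈ 𝒜 (i + d))
    (hB : ∀ i j, ∀ x ∈ 𝒜 i, ∀ y ∈ 𝒜 j, B x y ∈ 𝒜 (i + j + d))
    (hs : ∀ i j, ∀ x ∈ 𝒜 i, ∀ y ∈ 𝒜 j, B x y = paritySign (i : ZMod 2) (j : ZMod 2) • B y x) :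
    IsSymmetricForm 𝒜 d (lowForm C f B) := by
  intro n
  match n with
  | 0 =>
    refine ⟨⟨MultilinearMap.constOfIsEmpty ℝ _ C, fun _ => rfl⟩, fun deg x hx => ⟨?_, fun σ => ?_⟩⟩
    · change C ∈ _; simpa using hC
    · rw [Subsingleton.elim σ 1, koszulSign_one, one_smul]; rfl
  | 1 =>
    refine ⟨⟨MultilinearMap.ofSubsingleton ℝ E E (0 : Fin 1) f, fun _ => rfl⟩,
      fun deg x hx => ⟨?_, fun σ => ?_⟩⟩
    · change f (x 0) ∈ _; simpa using hf _ _ (hx 0)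
    · rw [Subsingleton.elim σ 1, koszulSign_one, one_smul]; rfl
  | 2 =>
    refine ⟨⟨{ toFun := fun x => B (x 0) (x 1), map_update_add' := ?_, map_update_smul' := ?_ },
      fun _ => rfl⟩, fun deg x hx => ⟨?_, fun σ => ?_⟩⟩
    · intro _ x i a b
      fin_cases i <;> simp [Function.update]
    · intro _ x i a b
      fin_cases i <;> simp [Function.update]
    · rw [Fin.sum_univ_two]
      exact hB _ _ _ (hx 0) _ (hx 1)
    · have : ∀ σ : Equiv.Perm (Fin 2), σ = 1 ∨ σ = Equiv.swap 0 1 := by decide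
      rcases this σ with rfl | rfl
      · rw [koszulSign_one, one_smul]; rfl
      · rw [koszulSign_swap]
        change B (x 0) (x 1) = _ • B (x 1) (x 0)
        rw [hs _ _ _ (hx 0) _ (hx 1)]
        unfold paritySign
        simp only [and_comm]
  | n + 3 =>
    refine ⟨⟨0, fun _ => rfl⟩, fun deg x hx => ⟨zero_mem _, fun σ => ?_⟩⟩
    exact (smul_zero _).symm

variable [DirectSum.Decomposition 𝒜]

theorem parityPart_add (s : ZMod 2) (x y : E) :
    parityPart 𝒜 s (x + y) = parityPart 𝒜 s x + parityPart 𝒜 s y := by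
  unfold parityPart
  rw [DirectSum.decompose_add, map_add]

theorem parityPart_zero (s : ZMod 2) : parityPart 𝒜 s (0 : E) = 0 := by
  unfold parityPart
  rw [DirectSum.decompose_zero, map_zero]

theorem parityPart_of_mem (s : ZMod 2) {i : ℤ} {x : E} (hx : x ∈ 𝒜 i) :
    parityPart 𝒜 s x = if (i : ZMod 2) = s then x else 0 := by
  unfold parityPart
  rw [DirectSum.decompose_of_mem 𝒜 hx]
  erw [DirectSum.toModule_lof]
  split_ifs <;> rfl

theorem parityPart_zero_add_one (x : E) : parityPart 𝒜 0 x + parityPart 𝒜 1 x = x := by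
  induction x using DirectSum.Decomposition.inductionOn 𝒜 with
  | zero => simp [parityPart_zero]
  | @homogeneous i x =>
    rw [parityPart_of_mem 𝒜 0 x.2, parityPart_of_mem 𝒜 1 x.2]
    have : ∀ a : ZMod 2, a = 0 ∨ a = 1 := by decide
    rcases this (i : ZMod 2) with h | h <;> simp [h]
  | add x y hx hy =>
    rw [parityPart_add, parityPart_add]
    nth_rw 3 [← hx]
    nth_rw 3 [← hy]
    abel

theorem sum_fin_one {F : (Fin 1 → ZMod 2) → E} : ∑ s, F s = F ![0] + F ![1] := by
  have : (Finset.univ : Finset (Fin 1 → ZMod 2)) = {![0], ![1]} := by decide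
  rw [this, Finset.sum_pair (by decide)]

theorem sum_fin_two {F : (Fin 2 → ZMod 2) → E} :
    ∑ s, F s = F ![0, 0] + F ![0, 1] + (F ![1, 0] + F ![1, 1]) := by
  have : (Finset.univ : Finset (Fin 2 → ZMod 2)) = {![0, 0], ![0, 1], ![1, 0], ![1, 1]} := by decide
  rw [this, Finset.sum_insert (by decide), Finset.sum_insert (by decide),
    Finset.sum_pair (by decide)]
  abel

theorem insertion_lowForm_zero (X : Fin 0 → E) :
    insertion 𝒜 (lowForm C f B) (lowForm C' f' B') 0 X = f' C := by
  have h : (Finset.univ.filter (IsShuffle 0 (n := 0))) = {1} := by decide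
  unfold insertion
  rw [Fin.sum_univ_one]
  refine (Finset.sum_congr h fun _ _ => rfl).trans ?_
  rw [Finset.sum_singleton, Fintype.sum_unique, koszulSign_one, one_smul]
  rfl

theorem insertion_lowForm_one (X : Fin 1 → E) :
    insertion 𝒜 (lowForm C f B) (lowForm C' f' B') 1 X = B' C (X 0) + f' (f (X 0)) := by
  have h0 : (Finset.univ.filter (IsShuffle 0 (n := 1))) = {1} := by decide
  have h1 : (Finset.univ.filter (IsShuffle 1 (n := 1))) = {1} := by decide
  unfold insertion
  rw [Fin.sum_univ_two]
  refine congrArg₂ (· + ·) ((Finset.sum_congr h0 fun _ _ => rfl).trans ?_)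
    ((Finset.sum_congr h1 fun _ _ => rfl).trans ?_)
  · rw [Finset.sum_singleton, sum_fin_one]
    simp only [koszulSign_one, one_smul]
    change B' C (parityPart 𝒜 0 (X 0)) + B' C (parityPart 𝒜 1 (X 0)) = _
    rw [← map_add, parityPart_zero_add_one]
  · rw [Finset.sum_singleton, sum_fin_one]
    simp only [koszulSign_one, one_smul]
    change f' (f (parityPart 𝒜 0 (X 0))) + f' (f (parityPart 𝒜 1 (X 0))) = _
    rw [← map_add, ← map_add, parityPart_zero_add_one]

/-- Only the transposed shuffle carries a sign depending on parities, so its sum over `s` stays;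
elsewhere even and odd parts add up to the argument. The case `k = 0` would need a ternary component
of the outer form. -/
theorem insertion_lowForm_two (X : Fin 2 → E) :
    insertion 𝒜 (lowForm C f B) (lowForm C' f' B') 2 X = B' (f (X 0)) (X 1) +
      ∑ s : Fin 2 → ZMod 2, paritySign (s 1) (s 0) •
        B' (f (parityPart 𝒜 (s 1) (X 1))) (parityPart 𝒜 (s 0) (X 0)) + f' (B (X 0) (X 1)) := by
  have h1 : (Finset.univ.filter (IsShuffle 1 (n := 2))) = {1, Equiv.swap 0 1} := by decide
  have h2 : (Finset.univ.filter (IsShuffle 2 (n := 2))) = {1} := by decide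
  unfold insertion
  rw [Fin.sum_univ_three]
  refine congrArg₂ (· + ·) ((congrArg₂ (· + ·)
    (Finset.sum_eq_zero fun σ _ => Finset.sum_eq_zero fun s _ => smul_zero _)
    ((Finset.sum_congr h1 fun _ _ => rfl).trans (Finset.sum_pair (by decide)))).trans
      ((zero_add _).trans (congrArg₂ (· + ·) ?_ ?_)))
    ((Finset.sum_congr h2 fun _ _ => rfl).trans ?_)
  · simp only [koszulSign_one, one_smul]
    rw [sum_fin_two]
    change B' (f (parityPart 𝒜 0 (X 0))) (parityPart 𝒜 0 (X 1)) +
      B' (f (parityPart 𝒜 0 (X 0))) (parityPart 𝒜 1 (X 1)) +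
      (B' (f (parityPart 𝒜 1 (X 0))) (parityPart 𝒜 0 (X 1)) +
      B' (f (parityPart 𝒜 1 (X 0))) (parityPart 𝒜 1 (X 1))) = _
    simp only [← map_add, parityPart_zero_add_one, ← LinearMap.add_apply]
  · simp only [koszulSign_swap]
    rfl
  · rw [Finset.sum_singleton, sum_fin_two]
    simp only [koszulSign_one, one_smul]
    change f' (B (parityPart 𝒜 0 (X 0)) (parityPart 𝒜 0 (X 1))) +
      f' (B (parityPart 𝒜 0 (X 0)) (parityPart 𝒜 1 (X 1))) +
      (f' (B (parityPart 𝒜 1 (X 0)) (parityPart 𝒜 0 (X 1))) +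
      f' (B (parityPart 𝒜 1 (X 0)) (parityPart 𝒜 1 (X 1)))) = _
    simp only [← map_add, parityPart_zero_add_one, ← LinearMap.add_apply]

/-- Only `k = 2` survives: smaller `k` needs an outer component of arity at least three, and `k = 3`
an inner one. The three `(2, 1)`-shuffles give the three terms of a Jacobi identity. -/
theorem insertion_lowForm_three (X : Fin 3 → E) :
    insertion 𝒜 (lowForm C f B) (lowForm C' f' B') 3 X = ∑ s : Fin 3 → ZMod 2,
      (B' (B (parityPart 𝒜 (s 0) (X 0)) (parityPart 𝒜 (s 1) (X 1))) (parityPart 𝒜 (s 2) (X 2)) +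
      (paritySign (s 2) (s 1) •
        B' (B (parityPart 𝒜 (s 0) (X 0)) (parityPart 𝒜 (s 2) (X 2))) (parityPart 𝒜 (s 1) (X 1)) +
      (paritySign (s 1) (s 0) * paritySign (s 2) (s 0)) •
        B' (B (parityPart 𝒜 (s 1) (X 1)) (parityPart 𝒜 (s 2) (X 2)))
          (parityPart 𝒜 (s 0) (X 0)))) := by
  have h2 : (Finset.univ.filter (IsShuffle 2 (n := 3))) =
    {1, Equiv.swap 1 2, finRotate 3} := by decide
  have e3 : ∀ σ : Equiv.Perm (Fin 3), ∀ s : Fin 3 → ZMod 2, ∀ x : Fin 0 → E,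
      koszulSign s σ • lowForm C' f' B' 1 (Fin.cons 0 x) = 0 := fun _ _ _ => by
    rw [lowForm_cons_zero, smul_zero]
  unfold insertion
  rw [Fin.sum_univ_four]
  refine (congrArg₂ (· + ·) (congrArg₂ (· + ·) (congrArg₂ (· + ·)
    (Finset.sum_eq_zero fun σ _ => Finset.sum_eq_zero fun s _ => smul_zero _)
    (Finset.sum_eq_zero fun σ _ => Finset.sum_eq_zero fun s _ => smul_zero _))
    ((Finset.sum_congr h2 fun _ _ => rfl).trans ((Finset.sum_insert (by decide)).trans
      (congrArg₂ (· + ·) rfl (Finset.sum_pair (by decide))))))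
    (Finset.sum_eq_zero fun σ _ => Finset.sum_eq_zero fun s _ => e3 σ s _)).trans ?_
  simp only [koszulSign_one, one_smul, koszulSign_swap_last, koszulSign_finRotate]
  rw [add_zero, add_zero, zero_add, ← Finset.sum_add_distrib, ← Finset.sum_add_distrib]
  rfl

theorem insertion_lowForm_of_le {n : ℕ} (hn : 4 ≤ n) (X : Fin n → E) :
    insertion 𝒜 (lowForm C f B) (lowForm C' f' B') n X = 0 := by
  unfold insertion
  refine Finset.sum_eq_zero fun k _ => Finset.sum_eq_zero fun σ _ => Finset.sum_eq_zero fun s _ => ?_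
  by_cases hk : 3 ≤ (k : ℕ)
  · rw [lowForm_eq_zero C f B hk, lowForm_cons_zero, smul_zero]
  · rw [lowForm_eq_zero C' f' B' (by omega), smul_zero]

end LowForms

end Algebroid
end

noncomputable section

namespace Algebroid

/-! ### Koszul signs through the parity involution, and the Richardson–Nijenhuis bracket. -/

section ParityForms

variable {E : Type*} [AddCommGroup E] [Module ℝ E] (𝒜 : ℤ → Submodule ℝ E)
  [DirectSum.Decomposition 𝒜]

/-- The involution `τ` acts by `1` on elements of even degree and by `-1` on elements of odd
degree. -/
def IsParityInvolution (τ : E →ₗ[ℝ] E) : Prop :=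
  ∀ x, parityPart 𝒜 0 x - parityPart 𝒜 1 x = τ x

/-- Graded symmetry of a bilinear map. -/
def IsGradedSymm (B : E →ₗ[ℝ] E →ₗ[ℝ] E) : Prop :=
  ∀ s t x y, B (parityPart 𝒜 s x) (parityPart 𝒜 t y) =
    paritySign s t • B (parityPart 𝒜 t y) (parityPart 𝒜 s x)

theorem paritySign_comm (s t : ZMod 2) : paritySign s t = paritySign t s := by
  unfold paritySign; simp only [and_comm]

theorem paritySign_mul_self (s t : ZMod 2) : paritySign s t * paritySign s t = 1 := by
  unfold paritySign; split_ifs <;> rfl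

variable {𝒜} {τ : E →ₗ[ℝ] E} (hτ : IsParityInvolution 𝒜 τ)

include hτ

/-- Parity projections are affine expressions in `τ`, so a linear map commuting with `τ` preserves
them and one anticommuting with `τ` exchanges them. -/
theorem IsParityInvolution.parityPart_zero_eq (x : E) :
    parityPart 𝒜 0 x = (1 / 2 : ℝ) • (x + τ x) := by
  have h := parityPart_zero_add_one 𝒜 x
  rw [← hτ]
  nth_rw 2 [← h]
  module

theorem IsParityInvolution.parityPart_one_eq (x : E) :
    parityPart 𝒜 1 x = (1 / 2 : ℝ) • (x - τ x) := by
  have h := parityPart_zero_add_one 𝒜 x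
  rw [← hτ]
  nth_rw 2 [← h]
  module

/-- As `f` preserves parity, the sign from the graded symmetry of `B` cancels the Koszul sign. -/
theorem sum_paritySign_of_even {f : E →ₗ[ℝ] E} {B : E →ₗ[ℝ] E →ₗ[ℝ] E}
    (hf : ∀ x, f (τ x) = τ (f x)) (hB : IsGradedSymm 𝒜 B) (x y : E) :
    ∑ s : Fin 2 → ZMod 2, paritySign (s 1) (s 0) •
      B (f (parityPart 𝒜 (s 1) y)) (parityPart 𝒜 (s 0) x) = B x (f y) := by
  have h0 : ∀ x, f (parityPart 𝒜 0 x) = parityPart 𝒜 0 (f x) := fun x => by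
    simp only [hτ.parityPart_zero_eq, map_smul, map_add, hf]
  have h1 : ∀ x, f (parityPart 𝒜 1 x) = parityPart 𝒜 1 (f x) := fun x => by
    simp only [hτ.parityPart_one_eq, map_smul, map_sub, hf]
  rw [sum_fin_two]
  simp only [Matrix.cons_val_zero, Matrix.cons_val_one, h0, h1]
  rw [hB 0 0 (f y) x, hB 0 1 (f y) x, hB 1 0 (f y) x, hB 1 1 (f y) x]
  simp only [paritySign_comm 1 0, smul_smul, paritySign_mul_self, one_smul]
  nth_rw 5 [← parityPart_zero_add_one 𝒜 x]
  nth_rw 5 [← parityPart_zero_add_one 𝒜 (f y)]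
  simp only [map_add, LinearMap.add_apply]
  abel

/-- As `f` changes the parity of `y`, the two signs differ by the parity of `x`, which leaves `τ x`.
-/
theorem sum_paritySign_of_odd {f : E →ₗ[ℝ] E} {B : E →ₗ[ℝ] E →ₗ[ℝ] E}
    (hf : ∀ x, f (τ x) = - τ (f x)) (hB : IsGradedSymm 𝒜 B) (x y : E) :
    ∑ s : Fin 2 → ZMod 2, paritySign (s 1) (s 0) •
      B (f (parityPart 𝒜 (s 1) y)) (parityPart 𝒜 (s 0) x) = B (τ x) (f y) := by
  have h0 : ∀ x, f (parityPart 𝒜 0 x) = parityPart 𝒜 1 (f x) := fun x => by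
    simp only [hτ.parityPart_zero_eq, hτ.parityPart_one_eq, map_smul, map_add, hf, sub_eq_add_neg]
  have h1 : ∀ x, f (parityPart 𝒜 1 x) = parityPart 𝒜 0 (f x) := fun x => by
    simp only [hτ.parityPart_zero_eq, hτ.parityPart_one_eq, map_smul, map_sub, hf, sub_neg_eq_add]
  rw [sum_fin_two]
  simp only [Matrix.cons_val_zero, Matrix.cons_val_one, h0, h1]
  rw [hB 1 0 (f y) x, hB 0 0 (f y) x, hB 1 1 (f y) x, hB 0 1 (f y) x, ← hτ x]
  simp only [smul_smul]
  rw [show paritySign 0 0 * paritySign 1 0 = 1 from rfl,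
    show paritySign 1 0 * paritySign 0 0 = 1 from rfl,
    show paritySign 0 1 * paritySign 1 1 = -1 from rfl,
    show paritySign 1 1 * paritySign 0 1 = -1 from rfl]
  nth_rw 5 [← parityPart_zero_add_one 𝒜 (f y)]
  simp only [map_add, map_sub, LinearMap.sub_apply]
  module

/-- The central computation. The bracket with a form of degree zero is a plain difference of
insertions; the constant `C` can only be inserted into `f'` and `B`, and nothing can be inserted
into it. -/
theorem rn_lowForm {C : E} {f f' : E →ₗ[ℝ] E} {B : E →ₗ[ℝ] E →ₗ[ℝ] E}
    (hf : ∀ x, f (τ x) = τ (f x)) (hB : IsGradedSymm 𝒜 B) :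
    rn 𝒜 0 1 (lowForm C f 0) (lowForm 0 f' B) =
      lowForm (f' C) (B C + f' ∘ₗ f - f ∘ₗ f') (B ∘ₗ f + B.compl₂ f - B.compr₂ f) := by
  funext n X
  change insertion 𝒜 _ _ n X - ((0 * 1 : ℤ).negOnePow : ℤ) • insertion 𝒜 _ _ n X = _
  rw [zero_mul, Int.negOnePow_zero, Units.val_one, one_smul]
  match n, X with
  | 0, X =>
    rw [insertion_lowForm_zero, insertion_lowForm_zero, map_zero, sub_zero]; rfl
  | 1, X =>
    rw [insertion_lowForm_one, insertion_lowForm_one]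
    simp [lowForm]
  | 2, X =>
    rw [insertion_lowForm_two, insertion_lowForm_two, sum_paritySign_of_even hτ hf hB]
    simp [lowForm]
  | 3, X =>
    rw [insertion_lowForm_three, insertion_lowForm_three]
    simp [lowForm]
  | n + 4, X =>
    rw [insertion_lowForm_of_le _ _ _ _ _ _ _ (by omega),
      insertion_lowForm_of_le _ _ _ _ _ _ _ (by omega), sub_zero]
    rfl

/-- The binary bracket satisfies the graded Jacobi identity. -/
def IsGradedJacobi (𝒜 : ℤ → Submodule ℝ E) [DirectSum.Decomposition 𝒜]
    (B : E →ₗ[ℝ] E →ₗ[ℝ] E) : Prop :=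
  ∀ s t u x y z,
    B (B (parityPart 𝒜 s x) (parityPart 𝒜 t y)) (parityPart 𝒜 u z) +
      (paritySign u t • B (B (parityPart 𝒜 s x) (parityPart 𝒜 u z)) (parityPart 𝒜 t y) +
      (paritySign t s * paritySign u s) •
        B (B (parityPart 𝒜 t y) (parityPart 𝒜 u z)) (parityPart 𝒜 s x)) = 0

theorem isDGLA_lowForm {d : E →ₗ[ℝ] E} {B : E →ₗ[ℝ] E →ₗ[ℝ] E}
    (hform : IsSymmetricForm 𝒜 1 (lowForm 0 d B)) (hd : ∀ x, d (τ x) = - τ (d x))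
    (hB : IsGradedSymm 𝒜 B) (hJ : IsGradedJacobi 𝒜 B) (hdd : ∀ x, d (d x) = 0)
    (hdB : ∀ x y, B (d x) y + B (τ x) (d y) + d (B x y) = 0) :
    IsDGLA 𝒜 (lowForm 0 d B) where
  form := hform
  curvature_eq_zero := rfl
  jacobi := by
    funext n X
    match n, X with
    | 0, X => rw [insertion_lowForm_zero, map_zero]; rfl
    | 1, X => rw [insertion_lowForm_one, hdd, map_zero]; exact add_zero _
    | 2, X => rw [insertion_lowForm_two, sum_paritySign_of_odd hτ hd hB, hdB]; rfl
    | 3, X =>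
      rw [insertion_lowForm_three]
      exact Finset.sum_eq_zero fun s _ => hJ _ _ _ _ _ _
    | n + 4, X => rw [insertion_lowForm_of_le _ _ _ _ _ _ _ (by omega)]; rfl
  higher n hn := by
    funext X
    exact lowForm_eq_zero _ _ _ hn X

end ParityForms

end Algebroid
end

noncomputable section

namespace Algebroid

/-! ### Passage to multisections: the quotient by locally zero elements. -/

namespace MultiSection

open Algebroid.PreBracket

variable {R L : Type*} [CommRing R] [AddCommGroup L] [Module R L]
  [Algebra ℝ R] [Module ℝ L] [IsScalarTower ℝ R L] {M : Type*} {ev : M → R →+* ℝ}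

theorem mk_surjective : Function.Surjective (mk (R := R) (L := L) (ev := ev)) :=
  (locallyZero L ev).mkQ_surjective

theorem mk_eq_zero_iff {P : ExteriorAlgebra R L} :
    mk (ev := ev) P = 0 ↔ ∀ x, ∃ f : R, ev x f ≠ 0 ∧ f • P = 0 :=
  Submodule.Quotient.mk_eq_zero _

theorem signInvolution_mk (P : ExteriorAlgebra R L) :
    signInvolution (mk (ev := ev) P) = mk (gradeInv P) := rfl

theorem underline_mk (N : L →ₗ[R] L) (P : ExteriorAlgebra R L) :
    underline N (mk (ev := ev) P) = mk (derivExt N P) := rfl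

theorem schouten_mk (𝔞 : PreBracket R L) (P Q : ExteriorAlgebra R L) :
    𝔞.schouten (mk (ev := ev) P) (mk Q) = mk (𝔞.schoutenAux P Q) := rfl

theorem signInvolution_signInvolution (P : MultiSection L ev) :
    signInvolution (signInvolution P) = P := by
  obtain ⟨P, rfl⟩ := mk_surjective P
  rw [signInvolution_mk, signInvolution_mk, gradeInv_gradeInv]

theorem underline_signInvolution (N : L →ₗ[R] L) (P : MultiSection L ev) :
    underline N (signInvolution P) = signInvolution (underline N P) := by
  obtain ⟨P, rfl⟩ := mk_surjective P
  rw [signInvolution_mk, underline_mk, underline_mk, signInvolution_mk, gradeInv_derivExt]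

theorem mem_shiftedGrading_iff {i : ℤ} {P : MultiSection L ev} :
    P ∈ shiftedGrading (L := L) (ev := ev) i ↔ ∃ Z ∈ intPart R L (i + 2), mk Z = P := by
  unfold shiftedGrading intPart
  split_ifs
  · rfl
  · constructor
    · intro h
      exact ⟨0, zero_mem _, by rw [(Submodule.mem_bot ℝ).1 h, map_zero]⟩
    · rintro ⟨Z, hZ, rfl⟩
      rw [(Submodule.mem_bot R).1 hZ, map_zero]
      exact zero_mem _

theorem signInvolution_of_mem {i : ℤ} {P : MultiSection L ev}
    (hP : P ∈ shiftedGrading (L := L) (ev := ev) i) :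
    signInvolution P = if (i : ZMod 2) = 0 then P else - P := by
  obtain ⟨Z, hZ, rfl⟩ := mem_shiftedGrading_iff.1 hP
  unfold intPart at hZ
  split_ifs at hZ with h
  · obtain ⟨n, hn⟩ := Int.eq_ofNat_of_zero_le h
    rw [hn, Int.toNat_natCast] at hZ
    -- The shift by two does not change parity, so the sign is that of the exterior degree.
    have hi : (i : ZMod 2) = (n : ZMod 2) := by
      have : i = (n : ℤ) - 2 := by omega
      rw [this]
      push_cast
      rw [show (2 : ZMod 2) = 0 from rfl, sub_zero]
    rw [hi, signInvolution_mk, gradeInv_of_mem hZ]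
    rcases Nat.even_or_odd n with hn | hn
    · rw [hn.neg_one_pow, one_smul, if_pos ((ZMod.natCast_eq_zero_iff_even).2 hn)]
    · rw [hn.neg_one_pow, neg_smul, one_smul, map_neg, if_neg]
      rw [ZMod.natCast_eq_zero_iff_even]
      exact Nat.not_even_iff_odd.2 hn
  · rw [(Submodule.mem_bot R).1 hZ]
    simp

theorem isParityInvolution_signInvolution :
    IsParityInvolution (shiftedGrading (L := L) (ev := ev)) signInvolution := by
  intro P
  induction P using DirectSum.Decomposition.inductionOn (shiftedGrading (L := L) (ev := ev)) with
  | zero => rw [parityPart_zero, parityPart_zero, map_zero, sub_zero]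
  | @homogeneous i P =>
    rw [parityPart_of_mem _ _ P.2, parityPart_of_mem _ _ P.2, signInvolution_of_mem P.2]
    have : ∀ a : ZMod 2, a = 0 ∨ a = 1 := by decide
    rcases this (i : ZMod 2) with h | h <;> simp [h]
  | add P Q hP hQ =>
    rw [parityPart_add, parityPart_add, map_add, ← hP, ← hQ]
    abel

theorem signInvolution_parityPart_zero (P : MultiSection L ev) :
    signInvolution (parityPart (shiftedGrading (L := L) (ev := ev)) 0 P) =
      parityPart (shiftedGrading (L := L) (ev := ev)) 0 P := by
  rw [isParityInvolution_signInvolution.parityPart_zero_eq, map_smul, map_add,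
    signInvolution_signInvolution, add_comm]

theorem signInvolution_parityPart_one (P : MultiSection L ev) :
    signInvolution (parityPart (shiftedGrading (L := L) (ev := ev)) 1 P) =
      - parityPart (shiftedGrading (L := L) (ev := ev)) 1 P := by
  rw [isParityInvolution_signInvolution.parityPart_one_eq, map_smul, map_sub,
    signInvolution_signInvolution, ← smul_neg, neg_sub]

/-- An even class need not have an even representative chosen; averaging over the involution gives
one, to which the sign lemmas of the exterior algebra apply. -/
theorem exists_even_rep {P : MultiSection L ev} (hP : signInvolution P = P) :
    ∃ Z, gradeInv Z = Z ∧ mk Z = P := by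
  obtain ⟨Z, rfl⟩ := mk_surjective P
  rw [signInvolution_mk] at hP
  refine ⟨algebraMap ℝ R (1 / 2) • (Z + gradeInv Z), ?_, ?_⟩
  · rw [map_smul, map_add, gradeInv_gradeInv, add_comm]
  · rw [algebraMap_smul, map_smul, map_add, hP]
    module

theorem exists_odd_rep {P : MultiSection L ev} (hP : signInvolution P = - P) :
    ∃ Z, gradeInv Z = - Z ∧ mk Z = P := by
  obtain ⟨Z, rfl⟩ := mk_surjective P
  rw [signInvolution_mk] at hP
  refine ⟨algebraMap ℝ R (1 / 2) • (Z - gradeInv Z), ?_, ?_⟩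
  · rw [map_smul, map_sub, gradeInv_gradeInv, ← smul_neg, neg_sub]
  · rw [algebraMap_smul, map_smul, map_sub, hP]
    module

variable (𝔞 : PreBracket R L)

theorem signInvolution_schouten (P Q : MultiSection L ev) :
    signInvolution (𝔞.schouten P Q) = - 𝔞.schouten (signInvolution P) (signInvolution Q) := by
  obtain ⟨P, rfl⟩ := mk_surjective P
  obtain ⟨Q, rfl⟩ := mk_surjective Q
  rw [schouten_mk, signInvolution_mk, gradeInv_schoutenAux, map_neg]
  rfl

theorem schouten_swap_of_odd {Q : MultiSection L ev} (hQ : signInvolution Q = - Q)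
    (P : MultiSection L ev) : 𝔞.schouten P Q = - 𝔞.schouten Q P := by
  obtain ⟨P, rfl⟩ := mk_surjective P
  obtain ⟨Q, hQ', rfl⟩ := exists_odd_rep hQ
  rw [schouten_mk, schouten_mk, 𝔞.schoutenAux_swap_of_odd hQ', map_neg]

theorem schouten_swap_of_even {Q : MultiSection L ev} (hQ : signInvolution Q = Q)
    (P : MultiSection L ev) : 𝔞.schouten P Q = 𝔞.schouten Q (signInvolution P) := by
  obtain ⟨P, rfl⟩ := mk_surjective P
  obtain ⟨Q, hQ', rfl⟩ := exists_even_rep hQ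
  rw [signInvolution_mk, schouten_mk, schouten_mk, 𝔞.schoutenAux_swap_of_even hQ']

theorem schouten_mem {i j : ℤ} {P Q : MultiSection L ev}
    (hP : P ∈ shiftedGrading (L := L) (ev := ev) i)
    (hQ : Q ∈ shiftedGrading (L := L) (ev := ev) j) :
    𝔞.schouten P Q ∈ shiftedGrading (L := L) (ev := ev) (i + j + 1) := by
  obtain ⟨Z, hZ, rfl⟩ := mem_shiftedGrading_iff.1 hP
  obtain ⟨W, hW, rfl⟩ := mem_shiftedGrading_iff.1 hQ
  refine mem_shiftedGrading_iff.2 ⟨𝔞.schoutenAux Z W, ?_, rfl⟩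
  unfold intPart at hZ hW
  split_ifs at hZ hW with h1 h2
  · have h := schoutenAux_mem 𝔞 hZ hW
    rwa [Int.toNat_of_nonneg h1, Int.toNat_of_nonneg h2,
      show i + 2 + (j + 2) - 1 = i + j + 1 + 2 by ring] at h
  · rw [(Submodule.mem_bot R).1 hW, schoutenAux_zero_right]; exact zero_mem _
  · rw [(Submodule.mem_bot R).1 hZ, schoutenAux_zero_left]; exact zero_mem _
  · rw [(Submodule.mem_bot R).1 hZ, schoutenAux_zero_left]; exact zero_mem _

theorem underline_mem (N : L →ₗ[R] L) {i : ℤ} {P : MultiSection L ev}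
    (hP : P ∈ shiftedGrading (L := L) (ev := ev) i) :
    underline N P ∈ shiftedGrading (L := L) (ev := ev) i := by
  obtain ⟨Z, hZ, rfl⟩ := mem_shiftedGrading_iff.1 hP
  refine mem_shiftedGrading_iff.2 ⟨derivExt N Z, ?_, rfl⟩
  unfold intPart at hZ ⊢
  split_ifs at hZ ⊢
  · exact derivExt_mem N hZ
  · rw [(Submodule.mem_bot R).1 hZ, derivExt_zero]; exact zero_mem _

theorem signInvolution_mem {i : ℤ} {P : MultiSection L ev}
    (hP : P ∈ shiftedGrading (L := L) (ev := ev) i) :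
    signInvolution P ∈ shiftedGrading (L := L) (ev := ev) i := by
  rw [signInvolution_of_mem hP]
  split_ifs
  · exact hP
  · exact neg_mem hP

/-! ### The symmetric bracket -/

/-- The bracket `(P, Q) ↦ (-1) ^ (p - 1) [P, Q]`. -/
def symBracket : MultiSection L ev →ₗ[ℝ] MultiSection L ev →ₗ[ℝ] MultiSection L ev :=
  - (𝔞.schouten ∘ₗ signInvolution)

theorem symBracket_apply (P Q : MultiSection L ev) :
    symBracket 𝔞 P Q = - 𝔞.schouten (signInvolution P) Q := rfl

theorem parityPart_cases (s : ZMod 2) (P : MultiSection L ev) :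
    (s = 0 ∧ signInvolution (parityPart (shiftedGrading (L := L) (ev := ev)) s P) =
      parityPart (shiftedGrading (L := L) (ev := ev)) s P) ∨
    (s = 1 ∧ signInvolution (parityPart (shiftedGrading (L := L) (ev := ev)) s P) =
      - parityPart (shiftedGrading (L := L) (ev := ev)) s P) := by
  have : ∀ a : ZMod 2, a = 0 ∨ a = 1 := by decide
  rcases this s with rfl | rfl
  · exact Or.inl ⟨rfl, signInvolution_parityPart_zero P⟩
  · exact Or.inr ⟨rfl, signInvolution_parityPart_one P⟩

/-- The Schouten bracket is graded antisymmetric for the degrees `p - 1`; the factor `(-1)^(p-1)`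
turns this into graded symmetry for `p`, equivalently for the shifted degree `p - 2`. -/
theorem isGradedSymm_symBracket :
    IsGradedSymm (shiftedGrading (L := L) (ev := ev)) (symBracket 𝔞) := by
  intro s t P Q
  have e1 := parityPart_cases s P
  have e2 := parityPart_cases t Q
  generalize parityPart (shiftedGrading (L := L) (ev := ev)) s P = P at *
  generalize parityPart (shiftedGrading (L := L) (ev := ev)) t Q = Q at *
  rw [symBracket_apply, symBracket_apply]
  rcases e1 with ⟨rfl, hP⟩ | ⟨rfl, hP⟩ <;> rcases e2 with ⟨rfl, hQ⟩ | ⟨rfl, hQ⟩ <;> rw [hP, hQ]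
  · rw [schouten_swap_of_even 𝔞 hQ, hP]; simp [paritySign]
  · rw [schouten_swap_of_odd 𝔞 hQ]; simp [paritySign]
  · rw [map_neg, LinearMap.neg_apply, schouten_swap_of_even 𝔞 hQ, hP]; simp [paritySign]
  · rw [map_neg, LinearMap.neg_apply, schouten_swap_of_odd 𝔞 hQ]; simp [paritySign]

theorem isSymmetricForm_symBracket {d : MultiSection L ev →ₗ[ℝ] MultiSection L ev}
    (hd : ∀ i, ∀ P ∈ shiftedGrading (L := L) (ev := ev) i,
      d P ∈ shiftedGrading (L := L) (ev := ev) (i + 1)) :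
    IsSymmetricForm (shiftedGrading (L := L) (ev := ev)) 1 (lowForm 0 d (symBracket 𝔞)) := by
  refine isSymmetricForm_lowForm _ _ _ _ (zero_mem _) hd ?_ ?_
  · intro i j P hP Q hQ
    rw [symBracket_apply]
    exact neg_mem (schouten_mem 𝔞 (signInvolution_mem hP) hQ)
  · intro i j P hP Q hQ
    have h := isGradedSymm_symBracket 𝔞 (i : ZMod 2) (j : ZMod 2) P Q
    rwa [parityPart_of_mem _ _ hP, parityPart_of_mem _ _ hQ, if_pos rfl, if_pos rfl] at h

section Jacobi

variable {𝔞} (h : 𝔞.IsLieRinehart)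

include h

theorem schouten_jacobi_of_odd {Q : MultiSection L ev} (hQ : signInvolution Q = - Q)
    (P S : MultiSection L ev) :
    𝔞.schouten P (𝔞.schouten Q S) =
      𝔞.schouten (𝔞.schouten P Q) S + 𝔞.schouten Q (𝔞.schouten P S) := by
  obtain ⟨P, rfl⟩ := mk_surjective P
  obtain ⟨S, rfl⟩ := mk_surjective S
  obtain ⟨Q, hQ', rfl⟩ := exists_odd_rep hQ
  simp only [schouten_mk, h.schoutenAux_jacobi_of_odd hQ', map_add]

theorem schouten_jacobi_of_even {Q : MultiSection L ev} (hQ : signInvolution Q = Q)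
    (P S : MultiSection L ev) :
    𝔞.schouten P (𝔞.schouten Q S) =
      𝔞.schouten (𝔞.schouten P Q) S - 𝔞.schouten Q (𝔞.schouten (signInvolution P) S) := by
  obtain ⟨P, rfl⟩ := mk_surjective P
  obtain ⟨S, rfl⟩ := mk_surjective S
  obtain ⟨Q, hQ', rfl⟩ := exists_even_rep hQ
  simp only [schouten_mk, signInvolution_mk, h.schoutenAux_jacobi_of_even hQ', map_sub]

theorem isGradedJacobi_symBracket :
    IsGradedJacobi (shiftedGrading (L := L) (ev := ev)) (symBracket 𝔞) := by
  intro s t u x y z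
  have e1 := parityPart_cases s x
  have e2 := parityPart_cases t y
  have e3 := parityPart_cases u z
  generalize parityPart (shiftedGrading (L := L) (ev := ev)) s x = x at *
  generalize parityPart (shiftedGrading (L := L) (ev := ev)) t y = y at *
  generalize parityPart (shiftedGrading (L := L) (ev := ev)) u z = z at *
  have yz := signInvolution_schouten 𝔞 y z
  have xz := signInvolution_schouten 𝔞 x z
  simp only [symBracket_apply, map_neg, signInvolution_schouten, signInvolution_signInvolution,
    LinearMap.neg_apply, neg_neg, smul_neg]
  have even := schouten_jacobi_of_even h (Q := y) (P := x) (S := z)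
  have odd := schouten_jacobi_of_odd h (Q := y) (P := x) (S := z)
  have yz_even := schouten_swap_of_even 𝔞 (Q := 𝔞.schouten y z) (P := x)
  have yz_odd := schouten_swap_of_odd 𝔞 (Q := 𝔞.schouten y z) (P := x)
  have xz_even := schouten_swap_of_even 𝔞 (Q := 𝔞.schouten x z) (P := y)
  have xz_odd := schouten_swap_of_odd 𝔞 (Q := 𝔞.schouten x z) (P := y)
  rcases e1 with ⟨rfl, hx⟩ | ⟨rfl, hx⟩ <;> rcases e2 with ⟨rfl, hy⟩ | ⟨rfl, hy⟩ <;>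
    rcases e3 with ⟨rfl, hz⟩ | ⟨rfl, hz⟩
  -- In each of the eight parity cases `[y, z]` and `[x, z]` have known parity, so the right-nested
  -- brackets in `J` can be swapped into the left-nested form of the goal, which is then `J` up to
  -- sign.
  all_goals
    rw [hy, hz] at yz
    rw [hx, hz] at xz
    try simp only [map_neg, LinearMap.neg_apply, neg_neg] at yz
    try simp only [map_neg, LinearMap.neg_apply, neg_neg] at xz
    first | have J := even hy | have J := odd hy
    first | have K := yz_even yz | have K := yz_odd yz
    first | have K' := xz_even xz | have K' := xz_odd xz
    simp only [hx, hy, hz, map_neg, LinearMap.neg_apply, K, K'] at J ⊢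
    simp [paritySign]
    first
    | linear_combination (norm := module) J
    | linear_combination (norm := module) - J

end Jacobi

end MultiSection

end Algebroid
end

noncomputable section

namespace Algebroid

open Algebroid.PreBracket Algebroid.MultiSection

variable {R L : Type*} [CommRing R] [AddCommGroup L] [Module R L]
  [Algebra ℝ R] [Module ℝ L] [IsScalarTower ℝ R L] {M : Type*} {ev : M → R →+* ℝ}

/-- Over a module on which only zero acts by zero, the Jacobi identity implies that the anchor is
compatible with brackets. -/
theorem PreBracket.isLieRinehart_of_jacobi (𝔞 : PreBracket R L)
    (hL : ∀ g : R, (∀ Z : L, g • Z = 0) → g = 0 ∨ Subsingleton L)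
    (hJ : ∀ X Y Z, 𝔞.bracket X (𝔞.bracket Y Z) + 𝔞.bracket Y (𝔞.bracket Z X) +
      𝔞.bracket Z (𝔞.bracket X Y) = 0) : 𝔞.IsLieRinehart := by
  have jac : ∀ X Y Z, 𝔞.bracket X (𝔞.bracket Y Z) =
      𝔞.bracket (𝔞.bracket X Y) Z + 𝔞.bracket Y (𝔞.bracket X Z) := by
    intro X Y Z
    have h := hJ X Y Z
    rw [𝔞.bracket_swap Z X, 𝔞.bracket_swap Z, map_neg] at h
    linear_combination (norm := module) h
  refine ⟨jac, fun X Y f => ?_⟩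
  -- Expanding the Jacobi identity of `X`, `Y`, `f • Z` by the Leibniz rule, everything cancels
  -- except this multiple of `Z`.
  have key : ∀ Z : L, (𝔞.anchor (𝔞.bracket X Y) f -
      (𝔞.anchor X (𝔞.anchor Y f) - 𝔞.anchor Y (𝔞.anchor X f))) • Z = 0 := by
    intro Z
    have h := jac X Y (f • Z)
    simp only [𝔞.leibniz, map_add] at h
    rw [jac X Y Z, smul_add] at h
    rw [sub_smul, sub_smul]
    linear_combination (norm := abel) -h
  rcases hL _ key with h | h
  · exact sub_eq_zero.1 h
  · rw [Subsingleton.elim X 0]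
    simp

/-! ### The co-boundary condition: Poisson, concomitant and torsion parts. -/

namespace MultiSection

section Deformation

variable {𝔞 𝔟 : PreBracket R L} {N : L →ₗ[R] L} (h : IsDeformation 𝔞 𝔟 N)

include h

theorem schouten_deformation (P Q : MultiSection L ev) :
    𝔟.schouten P Q = 𝔞.schouten (underline N P) Q + 𝔞.schouten P (underline N Q) -
      underline N (𝔞.schouten P Q) := by
  obtain ⟨P, rfl⟩ := mk_surjective P
  obtain ⟨Q, rfl⟩ := mk_surjective Q
  simp only [schouten_mk, underline_mk, h.schoutenAux, map_add, map_sub]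

theorem symBracket_deformation :
    symBracket 𝔟 (ev := ev) = symBracket 𝔞 ∘ₗ underline N +
      (symBracket 𝔞).compl₂ (underline N) - (symBracket 𝔞).compr₂ (underline N) := by
  refine LinearMap.ext fun P => LinearMap.ext fun Q => ?_
  simp only [symBracket_apply, schouten_deformation h, LinearMap.sub_apply, LinearMap.add_apply,
    LinearMap.comp_apply, LinearMap.compl₂_apply, LinearMap.compr₂_apply,
    underline_signInvolution, map_neg]
  abel

theorem rn_lowForm_symBracket (π : MultiSection L ev)
    (d : MultiSection L ev →ₗ[ℝ] MultiSection L ev) :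
    rn (shiftedGrading (L := L) (ev := ev)) 0 1 (lowForm π (underline N) 0)
        (lowForm 0 d (symBracket 𝔞)) =
      lowForm (d π) (symBracket 𝔞 π + d ∘ₗ underline N - underline N ∘ₗ d) (symBracket 𝔟) := by
  rw [rn_lowForm isParityInvolution_signInvolution (underline_signInvolution N)
    (isGradedSymm_symBracket 𝔞), symBracket_deformation h]

end Deformation

theorem lowForm_inj {E : Type*} [AddCommGroup E] [Module ℝ E] {C C' : E} {f f' : E →ₗ[ℝ] E}
    {B B' : E →ₗ[ℝ] E →ₗ[ℝ] E} :
    lowForm C f B = lowForm C' f' B' ↔ C = C' ∧ f = f' ∧ B = B' := by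
  refine ⟨fun h => ⟨congrFun (congrFun h 0) Fin.elim0, ?_, ?_⟩, fun ⟨h1, h2, h3⟩ => by rw [h1, h2, h3]⟩
  · ext1 x
    exact congrFun (congrFun h 1) ![x]
  · ext1 x
    ext1 y
    exact congrFun (congrFun h 2) ![x, y]

theorem symBracket_of_even (𝔞 : PreBracket R L) {π : MultiSection L ev}
    (hπ : signInvolution π = π) : symBracket 𝔞 π = - 𝔞.schouten π := by
  refine LinearMap.ext fun P => ?_
  rw [symBracket_apply, hπ]; rfl

/-- The co-boundary condition, component by component. -/
theorem coboundary_iff {𝔞 𝔟 𝔠 𝔡 : PreBracket R L} {N : L →ₗ[R] L} (hb : IsDeformation 𝔞 𝔟 N)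
    (hc : IsDeformation 𝔟 𝔠 N) (hd : IsDeformation 𝔞 𝔡 (N ∘ₗ N)) {π : MultiSection L ev}
    (hπ : signInvolution π = π) :
    rn (shiftedGrading (L := L) (ev := ev)) 0 1 (lowForm π (underline N) 0)
        (rn (shiftedGrading (L := L) (ev := ev)) 0 1 (lowForm π (underline N) 0)
          (lowForm 0 0 (symBracket 𝔞))) =
      rn (shiftedGrading (L := L) (ev := ev)) 0 1 (lowForm 0 (underline (N ∘ₗ N)) 0)
        (lowForm 0 0 (symBracket 𝔞)) ↔
    𝔞.schouten π π = 0 ∧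
      (∀ P, underline N (𝔞.schouten π P) - 𝔞.schouten π (underline N P) - 𝔟.schouten π P = 0) ∧
      symBracket 𝔠 (ev := ev) = symBracket 𝔡 := by
  rw [rn_lowForm_symBracket hb, rn_lowForm_symBracket hd, LinearMap.zero_comp, LinearMap.comp_zero,
    LinearMap.zero_comp, LinearMap.comp_zero, LinearMap.zero_apply, add_zero, sub_zero,
    rn_lowForm_symBracket hc, lowForm_inj, symBracket_of_even 𝔞 hπ, symBracket_of_even 𝔟 hπ,
    LinearMap.neg_apply, LinearMap.zero_apply, neg_eq_zero, map_zero, add_zero, sub_zero]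
  refine and_congr Iff.rfl (and_congr ?_ Iff.rfl)
  rw [LinearMap.ext_iff]
  refine forall_congr' fun P => ?_
  rw [show (-𝔟.schouten π + (-𝔞.schouten π) ∘ₗ underline N - underline N ∘ₗ (-𝔞.schouten π)) P =
    underline N (𝔞.schouten π P) - 𝔞.schouten π (underline N P) - 𝔟.schouten π P by
      simp only [LinearMap.sub_apply, LinearMap.add_apply, LinearMap.comp_apply,
        LinearMap.neg_apply, map_neg]
      abel]
  rfl

/-- Deforming twice by `N` and once by `N²` yields the same anchor `ρN²` and brackets of sections
differing by twice the torsion. The assumption `hL` lets sections be compared inside the quotient.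
-/
theorem symBracket_eq_iff {𝔞 𝔟 𝔠 𝔡 : PreBracket R L} {N : L →ₗ[R] L} (hb : IsDeformation 𝔞 𝔟 N)
    (hc : IsDeformation 𝔟 𝔠 N) (hd : IsDeformation 𝔞 𝔡 (N ∘ₗ N))
    (hL : ∀ Z : L, mk (ev := ev) (ExteriorAlgebra.ι R Z) = 0 → Z = 0) :
    symBracket 𝔠 (ev := ev) = symBracket 𝔡 ↔
      ∀ X Y, 𝔞.bracket (N X) (N Y) - N (𝔟.bracket X Y) = 0 := by
  have key : ∀ X Y, 𝔠.bracket X Y - 𝔡.bracket X Y =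
      (2 : ℝ) • (𝔞.bracket (N X) (N Y) - N (𝔟.bracket X Y)) := by
    intro X Y
    rw [hc.bracket, hb.bracket, hb.bracket, hd.bracket, hb.bracket]
    simp only [LinearMap.comp_apply, map_add, map_sub, two_smul]
    abel
  constructor
  · intro e X Y
    have e1 := congrArg (fun B => B (mk (ExteriorAlgebra.ι R X)) (mk (ExteriorAlgebra.ι R Y))) e
    simp only [symBracket_apply, signInvolution_mk, gradeInv_ι, map_neg, LinearMap.neg_apply,
      neg_neg, schouten_mk, schoutenAux_ι_left, lie_ι] at e1
    rw [← sub_eq_zero, ← map_sub, ← map_sub] at e1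
    have e2 := hL _ e1
    rw [key] at e2
    exact (smul_eq_zero.1 e2).resolve_left two_ne_zero
  · intro e
    have e1 : 𝔠 = 𝔡 := by
      have hbr : 𝔠.bracket = 𝔡.bracket := by
        ext1 X
        ext1 Y
        rw [← sub_eq_zero, key, e, smul_zero]
      have han : 𝔠.anchor = 𝔡.anchor := by
        ext1 X
        rw [hc.anchor, hb.anchor, hd.anchor]; rfl
      cases 𝔠
      cases 𝔡
      cases hbr
      cases han
      rfl
    rw [e1]

theorem concomitant_iff {𝔞 𝔟 : PreBracket R L} {N : L →ₗ[R] L} (hb : IsDeformation 𝔞 𝔟 N)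
    {W : ExteriorAlgebra R L} (hW : W ∈ ⋀[R]^2 L)
    (hN : ∀ α : Module.Dual R L, N (sharpExt W α) = sharpExt W (α ∘ₗ N))
    (hL : ∀ Z : R, (∀ x, ∃ f : R, ev x f ≠ 0 ∧ f * Z = 0) → Z = 0)
    (hbasis : ∀ x, ∃ (n : ℕ) (e : Fin n → L) (ε : Fin n → Module.Dual R L) (f : R),
      ev x f ≠ 0 ∧ ∀ X, f • X = ∑ i, ε i X • e i) :
    (∀ P : MultiSection L ev, underline N (𝔞.schouten (mk W) P) -
      𝔞.schouten (mk W) (underline N P) - 𝔟.schouten (mk W) P = 0) ↔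
    ∀ α β, 𝔞.dualBracket (sharpExt W) (α ∘ₗ N) β + 𝔞.dualBracket (sharpExt W) α (β ∘ₗ N) -
      𝔞.dualBracket (sharpExt W) α β ∘ₗ N = 𝔟.dualBracket (sharpExt W) α β := by
  have key : ∀ P : ExteriorAlgebra R L, underline N (𝔞.schouten (mk (ev := ev) W) (mk P)) -
      𝔞.schouten (mk W) (underline N (mk P)) - 𝔟.schouten (mk W) (mk P) =
      mk (concomitantMap 𝔞 𝔟 N W P) := by
    intro P
    simp only [concomitantMap, map_sub]
    rfl
  constructor
  · intro h α β
    ext X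
    rw [← sub_eq_zero]
    refine hL _ fun x => ?_
    have h0 := h (mk (ExteriorAlgebra.ι R X))
    rw [key] at h0
    obtain ⟨f, hf, hfP⟩ := mk_eq_zero_iff.1 h0 x
    refine ⟨f, hf, ?_⟩
    have e := contract_contract_concomitantMap hW hb hN X α β
    have e' := congrArg (fun a => f • a) e
    simp only [← map_smul, hfP] at e'
    rw [map_zero, map_zero, smul_neg, zero_eq_neg, Algebra.smul_def, ← map_mul,
      ExteriorAlgebra.algebraMap_eq_zero_iff] at e'
    exact e'
  · intro h P
    obtain ⟨P, rfl⟩ := mk_surjective P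
    rw [key, mk_eq_zero_iff]
    intro x
    obtain ⟨n, e, ε, f, hf, hfe⟩ := hbasis x
    -- The witness depends on the frame alone and not on `P`, so it stays fixed through the
    -- induction; the square is the one in `smul_eq_zero_of_contract_contract`.
    refine ⟨f * f, by rw [map_mul]; exact mul_ne_zero hf hf, ?_⟩
    induction P using exterior_induction with
    | algebraMap r => rw [concomitantMap_algebraMap hW hb hN, smul_zero]
    | add P Q hP hQ =>
      have : concomitantMap 𝔞 𝔟 N W (P + Q) =
          concomitantMap 𝔞 𝔟 N W P + concomitantMap 𝔞 𝔟 N W Q := by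
        simp only [concomitantMap, schoutenAux_add_right, derivExt_add]
        abel
      rw [this, smul_add, hP, hQ, add_zero]
    | ι_mul X P hP =>
      have hX : (f * f) • concomitantMap 𝔞 𝔟 N W (ExteriorAlgebra.ι R X) = 0 := by
        refine smul_eq_zero_of_contract_contract e ε f hfe ?_ fun α β => ?_
        · rw [concomitantMap, derivExt_ι, schoutenAux_ι_right, schoutenAux_ι_right,
            schoutenAux_ι_right]
          exact sub_mem (sub_mem (derivExt_mem N (neg_mem (lie_mem 𝔞 X hW)))
            (neg_mem (lie_mem 𝔞 _ hW))) (neg_mem (lie_mem 𝔟 X hW))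
        · rw [contract_contract_concomitantMap hW hb hN, h, sub_self, LinearMap.zero_apply, map_zero,
            neg_zero]
      rw [concomitantMap_ι_mul hW, smul_sub, ← smul_mul_assoc, hX, zero_mul, ← mul_smul_comm, hP,
        mul_zero, sub_zero]

/-! ### Differential graded Lie algebras -/

theorem schouten_derivation {𝔞 : PreBracket R L} (h : 𝔞.IsLieRinehart) {π : MultiSection L ev}
    (hπ : signInvolution π = π) (P Q : MultiSection L ev) :
    𝔞.schouten π (𝔞.schouten P Q) =
      𝔞.schouten (𝔞.schouten π P) Q - 𝔞.schouten (signInvolution P) (𝔞.schouten π Q) := by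
  have e := schouten_jacobi_of_even h hπ (signInvolution P) Q
  rw [schouten_swap_of_even 𝔞 hπ (signInvolution P), signInvolution_signInvolution] at e
  rw [e]
  abel

/-- For even `π`, Jacobi gives `[π, [π, P]] = [[π, π], P] - [π, [π, P]]`, so twice the square is
`[[π, π], P]`. -/
theorem schouten_schouten_self {𝔞 : PreBracket R L} (h : 𝔞.IsLieRinehart) {π : MultiSection L ev}
    (hπ : signInvolution π = π) (h0 : 𝔞.schouten π π = 0) (P : MultiSection L ev) :
    𝔞.schouten π (𝔞.schouten π P) = 0 := by
  have e := schouten_derivation h hπ π P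
  rw [h0, map_zero, LinearMap.zero_apply, hπ, zero_sub] at e
  have e' : (2 : ℝ) • 𝔞.schouten π (𝔞.schouten π P) = 0 := by
    rw [two_smul]
    nth_rw 1 [e]
    exact neg_add_cancel _
  exact (smul_eq_zero.1 e').resolve_left two_ne_zero

theorem signInvolution_schouten_of_even (𝔞 : PreBracket R L) {π : MultiSection L ev}
    (hπ : signInvolution π = π) (P : MultiSection L ev) :
    𝔞.schouten π (signInvolution P) = - signInvolution (𝔞.schouten π P) := by
  rw [signInvolution_schouten, hπ, neg_neg]

/-- A square-zero odd derivation of the Schouten bracket defines a differential graded Lie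
algebra. -/
theorem isDGLA_symBracket {𝔟 : PreBracket R L} (h : 𝔟.IsLieRinehart)
    {d : MultiSection L ev →ₗ[ℝ] MultiSection L ev}
    (hd : ∀ i, ∀ P ∈ shiftedGrading (L := L) (ev := ev) i,
      d P ∈ shiftedGrading (L := L) (ev := ev) (i + 1))
    (hτ : ∀ P, d (signInvolution P) = - signInvolution (d P)) (hdd : ∀ P, d (d P) = 0)
    (hder : ∀ P Q, d (𝔟.schouten P Q) = 𝔟.schouten (d P) Q -
      𝔟.schouten (signInvolution P) (d Q)) :
    IsDGLA (shiftedGrading (L := L) (ev := ev)) (lowForm 0 d (symBracket 𝔟)) := by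
  refine isDGLA_lowForm isParityInvolution_signInvolution (isSymmetricForm_symBracket 𝔟 hd) hτ
    (isGradedSymm_symBracket 𝔟) (isGradedJacobi_symBracket h) hdd fun P Q => ?_
  have e := hder (signInvolution P) Q
  rw [hτ, signInvolution_signInvolution, map_neg, LinearMap.neg_apply] at e
  rw [symBracket_apply, symBracket_apply, symBracket_apply, signInvolution_signInvolution, map_neg,
    e]
  abel

section PoissonNijenhuis

variable {𝔞 𝔟 : PreBracket R L} {N : L →ₗ[R] L} (hb : IsDeformation 𝔞 𝔟 N)
  (ha : 𝔞.IsLieRinehart) {π : MultiSection L ev} (hπ : signInvolution π = π)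
  (hc : ∀ P : MultiSection L ev, underline N (𝔞.schouten π P) -
      𝔞.schouten π (underline N P) - 𝔟.schouten π P = 0)

include hb hπ hc

/-- With `[π, π] = 0`, the deformation formula reads `[π, π]_N = 2[π, Nπ]`, and `hc` at `π` reads
`[π, Nπ] = -[π, π]_N`; together `3[π, π]_N = 0`. -/
theorem schouten_deformation_self (h0 : 𝔞.schouten π π = 0) : 𝔟.schouten π π = 0 := by
  have e1 := hc π
  have e2 := schouten_deformation hb π π
  have e3 := schouten_swap_of_even 𝔞 hπ (underline N π)
  rw [← underline_signInvolution, hπ] at e3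
  rw [e3, h0, map_zero] at e2
  rw [h0, map_zero] at e1
  have : (3 : ℝ) • 𝔟.schouten π π = 0 := by
    linear_combination (norm := module) e2 - (2 : ℝ) • e1
  exact (smul_eq_zero.1 this).resolve_left three_ne_zero

include ha

theorem schouten_derivation_deformation (P Q : MultiSection L ev) :
    𝔞.schouten π (𝔟.schouten P Q) =
      𝔟.schouten (𝔞.schouten π P) Q - 𝔟.schouten (signInvolution P) (𝔞.schouten π Q) := by
  have hNπ : signInvolution (underline N π) = underline N π := by
    rw [← underline_signInvolution, hπ]
  -- Substituting the deformation formula for `[π, ·]_N` into `hc` shows that `N` and `[π, ·]`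
  -- commute up to the inner operator `½[Nπ, ·]`. As `Nπ` is even too, every correction term is a
  -- derivation and they cancel.
  have e : ∀ P : MultiSection L ev, 𝔞.schouten π (underline N P) =
      underline N (𝔞.schouten π P) - (1 / 2 : ℝ) • 𝔞.schouten (underline N π) P := by
    intro P
    have e1 := hc P
    rw [schouten_deformation hb] at e1
    linear_combination (norm := module) (-1 / 2 : ℝ) • e1
  simp only [schouten_deformation hb, map_add, map_sub, e, schouten_derivation ha hπ,
    schouten_derivation ha hNπ, LinearMap.sub_apply, map_smul, LinearMap.smul_apply,
    underline_signInvolution]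
  module

end PoissonNijenhuis

end MultiSection

end Algebroid
end

noncomputable section

namespace Algebroid

open Algebroid.PreBracket Algebroid.MultiSection
open scoped Manifold ContDiff

/-! ### Local frames and their consequences for the module of sections. -/

section LocalFrames

variable {EM : Type*} [NormedAddCommGroup EM] [NormedSpace ℝ EM] [FiniteDimensional ℝ EM]
  {M : Type*} [TopologicalSpace M] [T2Space M] [ChartedSpace EM M] [IsManifold 𝓘(ℝ, EM) ∞ M]
  {F : Type*} [NormedAddCommGroup F] [NormedSpace ℝ F] [FiniteDimensional ℝ F]
  {A : M → Type*} [TopologicalSpace (Bundle.TotalSpace F A)] [∀ x, AddCommGroup (A x)]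
  [∀ x, Module ℝ (A x)] [∀ x, TopologicalSpace (A x)] [FiberBundle F A] [VectorBundle ℝ F A]
  [ContMDiffVectorBundle ∞ F A 𝓘(ℝ, EM)]

/-- Near every point the sections are spanned by a frame: after multiplication by a bump function,
every section is a combination of finitely many global ones. -/
theorem exists_frame (x : M) :
    ∃ (e : Fin (Module.finrank ℝ F) → Sec EM F A)
      (ε : Fin (Module.finrank ℝ F) → DualSec EM F A) (f : Fn EM M),
      f x ≠ 0 ∧ (∀ i, e i x ≠ 0) ∧ ∀ X, f • X = ∑ i, ε i X • e i := by
  have : ContMDiffVectorBundle 1 F A 𝓘(ℝ, EM) := ContMDiffVectorBundle.of_le (n := ∞) (by simp)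
  let b := Module.finBasis ℝ F
  let t := trivializationAt F A x
  have hx : x ∈ t.baseSet := FiberBundle.mem_baseSet_trivializationAt' x
  obtain ⟨ψ, hψ⟩ : ∃ ψ : SmoothBumpFunction 𝓘(ℝ, EM) x, tsupport ψ ⊆ t.baseSet := by
    obtain ⟨ψ, -, h⟩ := (SmoothBumpFunction.nhds_basis_tsupport (I := 𝓘(ℝ, EM)) x).mem_iff.1
      (t.open_baseSet.mem_nhds hx)
    exact ⟨ψ, h⟩
  have hψs : ContMDiff 𝓘(ℝ, EM) 𝓘(ℝ) ∞ ψ := ψ.contMDiff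
  have hout : ∀ y, y ∉ t.baseSet → ψ y = 0 := fun y hy =>
    image_eq_zero_of_notMem_tsupport fun h => hy (hψ h)
  let e : Fin (Module.finrank ℝ F) → Sec EM F A := fun i =>
    ⟨(ψ : M → ℝ) • t.localFrame b i, ContMDiffOn.smul_section_of_tsupport hψs.contMDiffOn
      t.open_baseSet hψ (t.contMDiffOn_localFrame_baseSet ∞ b i)⟩
  have hc : ∀ (X : Sec EM F A) i, ContMDiff 𝓘(ℝ, EM) 𝓘(ℝ) ∞
      (fun y => ψ y * t.localFrameCoeff 𝓘(ℝ, EM) b i y (X y)) := by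
    intro X i
    refine contMDiff_of_tsupport fun y hy => ?_
    have hy' : y ∈ t.baseSet := hψ (tsupport_mul_subset_left hy)
    exact hψs.contMDiffAt.mul (contMDiffAt_localFrameCoeff b hy' X.contMDiff.contMDiffAt i)
  let ε : Fin (Module.finrank ℝ F) → DualSec EM F A := fun i =>
    { toFun := fun X => ⟨_, hc X i⟩
      map_add' := fun X Y => by
        ext y
        change ψ y * t.localFrameCoeff 𝓘(ℝ, EM) b i y (X y + Y y) = _ * _ + _ * _
        rw [map_add, mul_add]
      map_smul' := fun f X => by
        ext y
        change ψ y * t.localFrameCoeff 𝓘(ℝ, EM) b i y (f y • X y) = f y * (ψ y * _)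
        rw [map_smul, smul_eq_mul]
        ring }
  -- One factor `ψ` extends the frame by zero to global sections, the other does so for the
  -- coefficients; hence the square.
  refine ⟨e, ε, ⟨fun y => ψ y * ψ y, hψs.mul hψs⟩, ?_, fun i => ?_, fun X => ?_⟩
  · change ψ x * ψ x ≠ 0
    rw [ψ.eq_one]
    norm_num
  · change ψ x • t.localFrame b i x ≠ 0
    rw [ψ.eq_one, one_smul, t.localFrame_apply_of_mem_baseSet b hx]
    exact (t.basisAt b hx).ne_zero i
  · ext y
    have hsum : (∑ i, ε i X • e i) y = ∑ i, (ε i X • e i) y := by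
      rw [← Finset.sum_apply]
      exact congrFun (map_sum (ContMDiffSection.coeAddHom 𝓘(ℝ, EM) F ∞ A) _ _) y
    rw [hsum]
    change (ψ y * ψ y) • X y = ∑ i, (ψ y * t.localFrameCoeff 𝓘(ℝ, EM) b i y (X y)) •
      (ψ y • t.localFrame b i y)
    by_cases hy : y ∈ t.baseSet
    · conv_lhs => rw [t.eq_sum_localFrameCoeff_smul (I := 𝓘(ℝ, EM)) (b := b) (s := X) hy]
      rw [Finset.smul_sum]
      refine Finset.sum_congr rfl fun i _ => ?_
      rw [smul_smul, smul_smul]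
      congr 1
      ring
    · simp [hout y hy]

/-- If `g x ≠ 0`, all sections vanish at `x`, although frame sections do not; so the rank, constant
as the dimension of `F`, is zero. This is the alternative needed to derive compatibility of the
anchor from the Jacobi identity. -/
theorem eq_zero_of_forall_smul (g : Fn EM M) (hg : ∀ Z : Sec EM F A, g • Z = 0) :
    g = 0 ∨ Subsingleton (Sec EM F A) := by
  by_contra! h
  obtain ⟨h0, hs⟩ := h
  obtain ⟨x, hx⟩ : ∃ x, g x ≠ 0 := by
    by_contra! h
    exact h0 (ContMDiffMap.ext h)
  have hZ : ∀ Z : Sec EM F A, Z x = 0 := fun Z => by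
    have e : g x • Z x = 0 := by rw [← smul_apply, hg]; rfl
    exact (smul_eq_zero.1 e).resolve_left hx
  obtain ⟨e, -, -, -, he, -⟩ := exists_frame (EM := EM) (F := F) (A := A) x
  have : IsEmpty (Fin (Module.finrank ℝ F)) := ⟨fun i => he i (hZ _)⟩
  have hall : ∀ Z : Sec EM F A, Z = 0 := by
    intro Z
    ext y
    obtain ⟨e, ε, f, hf, -, h⟩ := exists_frame (EM := EM) (F := F) (A := A) y
    have h' : f y • Z y = 0 := by
      rw [← smul_apply, h, Finset.univ_eq_empty, Finset.sum_empty]; rfl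
    exact (smul_eq_zero.1 h').resolve_left hf
  exact not_subsingleton (Sec EM F A) ⟨fun X Y => by rw [hall X, hall Y]⟩

theorem fn_eq_zero (Z : Fn EM M) (h : ∀ x, ∃ f : Fn EM M, evalAt x f ≠ 0 ∧ f * Z = 0) : Z = 0 := by
  ext x
  obtain ⟨f, hf, hZ⟩ := h x
  have e : f x * Z x = 0 := congrArg (fun g : Fn EM M => g x) hZ
  exact (mul_eq_zero.1 e).resolve_left hf

/-- Sections embed into multisections: passing to the quotient loses nothing in degree one. -/
theorem sec_eq_zero (Z : Sec EM F A)
    (h : mk (ev := evalAt) (ExteriorAlgebra.ι (Fn EM M) Z) = 0) : Z = 0 := by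
  ext x
  obtain ⟨f, hf, hZ⟩ := mk_eq_zero_iff.1 h x
  rw [← map_smul, ExteriorAlgebra.ι_eq_zero_iff] at hZ
  have e : f x • Z x = 0 := by rw [← smul_apply, hZ]; rfl
  exact (smul_eq_zero.1 e).resolve_left hf

theorem PreLieAlgebroid.IsLie.isLieRinehart {𝔞 : PreLieAlgebroid EM F A} (h : 𝔞.IsLie) :
    𝔞.toPreBracket.IsLieRinehart :=
  PreBracket.isLieRinehart_of_jacobi _ eq_zero_of_forall_smul h

end LocalFrames

end Algebroid
end

noncomputable section

namespace Algebroid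

open Algebroid.PreBracket Algebroid.MultiSection
open scoped Manifold ContDiff

/-! ### The forms of the theorem as instances of `lowForm`. -/

section Main

variable {EM : Type*} [NormedAddCommGroup EM] [NormedSpace ℝ EM]
  {M : Type*} [TopologicalSpace M] [ChartedSpace EM M] [IsManifold 𝓘(ℝ, EM) ∞ M]
  {F : Type*} [NormedAddCommGroup F] [NormedSpace ℝ F]
  {A : M → Type*} [TopologicalSpace (Bundle.TotalSpace F A)] [∀ x, AddCommGroup (A x)]
  [∀ x, Module ℝ (A x)] [∀ x, TopologicalSpace (A x)] [FiberBundle F A] [VectorBundle ℝ F A]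

theorem PreLieAlgebroid.isDeformation (𝔞 : PreLieAlgebroid EM F A) (N : Tensor EM F A) :
    IsDeformation 𝔞.toPreBracket (𝔞.deform N).toPreBracket N where
  bracket _ _ := rfl
  anchor _ := rfl

theorem PreLieAlgebroid.l2_eq_lowForm (𝔞 : PreLieAlgebroid EM F A) :
    𝔞.l2 = lowForm 0 0 (symBracket 𝔞.toPreBracket) := by
  funext n x
  match n with
  | 0 | 1 | 2 | _ + 3 => rfl

theorem PreLieAlgebroid.l1_add_l2_eq_lowForm (𝔞 : PreLieAlgebroid EM F A)
    (π : MultiSec EM F A) : 𝔞.l1 π + 𝔞.l2 =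
      lowForm 0 (𝔞.toPreBracket.schouten π) (symBracket 𝔞.toPreBracket) := by
  funext n x
  match n with
  | 0 | _ + 3 => exact add_zero (0 : MultiSec EM F A)
  | 1 => exact add_zero (𝔞.schouten π (x 0))
  | 2 => exact zero_add (symBracket 𝔞.toPreBracket (x 0) (x 1))

theorem PreLieAlgebroid.l2_sub_l1_eq_lowForm (𝔞 𝔟 : PreLieAlgebroid EM F A)
    (π : MultiSec EM F A) : 𝔟.l2 - 𝔞.l1 π =
      lowForm 0 (-𝔞.toPreBracket.schouten π) (symBracket 𝔟.toPreBracket) := by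
  funext n x
  match n with
  | 0 | _ + 3 => exact sub_zero (0 : MultiSec EM F A)
  | 1 => exact zero_sub (𝔞.schouten π (x 0))
  | 2 => exact sub_zero (symBracket 𝔟.toPreBracket (x 0) (x 1))

theorem oneForm_add_zeroForm (N : Tensor EM F A) (π : MultiSec EM F A) :
    oneForm (underline N) + zeroForm π = lowForm π (underline N) 0 := by
  funext n x
  match n with
  | 0 => exact zero_add π
  | 1 => exact add_zero (underline N (x 0))
  | 2 | _ + 3 => exact add_zero (0 : MultiSec EM F A)

theorem oneForm_underline (N : Tensor EM F A) :
    oneForm (underline (ev := evalAt) N) = lowForm 0 (underline N) 0 := by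
  funext n x
  match n with
  | 0 | 1 | 2 | _ + 3 => rfl

theorem isSymmetricForm_lowForm_underline (N : Tensor EM F A) {π : MultiSec EM F A}
    (hπ : π ∈ grading EM F A 0) :
    IsSymmetricForm (grading EM F A) 0 (lowForm π (underline N) 0) := by
  refine isSymmetricForm_lowForm _ _ _ _ hπ (fun i P hP => ?_) (fun _ _ _ _ _ _ => zero_mem _)
    fun _ _ _ _ _ _ => (smul_zero _).symm
  rw [add_zero]
  exact underline_mem N hP

theorem mem_grading_zero {π : MultiSec EM F A} (hπ : π ∈ Bivector EM F A) :
    π ∈ grading EM F A 0 := hπ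

end Main

end Algebroid
end

open scoped Manifold ContDiff
open Algebroid Algebroid.PreBracket Algebroid.MultiSection

theorem mainTheorem9
    {EM : Type*} [NormedAddCommGroup EM] [NormedSpace ℝ EM] [FiniteDimensional ℝ EM]
    {M : Type*} [TopologicalSpace M] [T2Space M] [SigmaCompactSpace M] [ChartedSpace EM M]
    [IsManifold 𝓘(ℝ, EM) ∞ M]
    {F : Type*} [NormedAddCommGroup F] [NormedSpace ℝ F] [FiniteDimensional ℝ F]
    {A : M → Type*} [TopologicalSpace (Bundle.TotalSpace F A)] [∀ x, AddCommGroup (A x)]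
    [∀ x, Module ℝ (A x)] [∀ x, TopologicalSpace (A x)] [FiberBundle F A] [VectorBundle ℝ F A]
    [ContMDiffVectorBundle ∞ F A 𝓘(ℝ, EM)]
    (𝔞 : LieAlgebroid EM F A) (π : MultiSec EM F A) (hπ : π ∈ Bivector EM F A)
    (N : Tensor EM F A) (hN : ∀ α : DualSec EM F A, N (sharp π α) = sharp π (α ∘ₗ N)) :
    ((IsCoboundaryNijenhuis (grading EM F A) 𝔞.l2 (oneForm (underline N) + zeroForm π)
          (oneForm (underline (N ∘ₗ N))) ∧
        curvature (oneForm (underline N) + zeroForm π) = π) ↔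
      𝔞.IsPoissonNijenhuis π N) ∧
    (𝔞.IsPoissonNijenhuis π N →
      (𝔞.deform N).IsLie ∧ (𝔞.deform N).IsPoisson π ∧
      IsDGLA (grading EM F A) ((𝔞.deform N).l1 π + (𝔞.deform N).l2) ∧
      rn (grading EM F A) 0 1 (oneForm (underline N)) 𝔞.l2 = (𝔞.deform N).l2 ∧
      rn (grading EM F A) 0 1 (oneForm (underline N) + zeroForm π) 𝔞.l2 =
        (𝔞.deform N).l2 - 𝔞.l1 π ∧
      IsDGLA (grading EM F A)
        (rn (grading EM F A) 0 1 (oneForm (underline N) + zeroForm π) 𝔞.l2)) := by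
  have hπ0 := mem_grading_zero hπ
  have hsgn : signInvolution π = π := by
    rw [signInvolution_of_mem hπ0, if_pos (by simp)]
  have hb := 𝔞.toPreLieAlgebroid.isDeformation N
  have hc := (𝔞.deform N).isDeformation N
  have hd := 𝔞.toPreLieAlgebroid.isDeformation (N ∘ₗ N)
  have hconc : (∀ P, underline N (𝔞.toPreBracket.schouten π P) -
      𝔞.toPreBracket.schouten π (underline N P) -
        (𝔞.deform N).toPreBracket.schouten π P = 0) ↔
      ∀ α β, 𝔞.koszulBracket π (α ∘ₗ N) β + 𝔞.koszulBracket π α (β ∘ₗ N) -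
        𝔞.koszulBracket π α β ∘ₗ N = (𝔞.deform N).koszulBracket π α β := by
    obtain ⟨W, hW, rfl⟩ := hπ
    refine concomitant_iff hb hW hN fn_eq_zero fun x => ?_
    obtain ⟨e, ε, f, hf, -, h⟩ := exists_frame (EM := EM) (F := F) (A := A) x
    exact ⟨_, e, ε, f, hf, h⟩
  have hnij := symBracket_eq_iff hb hc hd sec_eq_zero
  have hcob := coboundary_iff hb hc hd hsgn
  have hrn : rn (grading EM F A) 0 1 (oneForm (underline N) + zeroForm π) 𝔞.l2 =
      (𝔞.deform N).l2 - 𝔞.l1 π := by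
    rw [oneForm_add_zeroForm, 𝔞.l2_eq_lowForm, rn_lowForm_symBracket hb,
      PreLieAlgebroid.l2_sub_l1_eq_lowForm, symBracket_of_even _ hsgn, LinearMap.zero_comp,
      LinearMap.comp_zero, add_zero, sub_zero, LinearMap.zero_apply]
  refine ⟨⟨fun ⟨h, _⟩ => ?_, fun h => ⟨⟨?_, ?_, ?_, ?_⟩, zero_add π⟩⟩, fun h => ?_⟩
  · have e := h.coboundary
    rw [oneForm_add_zeroForm, oneForm_underline, 𝔞.l2_eq_lowForm] at e
    obtain ⟨h1, h2, h3⟩ := hcob.1 e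
    exact ⟨hnij.1 h3, h1, hN, hconc.1 h2⟩
  · rw [𝔞.l2_eq_lowForm]
    exact isSymmetricForm_symBracket _ fun i P _ => zero_mem _
  · rw [oneForm_add_zeroForm]
    exact isSymmetricForm_lowForm_underline N hπ0
  · rw [oneForm_underline]
    exact isSymmetricForm_lowForm_underline _ (zero_mem _)
  · rw [oneForm_add_zeroForm, oneForm_underline, 𝔞.l2_eq_lowForm]
    exact hcob.2 ⟨h.poisson, hconc.2 h.concomitant, hnij.2 h.nijenhuis⟩
  have hlie : (𝔞.deform N).IsLie :=
    hb.jacobi 𝔞.jacobi fun X Y => (sub_eq_zero.1 (h.nijenhuis X Y)).symm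
  have ha := 𝔞.jacobi.isLieRinehart
  have hP := hconc.2 h.concomitant
  have hdeg : ∀ 𝔟 : PreLieAlgebroid EM F A, ∀ i, ∀ P ∈ grading EM F A i,
      𝔟.toPreBracket.schouten π P ∈ grading EM F A (i + 1) := fun 𝔟 i P hPi => by
    have := schouten_mem 𝔟.toPreBracket hπ0 hPi
    rwa [zero_add] at this
  have hpois : (𝔞.deform N).IsPoisson π := schouten_deformation_self hb hsgn hP h.poisson
  refine ⟨hlie, hpois, ?_, ?_, hrn, ?_⟩
  · rw [PreLieAlgebroid.l1_add_l2_eq_lowForm]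
    exact isDGLA_symBracket hlie.isLieRinehart (hdeg _) (signInvolution_schouten_of_even _ hsgn)
      (schouten_schouten_self hlie.isLieRinehart hsgn hpois)
      (schouten_derivation hlie.isLieRinehart hsgn)
  · rw [oneForm_underline, 𝔞.l2_eq_lowForm, rn_lowForm_symBracket hb,
      LinearMap.zero_comp, LinearMap.comp_zero, add_zero, sub_zero, LinearMap.zero_apply, map_zero,
      PreLieAlgebroid.l2_eq_lowForm]
  · rw [hrn, PreLieAlgebroid.l2_sub_l1_eq_lowForm]
    -- Here the differential comes from `𝔞` and the bracket from its deformation: the square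
    -- vanishes because `π` is Poisson for `𝔞`, and the derivation property is
    -- `schouten_derivation_deformation`.
    refine isDGLA_symBracket hlie.isLieRinehart (fun i P hPi => neg_mem (hdeg _ i P hPi))
      (fun P => ?_) (fun P => ?_) fun P Q => ?_
    · rw [LinearMap.neg_apply, LinearMap.neg_apply, signInvolution_schouten_of_even _ hsgn, map_neg]
    · rw [LinearMap.neg_apply, LinearMap.neg_apply, map_neg, neg_neg,
        schouten_schouten_self ha hsgn h.poisson]
    · simp only [LinearMap.neg_apply, map_neg, schouten_derivation_deformation hb ha hsgn hP]
      abel
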